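/- Let $n\ge m\ge 1$ and $k\ge 0$ be integers. For a positive definite symmetric $m\times m$ matrix $r$ with leading principal minors $\Delta_0(r)=1,\Delta_1(r),\dots,\Delta_m(r)$, for $\lambda\in\mathbb C^m$ and $c\in\mathbb C$, put $$r^{\lambda}=\prod_{j=1}^m\Big[\frac{\Delta_j(r)}{\Delta_{j-1}(r)}\Big]^{\lambda_j/2},\quad \lambda_*=(\lambda_m,\dots,\lambda_1),\quad (r_*)_{i,j}=r_{m-i+1,m-j+1},\quad |\lambda|=\sum_{j=1}^m\lambda_j,\quad \mathbf c_0=(c,\dots,c),$$ and let $\Gamma_\Omega(\lambda)=\pi^{m(m-1)/4}\prod_{j=1}^m\Gamma\big((\lambda_j-j+1)/2\big)$ be the gamma function of the cone of positive definite matrices. Write a matrix $x\in\mathbb R^{n\times m}$ of rank $m$ as $x=v r^{1/2}$ with $r=x'x$ and $v'v=I_m$. The Fourier transform is $(\mathcal F\phi)(y)=\int_{\mathbb R^{n\times m}}e^{i\,\mathrm{tr}(y'x)}\phi(x)\,dx$ for Schwartz functions $\phi$, and $(\mathcal F u)(\phi)=u(\mathcal F\phi)$ for tempered distributions $u$. Let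 $P_k$ be a polynomial with complex coefficients on $\mathbb R^{n\times m}$ that is harmonic (as a function on $\mathbb R^{nm}$) and determinantally homogeneous of degree $k$: $P_k(xg)=\det(g)^kP_k(x)$ for all $g\in GL(m,\mathbb R)$. Let $U_k=\mathbb C^m$ if $k$ is even, and let $U_k$ be the complement in $\mathbb C^m$ of the polar set of $\lambda\mapsto\Gamma_\Omega(\mathbf k_0-\lambda_*)$ if $k$ is odd. Then: (a) The functions $\varphi_{\lambda,k}(x)=\dfrac{r_*^{-\lambda_*-\mathbf n_0}}{\Gamma_\Omega(-\lambda_*)}P_k(v)$ are regular tempered distributions (the integrals against Schwartz functions converge absolutely) if $\mathrm{Re}\,\lambda_j<j-m$ for all $j$, and extend to a family of tempered distributions $\varphi_{\lambda,k}$ that is holomorphic in $\lambda\in U_k$ (i.e. $\varphi_{\lambda,k}(\phi)$ is holomorphic for each Schwartz function $\phi$). (b) The functions $R_\lambda(x)=\dfrac{P_k(v)\,r^{\lambda}}{\Gamma_\Omega(\lambda+\mathbf k_0+\mathbf n_0)}$ are, in the same sense, regular tempered distributions if $\mathrm{Re}\,\lambda_j>j-n-1$ for all $j$, and extend to a family of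 tempered distributions $R_\lambda$ that is entire in $\lambda\in\mathbb C^m$. (c) The meromorphic function $\rho_k(\lambda)=\Gamma_\Omega(\mathbf k_0-\lambda_*)/\Gamma_\Omega(-\lambda_*)$ is holomorphic on $U_k$ (removable singularities being removed). (d) For all $\lambda\in U_k$, in the sense of tempered distributions, $$\mathcal F\varphi_{\lambda,k}=d_\lambda\,\rho_k(\lambda)\,R_\lambda,\quad\text{i.e.}\quad(\mathcal F\varphi_{\lambda,k})(vr^{1/2})=\frac{d_\lambda\,\Gamma_\Omega(\mathbf k_0-\lambda_*)}{\Gamma_\Omega(-\lambda_*)\,\Gamma_\Omega(\lambda+\mathbf k_0+\mathbf n_0)}\,P_k(v)\,r^{\lambda},\qquad d_\lambda=2^{-|\lambda|}\pi^{nm/2}i^{km}.$$ In other words, $d_\lambda\,\rho_k(\lambda)\,R_\lambda(\overline{\mathcal F\phi})=(2\pi)^{nm}\,\varphi_{\lambda,k}(\overline{\phi})$ for every Schwartz function $\phi$. -/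

import Mathlib

open MeasureTheory
open scoped SchwartzMap FourierTransform MatrixOrder

noncomputable section

namespace CompositeCosine

/-- The space of real `n × m` matrices as a Euclidean space (`nm` coordinates, Lebesgue measure,
inner product `tr (y' x)`); it carries the Schwartz functions and tempered distributions. -/
abbrev MatSpace (n m : ℕ) : Type := EuclideanSpace ℝ (Fin n × Fin m)

/-- The matrix with the coordinates of `x`. -/
def toMat {n m : ℕ} (x : MatSpace n m) : Matrix (Fin n) (Fin m) ℝ :=
  Matrix.of fun i j => x (i, j)

lemma inner_eq_trace {n m : ℕ} (x y : MatSpace n m) :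
    inner ℝ x y = ((toMat y).transpose * toMat x).trace := by
  simp only [PiLp.inner_apply, Matrix.trace, Matrix.diag, Matrix.mul_apply, toMat,
    Matrix.transpose_apply, Matrix.of_apply, Fintype.sum_prod_type]
  rw [Finset.sum_comm]
  simp

/-! ### The cone of positive definite matrices -/

/-- The leading principal minor of order `i` (equal to `1` for `i = 0`). -/
def leadingMinor {m : ℕ} (r : Matrix (Fin m) (Fin m) ℝ) (i : ℕ) : ℝ :=
  (r.submatrix (Subtype.val : {a : Fin m // a.val < i} → Fin m) Subtype.val).det

/-- The composite power function `r ^ l = ∏ i, (Δ_i(r) / Δ_{i-1}(r)) ^ (l_i / 2)`. -/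
def compPow {m : ℕ} (r : Matrix (Fin m) (Fin m) ℝ) (l : Fin m → ℂ) : ℂ :=
  ∏ i : Fin m, ((leadingMinor r (i.val + 1) / leadingMinor r i.val : ℝ) : ℂ) ^ (l i / 2)

/-- The reversed vector `(l_m, …, l_1)`. -/
def revVec {m : ℕ} (l : Fin m → ℂ) : Fin m → ℂ := fun j => l j.rev

/-- The matrix `ω r ω`, where `ω` is the antidiagonal permutation matrix. -/
def revMat {m : ℕ} (r : Matrix (Fin m) (Fin m) ℝ) : Matrix (Fin m) (Fin m) ℝ :=
  r.submatrix Fin.rev Fin.rev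

/-- The constant vector `(a, …, a)`. -/
def constVec (m a : ℕ) : Fin m → ℂ := fun _ => (a : ℂ)

/-- The gamma function of the cone,
`π ^ (m (m - 1) / 4) * ∏ j, Γ ((l_j - j + 1) / 2)` for `j = 1, …, m`
(the index `j : Fin m` starts at `0`). -/
def gammaCone {m : ℕ} (l : Fin m → ℂ) : ℂ :=
  (Real.pi : ℂ) ^ ((m : ℂ) * ((m : ℂ) - 1) / 4) *
    ∏ j : Fin m, Complex.Gamma ((l j - (j.val : ℂ)) / 2)

/-- `l` lies on the polar set of the gamma function of the cone: some argument
`(l_j - j + 1) / 2` is `0, -1, -2, …`. -/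
def IsGammaConePole {m : ℕ} (l : Fin m → ℂ) : Prop :=
  ∃ (j : Fin m) (p : ℕ), (l j - (j.val : ℂ)) / 2 = -(p : ℂ)

/-- The set on which the meromorphic function `Γ_Ω(k₀ - l_*) / Γ_Ω(-l_*)` of `l` is holomorphic:
for even `k` all of `ℂ ^ m` (the poles are cancelled), for odd `k` the complement of the polar
set of the numerator (no pole is cancelled). -/
def regularSet (m k : ℕ) : Set (Fin m → ℂ) :=
  {l | Odd k → ¬ IsGammaConePole (constVec m k - revVec l)}

/-! ### Polar coordinates `x = v r ^ (1/2)` -/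

/-- The radial part `r = x' x`. -/
def radial {n m : ℕ} (x : MatSpace n m) : Matrix (Fin m) (Fin m) ℝ :=
  (toMat x).transpose * toMat x

/-- The angular part `v = x r ^ (-1/2)`, with the positive semidefinite square root of `r = x' x`
(meaningful for `x` of rank `m`, hence almost everywhere if `m ≤ n`). -/
def angular {n m : ℕ} (x : MatSpace n m) : Matrix (Fin n) (Fin m) ℝ :=
  toMat x * (CFC.sqrt (radial x))⁻¹

/-! ### Polynomials on matrix space -/

/-- The value at a real matrix of a polynomial with complex coefficients in the entries. -/
def evalMat {n m : ℕ} (P : MvPolynomial (Fin n × Fin m) ℂ) (x : Matrix (Fin n) (Fin m) ℝ) : ℂ :=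
  MvPolynomial.eval (fun ij => ((x ij.1 ij.2 : ℝ) : ℂ)) P

/-- Harmonicity on `ℝ ^ (nm)`: the Laplacian of `P` vanishes. -/
def IsHarmonicPoly {n m : ℕ} (P : MvPolynomial (Fin n × Fin m) ℂ) : Prop :=
  ∑ ij : Fin n × Fin m, MvPolynomial.pderiv ij (MvPolynomial.pderiv ij P) = 0

/-- Determinantal homogeneity of degree `k`: `P (x g) = (det g) ^ k P x` for `g ∈ GL(m, ℝ)`. -/
def IsDetHomogeneous {n m : ℕ} (k : ℕ) (P : MvPolynomial (Fin n × Fin m) ℂ) : Prop :=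
  ∀ (g : Matrix (Fin m) (Fin m) ℝ), IsUnit g.det → ∀ x : Matrix (Fin n) (Fin m) ℝ,
    evalMat P (x * g) = ((g.det : ℝ) : ℂ) ^ k * evalMat P x

/-! ### Fourier transform and tempered distributions -/

/-- The dilation `y ↦ -y / (2 π)`. -/
def dilation (n m : ℕ) : MatSpace n m ≃L[ℝ] MatSpace n m :=
  ContinuousLinearEquiv.smulLeft (M₁ := MatSpace n m)
    (Units.mk0 (-(2 * Real.pi)⁻¹) (by simp [Real.pi_ne_zero]) : ℝˣ)

/-- The Fourier transform `y ↦ ∫ exp (i tr (y' x)) φ x dx` on Schwartz functions, see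
`fourierS_apply`. -/
def fourierS (n m : ℕ) : 𝓢(MatSpace n m, ℂ) →L[ℂ] 𝓢(MatSpace n m, ℂ) :=
  (SchwartzMap.compCLMOfContinuousLinearEquiv ℂ (dilation n m)).comp
    (FourierTransform.fourierCLM ℂ 𝓢(MatSpace n m, ℂ))

lemma fourierS_apply {n m : ℕ} (φ : 𝓢(MatSpace n m, ℂ)) (y : MatSpace n m) :
    fourierS n m φ y =
      ∫ x, Complex.exp (Complex.I * (((toMat y).transpose * toMat x).trace : ℝ)) * φ x := by
  have h : fourierS n m φ y = 𝓕 (φ : MatSpace n m → ℂ) (-(2 * Real.pi)⁻¹ • y) := rfl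
  rw [h, Real.fourier_eq']
  refine integral_congr_ae (Filter.Eventually.of_forall fun x => ?_)
  simp only [← inner_eq_trace, inner_smul_right, smul_eq_mul]
  congr 2
  push_cast
  have : (Real.pi : ℂ) ≠ 0 := by exact_mod_cast Real.pi_ne_zero
  field_simp

/-- The Fourier transform of a tempered distribution, `(F T) φ = T (F φ)`. -/
def fourierDist {n m : ℕ} (T : 𝓢'(MatSpace n m, ℂ)) : 𝓢'(MatSpace n m, ℂ) :=
  PointwiseConvergenceCLM.precomp ℂ (fourierS n m) T

/-- Complex conjugation of Schwartz functions. -/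
def conjS {n m : ℕ} (φ : 𝓢(MatSpace n m, ℂ)) : 𝓢(MatSpace n m, ℂ) :=
  SchwartzMap.postcompCLM (𝕜 := ℝ) (Complex.conjCLE : ℂ →L[ℝ] ℂ) φ

lemma conjS_apply {n m : ℕ} (φ : 𝓢(MatSpace n m, ℂ)) (x : MatSpace n m) :
    conjS φ x = starRingEnd ℂ (φ x) := rfl

/-- `T` is the regular distribution given by the function `f`; the integrals are absolutely
convergent. -/
def IsRegularDist {n m : ℕ} (T : 𝓢'(MatSpace n m, ℂ)) (f : MatSpace n m → ℂ) : Prop :=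
  ∀ φ : 𝓢(MatSpace n m, ℂ), Integrable (fun x => f x * φ x) ∧ T φ = ∫ x, f x * φ x

/-- The constant `d_l = 2 ^ (-|l|) π ^ (nm / 2) i ^ (km)`, with `|l| = l_1 + … + l_m`. -/
def dConst (n : ℕ) {m : ℕ} (k : ℕ) (l : Fin m → ℂ) : ℂ :=
  (2 : ℂ) ^ (-∑ j, l j) * (Real.pi : ℂ) ^ ((n : ℂ) * (m : ℂ) / 2) * Complex.I ^ (k * m)

end CompositeCosine

end

open CompositeCosine

open Filter Topology

namespace CompositeCosine

/-! ### Holomorphic functions of several variables -/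

/-! Everything rests on one functional equation between the zeta integrals Z(λ, φ) = ∫ r^λ P(v) φ(x)
dx and Z*(λ, φ) = ∫ r_*^(-λ_* - n₀) P(v) φ(x) dx. Both composite powers are superpositions of
Gaussians over the lower triangular matrices t with positive diagonal: integrating ∏ t_ii^μ_i
exp(-tr(t' r t)) gives a power of r_*, and, with s = t⁻¹, integrating ∏ t_ii^ν_i exp(-tr(s r s')/4)
gives a power of r (`triangularFamily`). The constants are products of gamma functions, which become
Γ_Ω(λ + k₀ + n₀) and d_λ Γ_Ω(k₀ - λ_*).

For fixed t, the Fourier transform of P(x) exp(-|xt|²) is a constant times det(t)^(-2k-n) P(y)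
exp(-|ys'|²/4): this is Hecke's formula for homogeneous harmonic polynomials, transported by the
determinantal homogeneity of P (`integral_evalMat_mul_gauss`). Pairing with a Schwartz function and
integrating over t gives, on the tube j - n - 1 < Re λ_j < j - m, the identity Γ_Ω(λ + k₀ + n₀)
Z*(λ, Fφ) = d_λ Γ_Ω(k₀ - λ_*) Z(λ, φ) (`gammaCone_mul_powInt_fourierS`). Absolute convergence comes
from Gram determinants: a ratio of consecutive minors is the squared distance of one column of x to
the span of p others, and a power of this distance with exponent greater than p - n is locally
integrable, uniformly in the span (`exists_lintegral_minorRatio_gram`).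

Dividing by the gamma factors leaves one holomorphic function on the half space Re λ_j > j - n - 1
and one on Re λ_j < j - m, and they agree on the tube, whose width is n - m + 1 ≥ 1. Their common
entire extension is an explicit Cauchy integral in the diagonal direction (1, …, 1): integrate over
λ + c + iℝ and λ - c + iℝ with kernel exp(z²)/z, where c is so large that these lines lie in the two
half spaces (`exists_entire_extension`). The factor exp(z²) absorbs the exponential growth of the
reciprocal gamma functions. The integrals also inherit bounds by Schwartz seminorms, so the
extension R_λ is a tempered distribution.

Finally φ_{λ,k} is defined as d_λ ρ_k(λ) R_λ ∘ F⁻¹. The Fourier formula then holds by construction,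
and on the half space Re λ_j < j - m the second description of R_λ shows that this is the regular
distribution asked for. Holomorphy on U_k is that of ρ_k, a polynomial when k is even. The Parseval
form follows from conj(Fφ) = (2π)^(nm) F⁻¹(conj φ). -/

lemma eqOn_of_convex_of_eventuallyEq {ι : Type*} [Fintype ι] {U : Set (ι → ℂ)} (hU : IsOpen U)
    (hc : Convex ℝ U) {f g : (ι → ℂ) → ℂ} (hf : DifferentiableOn ℂ f U)
    (hg : DifferentiableOn ℂ g U) {v : ι → ℂ} (hv : v ∈ U) (h : f =ᶠ[𝓝 v] g) : Set.EqOn f g U := by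
  intro w hw
  -- Restrict to the complex line through `v` and `w`. It meets `U` in a convex, hence connected,
  -- set containing 0 and 1, so the identity theorem in one variable suffices.
  let L : ℂ → (ι → ℂ) := fun z => v + z • (w - v)
  have hL : Differentiable ℂ L := by fun_prop
  let S : Set ℂ := L ⁻¹' U
  have hS : IsOpen S := hU.preimage hL.continuous
  have hSc : Convex ℝ S := by
    intro z hz z' hz' a b ha hb hab
    have := hc hz hz' ha hb hab
    change L _ ∈ U
    convert! this using 1
    simp only [L]
    ext i
    simp only [Pi.add_apply, Pi.smul_apply, Pi.sub_apply, smul_eq_mul, Complex.real_smul]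
    have hab' : (b : ℂ) = 1 - a := by rw [eq_sub_iff_add_eq, add_comm]; exact_mod_cast hab
    rw [hab']; ring
  have h0 : (0 : ℂ) ∈ S := by simpa [S, L] using hv
  have h1 : (1 : ℂ) ∈ S := by simpa [S, L] using hw
  have hfS : AnalyticOnNhd ℂ (f ∘ L) S :=
    (hf.comp hL.differentiableOn (fun z hz => hz)).analyticOnNhd hS
  have hgS : AnalyticOnNhd ℂ (g ∘ L) S :=
    (hg.comp hL.differentiableOn (fun z hz => hz)).analyticOnNhd hS
  have hev : f ∘ L =ᶠ[𝓝 0] g ∘ L := by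
    have : Tendsto L (𝓝 0) (𝓝 v) := by
      have := hL.continuous.tendsto 0
      simpa [L] using this
    exact this.eventually h
  have := hfS.eqOn_of_preconnected_of_eventuallyEq hgS hSc.isPreconnected h0 hev h1
  simpa [L] using this

/-- No bound on derivatives is assumed: Cauchy's estimate on balls of radius `ε / 2` turns the bound
for `F` into one for its derivative, and the derivative is measurable as a limit of difference
quotients. -/
lemma differentiableAt_integral_of_dominated {ι α : Type*} [Fintype ι] [MeasurableSpace α]
    {μ : Measure α} {F : (ι → ℂ) → α → ℂ} {l₀ : ι → ℂ} {ε : ℝ} (hε : 0 < ε) {bound : α → ℝ}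
    (hmeas : ∀ l ∈ Metric.ball l₀ ε, AEStronglyMeasurable (F l) μ)
    (hdiff : ∀ᵐ a ∂μ, DifferentiableOn ℂ (fun l => F l a) (Metric.ball l₀ ε))
    (hbound : ∀ᵐ a ∂μ, ∀ l ∈ Metric.ball l₀ ε, ‖F l a‖ ≤ bound a) (hint : Integrable bound μ) :
    DifferentiableAt ℂ (fun l => ∫ a, F l a ∂μ) l₀ := by
  classical
  have hl₀ : l₀ ∈ Metric.ball l₀ ε := Metric.mem_ball_self hε
  have hdiffAt : ∀ᵐ a ∂μ, ∀ l ∈ Metric.ball l₀ (ε / 2),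
      HasFDerivAt (fun l => F l a) (fderiv ℂ (fun l => F l a) l) l := by
    filter_upwards [hdiff] with a ha l hl
    exact (ha.differentiableAt (Metric.isOpen_ball.mem_nhds
      (Metric.ball_subset_ball (by linarith) hl))).hasFDerivAt
  have hcoord : ∀ i, AEStronglyMeasurable
      (fun a => fderiv ℂ (fun l => F l a) l₀ (Pi.single i 1)) μ := by
    intro i
    -- The shift by 2 keeps `l₀ + e N • Pi.single i 1` strictly inside the ball, even for `N = 0`.
    let e : ℕ → ℝ := fun N => ε / (N + 2)
    have he : Tendsto e atTop (𝓝 0) := by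
      have := tendsto_const_div_atTop_nhds_zero_nat ε
      have h2 := this.comp (tendsto_add_atTop_nat 2)
      refine h2.congr fun N => ?_
      simp [e]
    have hepos : ∀ N, 0 < e N := fun N => by positivity
    have hein : ∀ N, l₀ + (e N : ℂ) • (Pi.single i (1 : ℂ) : ι → ℂ) ∈ Metric.ball l₀ ε := by
      intro N
      rw [mem_ball_iff_norm, add_sub_cancel_left, norm_smul, Pi.norm_single]
      simp only [Complex.norm_real, norm_one, mul_one, Real.norm_of_nonneg (hepos N).le, e]
      rw [div_lt_iff₀ (by positivity)]
      have : (0 : ℝ) ≤ N := Nat.cast_nonneg N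
      nlinarith
    refine aestronglyMeasurable_of_tendsto_ae (u := atTop)
      (f := fun N a => ((e N : ℂ))⁻¹ • (F (l₀ + (e N : ℂ) • Pi.single i 1) a - F l₀ a)) ?_ ?_
    · intro N
      exact ((hmeas _ (hein N)).sub (hmeas _ hl₀)).const_smul ((e N : ℂ)⁻¹)
    · filter_upwards [hdiffAt] with a ha
      have h1 := (ha l₀ (Metric.mem_ball_self (by linarith))).hasLineDerivAt (Pi.single i 1)
      have h2 := (h1 : HasDerivAt _ _ _).tendsto_slope_zero
      have h3 : Tendsto (fun N => (e N : ℂ)) atTop (𝓝[≠] 0) := by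
        rw [tendsto_nhdsWithin_iff]
        refine ⟨?_, Eventually.of_forall fun N => by simpa using (hepos N).ne'⟩
        have := (Complex.continuous_ofReal.tendsto 0).comp he
        simpa [Function.comp_def] using this
      simpa only [Function.comp_def, zero_add, zero_smul, add_zero] using h2.comp h3
  have hrep : ∀ A : (ι → ℂ) →L[ℂ] ℂ,
      A = ∑ i, A (Pi.single i 1) • ContinuousLinearMap.proj (R := ℂ) (φ := fun _ : ι => ℂ) i := by
    intro A
    ext v
    conv_lhs => rw [pi_eq_sum_univ' v, map_sum]
    simp [mul_comm]
  refine (hasFDerivAt_integral_of_dominated_of_fderiv_le (𝕜 := ℂ)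
    (F' := fun l a => fderiv ℂ (fun l => F l a) l)
    (bound := fun a => (2 * bound a) / (ε / 2)) (s := Metric.ball l₀ (ε / 2))
    (Metric.ball_mem_nhds _ (by linarith)) ?_ ?_ ?_ ?_ ?_ ?_).differentiableAt
  · filter_upwards [Metric.ball_mem_nhds l₀ hε] with l hl using hmeas l hl
  · refine hint.mono' (hmeas _ hl₀) ?_
    filter_upwards [hbound] with a ha using ha _ hl₀
  · have : (fun a => fderiv ℂ (fun l => F l a) l₀) = fun a =>
        ∑ i, fderiv ℂ (fun l => F l a) l₀ (Pi.single i 1) •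
          ContinuousLinearMap.proj (R := ℂ) (φ := fun _ : ι => ℂ) i := funext fun a => hrep _
    rw [this]
    refine Finset.aestronglyMeasurable_fun_sum _ fun i _ => (hcoord i).smul_const _
  · filter_upwards [hdiff, hbound] with a ha hb l hl
    have hsub : Metric.ball l (ε / 2) ⊆ Metric.ball l₀ ε := by
      intro w hw
      rw [Metric.mem_ball] at *
      linarith [dist_triangle w l l₀]
    refine Complex.norm_fderiv_le_div_of_mapsTo_ball (ha.mono hsub) ?_ (by linarith)
    intro w hw
    rw [mem_closedBall_iff_norm]
    have h1 := hb w (hsub hw)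
    have h2 := hb l (hsub (Metric.mem_ball_self (by linarith)))
    linarith [norm_sub_le (F w a) (F l a)]
  · exact (hint.const_mul 2).div_const _
  · exact hdiffAt

/-! ### Bounds for the reciprocal gamma function -/

lemma norm_Gamma_le_of_re_pos {s : ℂ} (hs : 0 < s.re) : ‖Complex.Gamma s‖ ≤ Real.Gamma s.re := by
  rw [Complex.Gamma_eq_integral hs, Complex.GammaIntegral, Real.Gamma_eq_integral hs]
  refine (norm_integral_le_integral_norm _).trans (le_of_eq ?_)
  refine setIntegral_congr_fun measurableSet_Ioi fun x hx => ?_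
  have hx : 0 < x := hx
  simp only [norm_mul, Complex.norm_real, Real.norm_eq_abs, abs_of_pos (Real.exp_pos _),
    Complex.norm_cpow_eq_rpow_re_of_pos hx, Complex.sub_re, Complex.one_re]

lemma norm_sin_le_exp (s : ℂ) : ‖Complex.sin s‖ ≤ Real.exp |s.im| := by
  rw [Complex.sin, norm_div, norm_mul, Complex.norm_I, mul_one, Complex.norm_ofNat]
  have h1 : ‖Complex.exp (-s * Complex.I)‖ ≤ Real.exp |s.im| := by
    rw [Complex.norm_exp]
    refine Real.exp_le_exp.2 ?_
    simpa using le_abs_self _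
  have h2 : ‖Complex.exp (s * Complex.I)‖ ≤ Real.exp |s.im| := by
    rw [Complex.norm_exp]
    refine Real.exp_le_exp.2 ?_
    simpa using neg_le_abs _
  have := norm_sub_le (Complex.exp (-s * Complex.I)) (Complex.exp (s * Complex.I))
  linarith

/-- Reflection: 1/Γ(s) = Γ(1 - s) sin(πs)/π. For Re s ≤ 1/2 the real part of 1 - s stays in a
compact subinterval of (0, ∞), so only the sine grows; 4 is a crude bound for π. -/
lemma exists_norm_inv_Gamma_le_of_re_le (a : ℝ) : ∃ C : ℝ, 0 ≤ C ∧ ∀ s : ℂ, a ≤ s.re →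
    s.re ≤ 1 / 2 → ‖(Complex.Gamma s)⁻¹‖ ≤ C * Real.exp (4 * |s.im|) := by
  have hcont : ContinuousOn Real.Gamma (Set.Icc (1 / 2) (1 - a)) := by
    intro x hx
    refine (Real.differentiableAt_Gamma fun m => ?_).continuousAt.continuousWithinAt
    have : (0 : ℝ) ≤ m := Nat.cast_nonneg m
    linarith [hx.1]
  obtain ⟨C, hC⟩ := isCompact_Icc.exists_bound_of_continuousOn hcont
  refine ⟨|C|, abs_nonneg _, fun s h1 h2 => ?_⟩
  have hre : (1 - s).re = 1 - s.re := by simp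
  have hpos : 0 < (1 - s).re := by rw [hre]; linarith
  have hG : ‖Complex.Gamma (1 - s)‖ ≤ |C| := by
    refine (norm_Gamma_le_of_re_pos hpos).trans ?_
    have := hC (1 - s).re ⟨by rw [hre]; linarith, by rw [hre]; linarith⟩
    exact (Real.le_norm_self _).trans (this.trans (le_abs_self _))
  have hne : Complex.Gamma (1 - s) ≠ 0 := Complex.Gamma_ne_zero_of_re_pos hpos
  have hrefl := Complex.Gamma_mul_Gamma_one_sub s
  have hpi : (Real.pi : ℂ) ≠ 0 := by exact_mod_cast Real.pi_ne_zero
  have hinv : (Complex.Gamma s)⁻¹ =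
      Complex.Gamma (1 - s) * Complex.sin (Real.pi * s) / Real.pi := by
    have h3 : Complex.Gamma s = Real.pi / Complex.sin (Real.pi * s) / Complex.Gamma (1 - s) := by
      rw [← hrefl]; field_simp
    rw [h3, div_div, inv_div]
    ring
  rw [hinv, norm_div, norm_mul, Complex.norm_real, Real.norm_of_nonneg Real.pi_pos.le]
  have hsin := norm_sin_le_exp (Real.pi * s)
  have him : |(Real.pi * s : ℂ).im| ≤ 4 * |s.im| := by
    simp only [Complex.mul_im, Complex.ofReal_re, Complex.ofReal_im, zero_mul, add_zero, abs_mul,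
      abs_of_pos Real.pi_pos]
    exact mul_le_mul_of_nonneg_right Real.pi_le_four (abs_nonneg _)
  have hsin' := hsin.trans (Real.exp_le_exp.2 him)
  have h5 : ‖Complex.Gamma (1 - s)‖ * ‖Complex.sin (Real.pi * s)‖ ≤
      |C| * Real.exp (4 * |s.im|) :=
    mul_le_mul hG hsin' (norm_nonneg _) (abs_nonneg _)
  refine (div_le_self (by positivity) ?_).trans h5
  linarith [Real.pi_gt_three]

/-- The recursion 1/Γ(s) = 1/((s - 1) Γ(s - 1)) moves the previous bound to the right unit by unit,
without loss where |Im s| ≥ 1. The remaining rectangle is compact and 1/Γ is entire. -/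
lemma exists_norm_inv_Gamma_le (a b : ℝ) : ∃ C : ℝ, 0 ≤ C ∧ ∀ s : ℂ, a ≤ s.re →
    s.re ≤ b → ‖(Complex.Gamma s)⁻¹‖ ≤ C * Real.exp (4 * |s.im|) := by
  have key : ∀ n : ℕ, ∀ a : ℝ, ∃ C : ℝ, 0 ≤ C ∧ ∀ s : ℂ, a ≤ s.re → s.re ≤ 1 / 2 + n →
      1 ≤ |s.im| → ‖(Complex.Gamma s)⁻¹‖ ≤ C * Real.exp (4 * |s.im|) := by
    intro n
    induction n with
    | zero =>
      intro a
      obtain ⟨C, hC0, hC⟩ := exists_norm_inv_Gamma_le_of_re_le a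
      exact ⟨C, hC0, fun s h1 h2 _ => hC s h1 (by simpa using h2)⟩
    | succ n ih =>
      intro a
      obtain ⟨C, hC0, hC⟩ := ih (a - 1)
      refine ⟨C, hC0, fun s h1 h2 h3 => ?_⟩
      have h4 := hC (s - 1) (by simpa using h1) (by push_cast at h2; simp; linarith)
        (by simpa using h3)
      have him : (s - 1).im = s.im := by simp
      rw [him] at h4
      have hn : 1 ≤ ‖s - 1‖ := h3.trans (him ▸ Complex.abs_im_le_norm (s - 1))
      have hne : s - 1 ≠ 0 := by
        intro h0; rw [h0, norm_zero] at hn; linarith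
      have hrec := Complex.Gamma_add_one (s - 1) hne
      rw [sub_add_cancel] at hrec
      rw [hrec, mul_inv, norm_mul, norm_inv (s - 1)]
      refine le_trans ?_ h4
      exact mul_le_of_le_one_left (norm_nonneg _) (inv_le_one_of_one_le₀ hn)
  obtain ⟨n, hn⟩ := exists_nat_ge b
  obtain ⟨C, hC0, hC⟩ := key n a
  have hK : IsCompact (Set.Icc a b ×ℂ Set.Icc (-1) 1) := isCompact_Icc.reProdIm isCompact_Icc
  obtain ⟨C', hC'⟩ := hK.exists_bound_of_continuousOn
    (Complex.differentiable_one_div_Gamma.continuous.continuousOn)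
  refine ⟨max C |C'|, le_max_of_le_left hC0, fun s h1 h2 => ?_⟩
  rcases le_total 1 |s.im| with h | h
  · refine (hC s h1 (by linarith) h).trans ?_
    gcongr
    exact le_max_left _ _
  · refine (hC' s ⟨⟨h1, h2⟩, abs_le.1 h⟩).trans ?_
    have : (1 : ℝ) ≤ Real.exp (4 * |s.im|) := Real.one_le_exp (by positivity)
    calc C' ≤ max C |C'| := (le_abs_self _).trans (le_max_right _ _)
      _ ≤ _ := le_mul_of_one_le_right (le_max_of_le_left hC0) this

/-! ### A Cauchy formula for strips -/

/-- Cauchy's theorem on the rectangles with vertices ±c ± iT; the horizontal sides are O(exp(-T)).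
-/
lemma integral_vertical_eq_of_decay {g : ℂ → ℂ} (hg : Differentiable ℂ g) {c C : ℝ}
    (hdec : ∀ x τ : ℝ, |x| ≤ |c| → 1 ≤ |τ| → ‖g (x + τ * Complex.I)‖ ≤ C * Real.exp (-|τ|)) :
    Integrable (fun τ : ℝ => g (c + τ * Complex.I)) ∧
    Integrable (fun τ : ℝ => g (-c + τ * Complex.I)) ∧
    ∫ τ : ℝ, g (c + τ * Complex.I) = ∫ τ : ℝ, g (-c + τ * Complex.I) := by
  have hint : ∀ x : ℝ, |x| ≤ |c| → Integrable (fun τ : ℝ => g (x + τ * Complex.I)) := by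
    intro x hx
    have hcont : Continuous (fun τ : ℝ => g (x + τ * Complex.I)) := by
      have := hg.continuous
      fun_prop
    refine hcont.locallyIntegrable.integrable_of_isBigO_atBot_atTop
      (g := fun τ => Real.exp (-|τ|)) (g' := fun τ => Real.exp (-|τ|)) ?_ ?_ ?_ ?_
    · refine Asymptotics.IsBigO.of_bound C ?_
      filter_upwards [eventually_le_atBot (-1 : ℝ)] with τ hτ
      rw [Real.norm_of_nonneg (Real.exp_pos _).le]
      exact hdec x τ hx (by rw [abs_of_nonpos (by linarith)]; linarith)
    · refine ⟨Set.Iic 0, Iic_mem_atBot 0, ?_⟩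
      refine (integrableOn_exp_Iic 0).congr_fun (fun τ hτ => ?_) measurableSet_Iic
      rw [Set.mem_Iic] at hτ
      simp [abs_of_nonpos hτ]
    · refine Asymptotics.IsBigO.of_bound C ?_
      filter_upwards [eventually_ge_atTop (1 : ℝ)] with τ hτ
      rw [Real.norm_of_nonneg (Real.exp_pos _).le]
      exact hdec x τ hx (by rw [abs_of_nonneg (by linarith)]; linarith)
    · refine ⟨Set.Ioi 0, Ioi_mem_atTop 0, ?_⟩
      refine (integrableOn_exp_neg_Ioi 0).congr_fun (fun τ hτ => ?_) measurableSet_Ioi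
      rw [Set.mem_Ioi] at hτ
      simp [abs_of_pos hτ]
  have h1 := hint c le_rfl
  have h2 := hint (-c) (by simp)
  refine ⟨h1, by simpa using h2, ?_⟩
  have hrect : ∀ T : ℝ, (∫ x : ℝ in -c..c, g (x + (-T : ℝ) * Complex.I)) -
      (∫ x : ℝ in -c..c, g (x + T * Complex.I)) +
      Complex.I • (∫ y : ℝ in -T..T, g (c + y * Complex.I)) -
      Complex.I • (∫ y : ℝ in -T..T, g ((-c : ℝ) + y * Complex.I)) = 0 := by
    intro T
    have := Complex.integral_boundary_rect_eq_zero_of_differentiableOn g (⟨-c, -T⟩ : ℂ) ⟨c, T⟩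
      hg.differentiableOn
    simpa using this
  have hbd : ∀ (s : ℝ), |s| = 1 → Tendsto
      (fun T : ℝ => ∫ x : ℝ in -c..c, g (x + (s * T : ℝ) * Complex.I)) atTop (𝓝 0) := by
    intro s hs
    have hlim : Tendsto (fun T : ℝ => C * Real.exp (-T) * |c - -c|) atTop (𝓝 0) := by
      have := (Real.tendsto_exp_neg_atTop_nhds_zero.const_mul C).mul_const |c - -c|
      simpa using this
    refine squeeze_zero_norm' ?_ hlim
    filter_upwards [eventually_ge_atTop (1 : ℝ)] with T hT
    refine intervalIntegral.norm_integral_le_of_norm_le_const fun x hx => ?_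
    have hx' : |x| ≤ |c| := by
      rw [Set.mem_uIoc] at hx
      rcases hx with hx | hx
      · rw [abs_le]
        have := le_abs_self c
        constructor <;> linarith [hx.1, hx.2]
      · rw [abs_le]
        have := neg_le_abs c
        constructor <;> linarith [hx.1, hx.2]
    have habs : |s * T| = T := by rw [abs_mul, hs, one_mul, abs_of_nonneg (by linarith)]
    have := hdec x (s * T) hx' (by rw [habs]; exact hT)
    rwa [habs] at this
  have l1 := hbd (-1) (by simp)
  have l2 := hbd 1 (by simp)
  have l3 := intervalIntegral_tendsto_integral h1 tendsto_neg_atTop_atBot tendsto_id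
  have l4 := intervalIntegral_tendsto_integral h2 tendsto_neg_atTop_atBot tendsto_id
  have l5 := ((l1.sub l2).add (l3.const_smul Complex.I)).sub (l4.const_smul Complex.I)
  have l6 := tendsto_nhds_unique (l5.congr fun T => by simpa using hrect T) tendsto_const_nhds
  have l7 : Complex.I * (∫ τ : ℝ, g (c + τ * Complex.I)) =
      Complex.I * ∫ τ : ℝ, g ((-c : ℝ) + τ * Complex.I) := by
    simpa [sub_eq_zero] using l6
  simpa using mul_left_cancel₀ Complex.I_ne_zero l7

/-- Write 1/(c + iτ) as ∫ exp(-(c + iτ)u) du over u > 0 and exchange the integrals. The inner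
Gaussian integral is √π exp(-u²/4), whose integral over the half-line is π. Each of the lines ±c
thus carries half of the residue at 0. -/
lemma integral_exp_sq_div (c : ℝ) (hc : 0 < c) :
    ∫ τ : ℝ, Complex.exp ((c + τ * Complex.I) ^ 2) / (c + τ * Complex.I) = Real.pi := by
  have hinner : ∀ τ : ℝ, ∫ u in Set.Ioi (0 : ℝ),
      Complex.exp ((c + τ * Complex.I) ^ 2) * Complex.exp (-(c + τ * Complex.I) * u) =
      Complex.exp ((c + τ * Complex.I) ^ 2) / (c + τ * Complex.I) := by
    intro τ
    rw [integral_const_mul, integral_exp_mul_complex_Ioi (by simpa using hc)]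
    simp only [Complex.ofReal_zero, mul_zero, Complex.exp_zero, neg_div_neg_eq, mul_one_div]
  simp_rw [← hinner]
  have hnorm : ∀ τ u : ℝ, ‖Complex.exp ((c + τ * Complex.I) ^ 2) *
      Complex.exp (-(c + τ * Complex.I) * u)‖ =
      Real.exp (c ^ 2) * Real.exp (-1 * τ ^ 2) * Real.exp (-c * u) := by
    intro τ u
    rw [norm_mul, Complex.norm_exp, Complex.norm_exp, ← Real.exp_add, ← Real.exp_add,
      ← Real.exp_add]
    congr 1
    simp [pow_two]
    ring
  have hint : Integrable (Function.uncurry fun τ u : ℝ => Complex.exp ((c + τ * Complex.I) ^ 2) *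
      Complex.exp (-(c + τ * Complex.I) * u)) (volume.prod (volume.restrict (Set.Ioi 0))) := by
    have h1 : Integrable (fun p : ℝ × ℝ => (Real.exp (c ^ 2) * Real.exp (-1 * p.1 ^ 2)) *
        Real.exp (-c * p.2)) (volume.prod (volume.restrict (Set.Ioi 0))) :=
      ((integrable_exp_neg_mul_sq one_pos).const_mul _).mul_prod
        (exp_neg_integrableOn_Ioi 0 hc)
    refine h1.mono' (by
      apply Continuous.aestronglyMeasurable
      unfold Function.uncurry
      fun_prop) (Eventually.of_forall fun p => ?_)
    exact (hnorm p.1 p.2).le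
  rw [integral_integral_swap hint]
  have hin : ∀ u : ℝ, ∫ τ : ℝ, Complex.exp ((c + τ * Complex.I) ^ 2) *
      Complex.exp (-(c + τ * Complex.I) * u) =
      ((Real.sqrt Real.pi * Real.exp (-(1 / 4) * u ^ 2) : ℝ) : ℂ) := by
    intro u
    have h := integral_cexp_quadratic (b := -1) (by simp) (2 * c * Complex.I - u * Complex.I)
      (c ^ 2 - u * c)
    have h1 : ∀ τ : ℝ, Complex.exp ((c + τ * Complex.I) ^ 2) *
        Complex.exp (-(c + τ * Complex.I) * u) = Complex.exp (-1 * τ ^ 2 +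
          (2 * c * Complex.I - u * Complex.I) * τ + (c ^ 2 - u * c)) := by
      intro τ
      rw [← Complex.exp_add]
      congr 1
      linear_combination ((τ : ℂ) ^ 2) * Complex.I_sq
    simp_rw [h1]
    rw [h, Complex.ofReal_mul, Complex.ofReal_exp, Real.sqrt_eq_rpow,
      Complex.ofReal_cpow Real.pi_pos.le]
    congr 1
    · simp
    · congr 1
      push_cast
      linear_combination (1 / 4 * (2 * c - u) ^ 2 : ℂ) * Complex.I_sq
  simp_rw [hin]
  rw [integral_complex_ofReal, integral_const_mul, integral_gaussian_Ioi]
  congr 1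
  rw [show Real.pi / (1 / 4) = 2 ^ 2 * Real.pi by ring, Real.sqrt_mul (by norm_num),
    Real.sqrt_sq (by norm_num)]
  linear_combination Real.mul_self_sqrt Real.pi_pos.le

/-- Used to absorb growth of rate `A` into the decay of exp(z²) along vertical lines, with exp(-|τ|)
to spare. -/
lemma exp_linear_sub_sq_le (A t : ℝ) :
    Real.exp (A * t) * Real.exp (-t ^ 2) ≤ Real.exp ((A + 1) ^ 2) * Real.exp (-t) := by
  rw [← Real.exp_add, ← Real.exp_add]
  refine Real.exp_le_exp.2 ?_
  nlinarith [sq_nonneg (t - (A + 1) / 2)]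

/-- An entire function of exponential growth on a vertical strip is recovered from its values on
the two boundary lines. -/
lemma cauchy_strip {f : ℂ → ℂ} (hf : Differentiable ℂ f) {c C A : ℝ} (hc : 0 < c) (hC : 0 ≤ C)
    (hA : 0 ≤ A)
    (hgr : ∀ x τ : ℝ, |x| ≤ c → ‖f (x + τ * Complex.I)‖ ≤ C * Real.exp (A * |τ|)) :
    (∫ τ : ℝ, f (c + τ * Complex.I) *
        (Complex.exp ((c + τ * Complex.I) ^ 2) / (c + τ * Complex.I))) -
      ∫ τ : ℝ, f (-c + τ * Complex.I) *
        (Complex.exp ((-c + τ * Complex.I) ^ 2) / (-c + τ * Complex.I)) = 2 * Real.pi * f 0 := by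
  -- After subtracting `f 0`, the quotient by `z` has no pole and is entire as a `dslope`, so its
  -- integrals over the two lines agree. The subtracted terms contribute `π * f 0` on the line `c`
  -- and, by the reflection τ ↦ -τ, `-π * f 0` on the line `-c`.
  have hgd : Differentiable ℂ (fun z => (f z - f 0) * Complex.exp (z ^ 2)) := by fun_prop
  have hk : Differentiable ℂ (dslope (fun z => (f z - f 0) * Complex.exp (z ^ 2)) 0) := by
    have := (Complex.differentiableOn_dslope (s := Set.univ) (c := (0 : ℂ)) univ_mem).2
      hgd.differentiableOn
    exact differentiableOn_univ.1 this
  have hkz : ∀ z : ℂ, z ≠ 0 → dslope (fun z => (f z - f 0) * Complex.exp (z ^ 2)) 0 z =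
      f z * (Complex.exp (z ^ 2) / z) - f 0 * (Complex.exp (z ^ 2) / z) := by
    intro z hz
    rw [dslope_of_ne _ hz, slope_def_field]
    simp
    ring
  have hnexp : ∀ x τ : ℝ, ‖Complex.exp ((x + τ * Complex.I) ^ 2)‖ =
      Real.exp (x ^ 2) * Real.exp (-|τ| ^ 2) := by
    intro x τ
    rw [Complex.norm_exp, ← Real.exp_add]
    congr 1
    simp [pow_two]
    ring
  have hf0 : ‖f 0‖ ≤ C := by simpa using hgr 0 0 (by simpa using hc.le)
  have hdec : ∀ x τ : ℝ, |x| ≤ |c| → 1 ≤ |τ| →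
      ‖dslope (fun z => (f z - f 0) * Complex.exp (z ^ 2)) 0 (x + τ * Complex.I)‖ ≤
      (2 * C * Real.exp (c ^ 2) * Real.exp ((A + 1) ^ 2)) * Real.exp (-|τ|) := by
    intro x τ hx hτ
    rw [abs_of_pos hc] at hx
    have h1 : 1 ≤ ‖(x + τ * Complex.I : ℂ)‖ := by
      refine hτ.trans ?_
      simpa using Complex.abs_im_le_norm (x + τ * Complex.I : ℂ)
    have hz : (x + τ * Complex.I : ℂ) ≠ 0 := by
      intro h0; rw [h0, norm_zero] at h1; linarith
    rw [hkz _ hz, ← sub_mul, norm_mul, norm_div, hnexp]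
    have hE : 1 ≤ Real.exp (A * |τ|) := Real.one_le_exp (by positivity)
    have h2 : ‖f (x + τ * Complex.I) - f 0‖ ≤ 2 * C * Real.exp (A * |τ|) := by
      have := norm_sub_le (f (x + τ * Complex.I)) (f 0)
      nlinarith [hgr x τ hx]
    have hx2 : Real.exp (x ^ 2) ≤ Real.exp (c ^ 2) := by
      refine Real.exp_le_exp.2 ?_
      rw [← sq_abs]
      exact pow_le_pow_left₀ (abs_nonneg _) hx 2
    have h3 : Real.exp (x ^ 2) * Real.exp (-|τ| ^ 2) / ‖(x + τ * Complex.I : ℂ)‖ ≤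
        Real.exp (c ^ 2) * Real.exp (-|τ| ^ 2) :=
      (div_le_self (by positivity) h1).trans (by gcongr)
    calc _ ≤ (2 * C * Real.exp (A * |τ|)) * (Real.exp (c ^ 2) * Real.exp (-|τ| ^ 2)) :=
          mul_le_mul h2 h3 (by positivity) (by positivity)
      _ = (2 * C * Real.exp (c ^ 2)) * (Real.exp (A * |τ|) * Real.exp (-|τ| ^ 2)) := by ring
      _ ≤ (2 * C * Real.exp (c ^ 2)) * (Real.exp ((A + 1) ^ 2) * Real.exp (-|τ|)) :=
          mul_le_mul_of_nonneg_left (exp_linear_sub_sq_le A _) (by positivity)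
      _ = _ := by ring
  obtain ⟨i1, i2, heq⟩ := integral_vertical_eq_of_decay hk hdec
  have hne1 : ∀ τ : ℝ, (c + τ * Complex.I : ℂ) ≠ 0 := by
    intro τ h0
    have := congrArg Complex.re h0
    simp at this; exact hc.ne' this
  have hne2 : ∀ τ : ℝ, (-c + τ * Complex.I : ℂ) ≠ 0 := by
    intro τ h0
    have := congrArg Complex.re h0
    simp at this; exact hc.ne' this
  have hKdec : ∀ (x : ℝ), |x| = c → Integrable (fun τ : ℝ =>
      Complex.exp ((x + τ * Complex.I) ^ 2) / (x + τ * Complex.I)) := by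
    intro x hx
    have hne : ∀ τ : ℝ, (x + τ * Complex.I : ℂ) ≠ 0 := by
      intro τ h0
      have := congrArg Complex.re h0
      simp at this
      rw [this] at hx; simp at hx; exact hc.ne hx
    have hb : Integrable (fun τ : ℝ => Real.exp (x ^ 2) / c * Real.exp (-1 * τ ^ 2)) :=
      (integrable_exp_neg_mul_sq one_pos).const_mul _
    refine hb.mono' ?_ (Eventually.of_forall fun τ => ?_)
    · apply Continuous.aestronglyMeasurable
      exact Continuous.div (by fun_prop) (by fun_prop) hne
    · rw [norm_div, hnexp, sq_abs, mul_comm (_ / c), ← mul_div_assoc, mul_comm (Real.exp (x ^ 2)),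
        neg_one_mul]
      refine div_le_div_of_nonneg_left (by positivity) hc ?_
      rw [← hx]
      simpa using Complex.abs_re_le_norm (x + τ * Complex.I : ℂ)
  have iK1 := hKdec c (abs_of_pos hc)
  have iK2 := hKdec (-c) (by rw [abs_neg, abs_of_pos hc])
  push_cast at iK2
  simp_rw [hkz _ (hne1 _)] at i1 heq
  simp_rw [hkz _ (hne2 _)] at i2 heq
  have j1 := i1.add (iK1.const_mul (f 0))
  have j2 := i2.add (iK2.const_mul (f 0))
  simp only [Pi.add_def, sub_add_cancel] at j1 j2
  rw [integral_sub j1 (iK1.const_mul _), integral_sub j2 (iK2.const_mul _), integral_const_mul,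
    integral_const_mul, integral_exp_sq_div c hc] at heq
  have hneg : ∫ τ : ℝ, Complex.exp ((-c + τ * Complex.I) ^ 2) / (-c + τ * Complex.I) =
      -Real.pi := by
    rw [← integral_exp_sq_div c hc, ← integral_neg, ← integral_neg_eq_self]
    refine integral_congr_ae (Eventually.of_forall fun τ => ?_)
    simp only [Complex.ofReal_neg]
    rw [← div_neg]
    congr 2 <;> ring
  rw [hneg] at heq
  linear_combination heq

/-! ### Leading minors and Schur complements -/

/-- The lower right block of size `m`. -/
def tailMat {m : ℕ} (r : Matrix (Fin (m + 1)) (Fin (m + 1)) ℝ) : Matrix (Fin m) (Fin m) ℝ :=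
  r.submatrix Fin.succ Fin.succ

/-- The Schur complement of the upper left entry. -/
noncomputable def schurMat {m : ℕ} (r : Matrix (Fin (m + 1)) (Fin (m + 1)) ℝ) : Matrix (Fin m) (Fin m) ℝ :=
  Matrix.of fun i j => r i.succ j.succ - r i.succ 0 / r 0 0 * r 0 j.succ

/-- Subtracting multiples of the first row clears the first column and leaves the Schur complement
as the lower right block. -/
lemma det_eq_mul_det_schurMat {m : ℕ} (r : Matrix (Fin (m + 1)) (Fin (m + 1)) ℝ)
    (h : r 0 0 ≠ 0) : r.det = r 0 0 * (schurMat r).det := by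
  let B : Matrix (Fin (m + 1)) (Fin (m + 1)) ℝ :=
    Matrix.of fun i j => r i j - (Fin.cons 0 (fun i : Fin m => r i.succ 0 / r 0 0) :
      Fin (m + 1) → ℝ) i * r 0 j
  have hB : r.det = B.det := by
    refine Matrix.det_eq_of_forall_row_eq_smul_add_const
      (Fin.cons 0 (fun i : Fin m => r i.succ 0 / r 0 0)) 0 (by simp) fun i j => ?_
    simp [B]
  rw [hB, Matrix.det_succ_column_zero, Fin.sum_univ_succ]
  have h0 : ∀ i : Fin m, B i.succ 0 = 0 := by
    intro i
    simp [B, h]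
  simp only [h0, mul_zero, zero_mul, Finset.sum_const_zero, add_zero]
  have : B.submatrix (Fin.succAbove 0) Fin.succ = schurMat r := by
    ext i j
    simp [B, schurMat]
  rw [this]
  simp [B]

lemma leadingMinor_eq_det_castLE {m i : ℕ} (h : i ≤ m) (r : Matrix (Fin m) (Fin m) ℝ) :
    leadingMinor r i = (r.submatrix (Fin.castLE h) (Fin.castLE h)).det := by
  let e : Fin i ≃ {a : Fin m // a.val < i} :=
    { toFun := fun a => ⟨Fin.castLE h a, a.2⟩
      invFun := fun a => ⟨a.1.1, a.2⟩
      left_inv := fun a => rfl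
      right_inv := fun a => rfl }
  rw [leadingMinor, ← Matrix.det_submatrix_equiv_self e]
  rfl

lemma leadingMinor_zero {m : ℕ} (r : Matrix (Fin m) (Fin m) ℝ) : leadingMinor r 0 = 1 := by
  rw [leadingMinor_eq_det_castLE (Nat.zero_le m)]
  simp

lemma leadingMinor_self {m : ℕ} (r : Matrix (Fin m) (Fin m) ℝ) : leadingMinor r m = r.det := by
  rw [leadingMinor_eq_det_castLE le_rfl]
  rfl

/-- Taking Schur complements commutes with passing to an upper left block. -/
lemma leadingMinor_succ_schurMat {m i : ℕ} (hi : i ≤ m) (r : Matrix (Fin (m + 1)) (Fin (m + 1)) ℝ)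
    (h : r 0 0 ≠ 0) : leadingMinor r (i + 1) = r 0 0 * leadingMinor (schurMat r) i := by
  rw [leadingMinor_eq_det_castLE (Nat.succ_le_succ hi), leadingMinor_eq_det_castLE hi,
    det_eq_mul_det_schurMat _ (by simpa using h)]
  rfl

lemma leadingMinor_castSucc {m i : ℕ} (hi : i ≤ m) (r : Matrix (Fin (m + 1)) (Fin (m + 1)) ℝ) :
    leadingMinor r i = leadingMinor (r.submatrix Fin.castSucc Fin.castSucc) i := by
  rw [leadingMinor_eq_det_castLE (hi.trans (Nat.le_succ m)), leadingMinor_eq_det_castLE hi]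
  rfl

lemma revMat_castSucc {m : ℕ} (r : Matrix (Fin (m + 1)) (Fin (m + 1)) ℝ) :
    (revMat r).submatrix Fin.castSucc Fin.castSucc = revMat (tailMat r) := by
  ext i j
  simp [revMat, tailMat, Fin.rev_castSucc]

lemma det_revMat {m : ℕ} (r : Matrix (Fin m) (Fin m) ℝ) : (revMat r).det = r.det :=
  Matrix.det_submatrix_equiv_self Fin.revPerm r

lemma _root_.Matrix.PosDef.leadingMinor_pos {m : ℕ} {r : Matrix (Fin m) (Fin m) ℝ}
    (hr : r.PosDef) {i : ℕ} (hi : i ≤ m) : 0 < leadingMinor r i := by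
  rw [leadingMinor_eq_det_castLE hi]
  exact (hr.submatrix (Fin.castLE_injective hi)).det_pos

lemma _root_.Matrix.PosDef.tailMat {m : ℕ} {r : Matrix (Fin (m + 1)) (Fin (m + 1)) ℝ}
    (hr : r.PosDef) : (tailMat r).PosDef :=
  hr.submatrix (Fin.succ_injective m)

lemma _root_.Matrix.PosDef.revMat {m : ℕ} {r : Matrix (Fin m) (Fin m) ℝ}
    (hr : r.PosDef) : (revMat r).PosDef :=
  hr.submatrix Fin.rev_injective

lemma _root_.Matrix.PosDef.apply_symm {m : ℕ} {r : Matrix (Fin m) (Fin m) ℝ}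
    (hr : r.PosDef) (i j : Fin m) : r i j = r j i := by
  simpa using (hr.isHermitian.apply i j).symm

lemma _root_.Matrix.PosDef.schurMat {m : ℕ} {r : Matrix (Fin (m + 1)) (Fin (m + 1)) ℝ}
    (hr : r.PosDef) : (schurMat r).PosDef := by
  have h0 : 0 < r 0 0 := hr.diag_pos
  refine Matrix.PosDef.of_dotProduct_mulVec_pos ?_ fun x hx => ?_
  · ext i j
    simp only [Matrix.conjTranspose_apply, CompositeCosine.schurMat, Matrix.of_apply, star_trivial]
    rw [hr.apply_symm j.succ i.succ, hr.apply_symm j.succ 0, hr.apply_symm 0 i.succ]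
    ring
  · let c : ℝ := ∑ j, r 0 j.succ * x j
    -- The first coordinate `-c / r 0 0` minimises the quadratic form of `r` for given `x`; the
    -- minimum is the quadratic form of the Schur complement.
    let y : Fin (m + 1) → ℝ := Fin.cons (-c / r 0 0) x
    have hy : y ≠ 0 := by
      intro h
      apply hx
      ext i
      simpa [y] using congrFun h i.succ
    have hpos := hr.dotProduct_mulVec_pos hy
    have e : star y ⬝ᵥ r.mulVec y = star x ⬝ᵥ (CompositeCosine.schurMat r).mulVec x := by
      simp only [dotProduct, Matrix.mulVec, Fin.sum_univ_succ, y, Fin.cons_zero, Fin.cons_succ,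
        CompositeCosine.schurMat, Matrix.of_apply, star_trivial, sub_mul, Finset.sum_sub_distrib,
        Pi.star_apply, mul_sub, mul_add, Finset.sum_add_distrib]
      have e1 : ∑ j, r 0 j.succ * x j = c := rfl
      have e2 : ∑ i : Fin m, x i * (r i.succ 0 * (-c / r 0 0)) = -c * c / r 0 0 := by
        have : ∀ i : Fin m, x i * (r i.succ 0 * (-c / r 0 0)) =
            (r 0 i.succ * x i) * (-c / r 0 0) := fun i => by rw [hr.apply_symm i.succ 0]; ring
        simp_rw [this]
        rw [← Finset.sum_mul, e1]
        ring
      have e3 : ∑ i : Fin m, x i * ∑ j : Fin m, r i.succ 0 / r 0 0 * r 0 j.succ * x j =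
          c * c / r 0 0 := by
        have : ∀ i : Fin m, x i * ∑ j : Fin m, r i.succ 0 / r 0 0 * r 0 j.succ * x j =
            (r 0 i.succ * x i) * (c / r 0 0) := fun i => by
          simp_rw [mul_assoc]
          rw [← Finset.mul_sum, e1, hr.apply_symm i.succ 0]; ring
        simp_rw [this]
        rw [← Finset.sum_mul, e1]
        ring
      rw [e1, e2, e3]
      field_simp
      ring
    rwa [e] at hpos

/-! ### Composite powers -/

lemma compPow_succ_schurMat {m : ℕ} {r : Matrix (Fin (m + 1)) (Fin (m + 1)) ℝ} (hr : r.PosDef)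
    (l : Fin (m + 1) → ℂ) :
    compPow r l = (r 0 0 : ℂ) ^ (l 0 / 2) * compPow (schurMat r) (fun i => l i.succ) := by
  have h0 : 0 < r 0 0 := hr.diag_pos
  rw [compPow, Fin.prod_univ_succ, compPow]
  congr 1
  · simp only [Fin.val_zero, leadingMinor_zero, div_one]
    rw [leadingMinor_succ_schurMat (Nat.zero_le m) r h0.ne', leadingMinor_zero, mul_one]
  · refine Finset.prod_congr rfl fun i _ => ?_
    rw [Fin.val_succ, leadingMinor_succ_schurMat i.2 r h0.ne',
      leadingMinor_succ_schurMat i.2.le r h0.ne', mul_div_mul_left _ _ h0.ne']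

/-- Leading minors of `revMat r` are lower right minors of `r`, so here the lower right block plays
the part that the Schur complement plays in `compPow_succ_schurMat`. These are the recursions
satisfied by the two kinds of gamma integrals. -/
lemma compPow_revMat_succ {m : ℕ} (r : Matrix (Fin (m + 1)) (Fin (m + 1)) ℝ)
    (l : Fin (m + 1) → ℂ) :
    compPow (revMat r) l = ((r.det / (tailMat r).det : ℝ) : ℂ) ^ (l (Fin.last m) / 2) *
      compPow (revMat (tailMat r)) (fun i => l i.castSucc) := by
  rw [compPow, Fin.prod_univ_castSucc, compPow, mul_comm]
  congr 1
  · rw [Fin.val_last, leadingMinor_self, det_revMat, leadingMinor_castSucc le_rfl, revMat_castSucc,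
      leadingMinor_self, det_revMat]
  · refine Finset.prod_congr rfl fun i _ => ?_
    rw [Fin.val_castSucc, leadingMinor_castSucc i.2, leadingMinor_castSucc i.2.le, revMat_castSucc]

lemma prod_leadingMinor_ratio {m : ℕ} {r : Matrix (Fin m) (Fin m) ℝ} (hr : r.PosDef) :
    ∏ i : Fin m, leadingMinor r (i.val + 1) / leadingMinor r i.val = r.det := by
  rw [Fin.prod_univ_eq_prod_range (fun i => leadingMinor r (i + 1) / leadingMinor r i),
    ← leadingMinor_self]
  have : ∀ k ≤ m, ∏ i ∈ Finset.range k, leadingMinor r (i + 1) / leadingMinor r i =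
      leadingMinor r k := by
    intro k hk
    induction k with
    | zero => simp [leadingMinor_zero]
    | succ k ih =>
      rw [Finset.prod_range_succ, ih (by omega),
        mul_div_cancel₀ _ (hr.leadingMinor_pos (by omega : k ≤ m)).ne']
  exact this m le_rfl

lemma _root_.Matrix.PosDef.ratio_pos {m : ℕ} {r : Matrix (Fin m) (Fin m) ℝ} (hr : r.PosDef)
    (i : Fin m) : 0 < leadingMinor r (i.val + 1) / leadingMinor r i.val :=
  div_pos (hr.leadingMinor_pos i.2) (hr.leadingMinor_pos i.2.le)

lemma ofReal_prod_cpow {ι : Type*} (s : Finset ι) (f : ι → ℝ) (hf : ∀ i ∈ s, 0 ≤ f i) (c : ℂ) :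
    ((∏ i ∈ s, f i : ℝ) : ℂ) ^ c = ∏ i ∈ s, ((f i : ℝ) : ℂ) ^ c := by
  classical
  induction s using Finset.induction_on with
  | empty => simp
  | insert a s ha ih =>
    rw [Finset.prod_insert ha, Finset.prod_insert ha, Complex.ofReal_mul,
      Complex.mul_cpow_ofReal_nonneg (hf _ (by simp))
        (Finset.prod_nonneg fun i hi => hf i (by simp [hi])), ih fun i hi => hf i (by simp [hi])]

lemma compPow_add_const {m : ℕ} {r : Matrix (Fin m) (Fin m) ℝ} (hr : r.PosDef) (l : Fin m → ℂ)
    (c : ℂ) : compPow r (fun i => l i + c) = (r.det : ℂ) ^ (c / 2) * compPow r l := by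
  rw [← prod_leadingMinor_ratio hr, ofReal_prod_cpow _ _ (fun i _ => (hr.ratio_pos i).le), compPow,
    compPow, ← Finset.prod_mul_distrib]
  refine Finset.prod_congr rfl fun i _ => ?_
  rw [← Complex.cpow_add _ _ (by exact_mod_cast (hr.ratio_pos i).ne')]
  ring_nf

/-! ### Gaussian and gamma integrals -/

lemma mellin_exp_neg_mul {s : ℂ} (hs : 0 < s.re) {κ : ℝ} (hκ : 0 < κ) :
    MellinConvergent (fun t => (Real.exp (-(κ * t)) : ℂ)) s ∧
    mellin (fun t => (Real.exp (-(κ * t)) : ℂ)) s = (κ : ℂ) ^ (-s) * Complex.Gamma s := by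
  have h := Complex.integral_cpow_mul_exp_neg_mul_Ioi hs hκ
  have hm : mellin (fun t => (Real.exp (-(κ * t)) : ℂ)) s = (κ : ℂ) ^ (-s) * Complex.Gamma s := by
    rw [mellin]
    simp only [smul_eq_mul, Complex.ofReal_exp, Complex.ofReal_neg, Complex.ofReal_mul]
    rw [h, Complex.cpow_neg, one_div, Complex.inv_cpow _ _ (by
      rw [Complex.arg_ofReal_of_nonneg hκ.le]; exact Real.pi_ne_zero.symm)]
  refine ⟨?_, hm⟩
  -- A non-integrable function has Bochner integral 0, so the nonzero value just computed already
  -- proves convergence.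
  refine Integrable.of_integral_ne_zero (μ := volume.restrict (Set.Ioi 0)) ?_
  rw [← mellin, hm]
  refine mul_ne_zero ?_ (Complex.Gamma_ne_zero_of_re_pos hs)
  rw [Complex.cpow_ne_zero_iff]
  left; exact_mod_cast hκ.ne'

/-- `∫ a ^ μ exp (-σ a²) da` over the half-line. -/
lemma integral_cpow_mul_gaussian {μ : ℂ} (hμ : -1 < μ.re) {σ : ℝ} (hσ : 0 < σ) :
    IntegrableOn (fun a : ℝ => (a : ℂ) ^ μ * (Real.exp (-(σ * a ^ 2)) : ℂ)) (Set.Ioi 0) ∧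
    ∫ a in Set.Ioi (0 : ℝ), (a : ℂ) ^ μ * (Real.exp (-(σ * a ^ 2)) : ℂ) =
      1 / 2 * (σ : ℂ) ^ (-((μ + 1) / 2)) * Complex.Gamma ((μ + 1) / 2) := by
  have hs : 0 < ((μ + 1) / 2).re := by
    rw [show (μ + 1) / 2 = (μ + 1) / ((2 : ℝ) : ℂ) by push_cast; rfl, Complex.div_ofReal_re]
    simp; linarith
  obtain ⟨h1, h2⟩ := mellin_exp_neg_mul hs hσ
  have e := mellin_comp_rpow (fun t => (Real.exp (-(σ * t)) : ℂ)) (μ + 1) 2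
  have i := (MellinConvergent.comp_rpow (f := fun t => (Real.exp (-(σ * t)) : ℂ)) (s := μ + 1)
    (a := 2) two_ne_zero).2 (by simpa using h1)
  rw [MellinConvergent] at i
  rw [mellin] at e
  simp only [add_sub_cancel_right, smul_eq_mul, Real.rpow_two] at i e
  refine ⟨i, ?_⟩
  rw [e, Complex.ofReal_ofNat, h2]
  simp
  ring

/-- `∫ a ^ ν exp (-κ / a²) da` over the half-line. -/
lemma integral_cpow_mul_inv_gaussian {ν : ℂ} (hν : ν.re < -1) {κ : ℝ} (hκ : 0 < κ) :
    IntegrableOn (fun a : ℝ => (a : ℂ) ^ ν * (Real.exp (-(κ / a ^ 2)) : ℂ)) (Set.Ioi 0) ∧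
    ∫ a in Set.Ioi (0 : ℝ), (a : ℂ) ^ ν * (Real.exp (-(κ / a ^ 2)) : ℂ) =
      1 / 2 * (κ : ℂ) ^ ((ν + 1) / 2) * Complex.Gamma (-((ν + 1) / 2)) := by
  have hs : 0 < (-((ν + 1) / 2)).re := by
    rw [show (ν + 1) / 2 = (ν + 1) / ((2 : ℝ) : ℂ) by push_cast; rfl, Complex.neg_re,
      Complex.div_ofReal_re]
    simp; linarith
  obtain ⟨h1, h2⟩ := mellin_exp_neg_mul hs hκ
  have hdiv : (ν + 1) / ((-2 : ℝ) : ℂ) = -((ν + 1) / 2) := by push_cast; ring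
  have e := mellin_comp_rpow (fun t => (Real.exp (-(κ * t)) : ℂ)) (ν + 1) (-2)
  have i := (MellinConvergent.comp_rpow (f := fun t => (Real.exp (-(κ * t)) : ℂ)) (s := ν + 1)
    (a := -2) (by norm_num)).2 (by rw [hdiv]; exact h1)
  rw [MellinConvergent] at i
  rw [mellin, hdiv, h2] at e
  have hc : ∀ a ∈ Set.Ioi (0 : ℝ), (a : ℂ) ^ (ν + 1 - 1) •
      (Real.exp (-(κ * a ^ (-2 : ℝ))) : ℂ) = (a : ℂ) ^ ν * (Real.exp (-(κ / a ^ 2)) : ℂ) := by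
    intro a ha
    rw [add_sub_cancel_right, smul_eq_mul, Real.rpow_neg (le_of_lt ha), Real.rpow_two,
      div_eq_mul_inv]
  refine ⟨i.congr_fun hc measurableSet_Ioi, ?_⟩
  rw [← setIntegral_congr_fun measurableSet_Ioi hc, e]
  simp
  ring

/-- A Gaussian integral with an affine argument. -/
lemma integral_exp_neg_mulVec {m : ℕ} (M : Matrix (Fin m) (Fin m) ℝ) (hM : M.det ≠ 0) {κ : ℝ}
    (hκ : 0 < κ) (v : Fin m → ℝ) :
    Integrable (fun b : Fin m → ℝ =>
      Real.exp (-(κ * (M.mulVec (b - v) ⬝ᵥ M.mulVec (b - v))))) ∧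
    ∫ b : Fin m → ℝ, Real.exp (-(κ * (M.mulVec (b - v) ⬝ᵥ M.mulVec (b - v)))) =
      |M.det|⁻¹ * (Real.pi / κ) ^ ((m : ℝ) / 2) := by
  have hG : Integrable (fun b : Fin m → ℝ => Real.exp (-(κ * (b ⬝ᵥ b)))) ∧
      ∫ b : Fin m → ℝ, Real.exp (-(κ * (b ⬝ᵥ b))) = (Real.pi / κ) ^ ((m : ℝ) / 2) := by
    have hprod : ∀ b : Fin m → ℝ, Real.exp (-(κ * (b ⬝ᵥ b))) =
        ∏ i, Real.exp (-κ * (b i) ^ 2) := by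
      intro b
      rw [← Real.exp_sum, dotProduct, Finset.mul_sum, ← Finset.sum_neg_distrib]
      congr 1
      exact Finset.sum_congr rfl fun i _ => by ring
    simp_rw [hprod]
    constructor
    · exact Integrable.fintype_prod (f := fun _ : Fin m => fun x : ℝ => Real.exp (-κ * x ^ 2))
        fun _ => integrable_exp_neg_mul_sq hκ
    · have := integral_fintype_prod_volume_eq_pow (ι := Fin m) (E := ℝ)
        (fun x : ℝ => Real.exp (-κ * x ^ 2))
      rw [this, integral_gaussian, Fintype.card_fin, Real.sqrt_eq_rpow, ← Real.rpow_natCast,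
        ← Real.rpow_mul (by positivity)]
      ring_nf
  let L : (Fin m → ℝ) →ₗ[ℝ] (Fin m → ℝ) := Matrix.toLin' M
  have hL : LinearMap.det L ≠ 0 := by rwa [LinearMap.det_toLin']
  have hmap := Real.map_linearMap_volume_pi_eq_smul_volume_pi (f := L) hL
  have hcont : Continuous L := LinearMap.continuous_of_finiteDimensional L
  have hemb : MeasurableEmbedding L :=
    ((LinearMap.equivOfDetNeZero L hL).toContinuousLinearEquiv.toHomeomorph).measurableEmbedding
  have hdetL : LinearMap.det L = M.det := LinearMap.det_toLin' M
  have i1 : Integrable (fun b : Fin m → ℝ => Real.exp (-(κ * (L b ⬝ᵥ L b)))) := by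
    have : Integrable (fun b : Fin m → ℝ => Real.exp (-(κ * (b ⬝ᵥ b))))
        (Measure.map L volume) := by
      rw [hmap]
      exact hG.1.smul_measure ENNReal.ofReal_ne_top
    exact (hemb.integrable_map_iff).1 this
  have e1 : ∫ b : Fin m → ℝ, Real.exp (-(κ * (L b ⬝ᵥ L b))) =
      |M.det|⁻¹ * (Real.pi / κ) ^ ((m : ℝ) / 2) := by
    have := hemb.integral_map (μ := volume) (fun b : Fin m → ℝ => Real.exp (-(κ * (b ⬝ᵥ b))))
    rw [← this, hmap, integral_smul_measure, hG.2, hdetL,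
      ENNReal.toReal_ofReal (abs_nonneg _), smul_eq_mul, abs_inv]
  constructor
  · exact i1.comp_sub_right v
  · rw [integral_sub_right_eq_self (fun b => Real.exp (-(κ * (M.mulVec b ⬝ᵥ M.mulVec b)))) v]
    exact e1

/-- Integration of the second variable in a product of a function of the first variable and a
positive kernel. -/
lemma integral_prod_kernel {X Y : Type*} [MeasurableSpace X] [MeasurableSpace Y] {μ : Measure X}
    {ν : Measure Y} [SFinite μ] [SFinite ν] {h : X → ℂ} {E : X × Y → ℝ} {c : X → ℝ}
    (hh : AEStronglyMeasurable h μ) (hE : AEStronglyMeasurable E (μ.prod ν)) (hE0 : ∀ p, 0 ≤ E p)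
    (hEi : ∀ x, Integrable (fun y => E (x, y)) ν) (hc : ∀ x, ∫ y, E (x, y) ∂ν = c x)
    (hint : Integrable (fun x => h x * c x) μ) :
    Integrable (fun p : X × Y => h p.1 * (E p : ℂ)) (μ.prod ν) ∧
    ∫ p : X × Y, h p.1 * (E p : ℂ) ∂(μ.prod ν) = ∫ x, h x * c x ∂μ := by
  have hmeas : AEStronglyMeasurable (fun p : X × Y => h p.1 * (E p : ℂ)) (μ.prod ν) :=
    (hh.comp_fst).mul (Complex.continuous_ofReal.comp_aestronglyMeasurable hE)
  have hint2 : Integrable (fun p : X × Y => h p.1 * (E p : ℂ)) (μ.prod ν) := by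
    rw [integrable_prod_iff hmeas]
    refine ⟨Eventually.of_forall fun x => ((hEi x).ofReal.const_mul (h x)), ?_⟩
    refine hint.norm.congr (Eventually.of_forall fun x => ?_)
    simp only [norm_mul, Complex.norm_real]
    rw [integral_const_mul]
    congr 1
    rw [← hc x, Real.norm_of_nonneg (integral_nonneg fun y => hE0 _)]
    exact integral_congr_ae (Eventually.of_forall fun y => (Real.norm_of_nonneg (hE0 _)).symm)
  refine ⟨hint2, ?_⟩
  rw [integral_prod _ hint2]
  refine integral_congr_ae (Eventually.of_forall fun x => ?_)
  simp only
  rw [integral_const_mul, integral_complex_ofReal, hc]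

/-! ### Block triangular matrices -/

/-- The block triangular matrix with first column `(a, b)` and lower right block `t`. -/
def consLower {m : ℕ} (a : ℝ) (b : Fin m → ℝ) (t : Matrix (Fin m) (Fin m) ℝ) :
    Matrix (Fin (m + 1)) (Fin (m + 1)) ℝ :=
  Matrix.of (Fin.cons (Fin.cons a 0) fun i => Fin.cons (b i) (t i))

section consLower

variable {m : ℕ} (a : ℝ) (b : Fin m → ℝ) (t : Matrix (Fin m) (Fin m) ℝ)

@[simp] lemma consLower_zero_zero : consLower a b t 0 0 = a := rfl
@[simp] lemma consLower_zero_succ (j : Fin m) : consLower a b t 0 j.succ = 0 := rfl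
@[simp] lemma consLower_succ_zero (i : Fin m) : consLower a b t i.succ 0 = b i := rfl
@[simp] lemma consLower_succ_succ (i j : Fin m) : consLower a b t i.succ j.succ = t i j := rfl

lemma det_consLower : (consLower a b t).det = a * t.det := by
  rw [Matrix.det_succ_row_zero, Fin.sum_univ_succ]
  simp only [consLower_zero_succ, mul_zero, zero_mul, Finset.sum_const_zero, add_zero]
  have : (consLower a b t).submatrix Fin.succ (Fin.succAbove 0) = t := by
    ext i j; simp
  rw [this]; simp

lemma consLower_mul_inv (ha : a ≠ 0) {s : Matrix (Fin m) (Fin m) ℝ} (h : t * s = 1) :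
    consLower a b t * consLower a⁻¹ (-(a⁻¹ • s.mulVec b)) s = 1 := by
  have hts : t.mulVec (s.mulVec b) = b := by rw [Matrix.mulVec_mulVec, h, Matrix.one_mulVec]
  ext i j
  rw [Matrix.mul_apply, Fin.sum_univ_succ]
  refine Fin.cases ?_ (fun i => ?_) i <;> refine Fin.cases ?_ (fun j => ?_) j
  · simp [ha]
  · simp [(Fin.succ_ne_zero j).symm]
  · simp only [consLower_succ_zero, consLower_zero_zero, consLower_succ_succ, Pi.neg_apply,
      Pi.smul_apply, smul_eq_mul, mul_neg, Finset.sum_neg_distrib,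
      Matrix.one_apply_ne (Fin.succ_ne_zero i)]
    have : ∑ x, t i x * (a⁻¹ * s.mulVec b x) = a⁻¹ * b i := by
      conv_rhs => rw [← hts]
      simp only [Matrix.mulVec, dotProduct, Finset.mul_sum]
      refine Finset.sum_congr rfl fun x _ => Finset.sum_congr rfl fun y _ => by ring
    rw [this]; ring
  · have := congrFun (congrFun h i) j
    rw [Matrix.mul_apply] at this
    simp [this, Matrix.one_apply]

/-- Completing the square in the first column `(a, b)`: the form is minimal at `b = -a • u`, and the
coefficient of `a ^ 2` is the Schur complement of the lower right block. Integration over `b`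
therefore decouples from the integrations over `a` and `t`. -/
lemma trace_conj_consLower {r : Matrix (Fin (m + 1)) (Fin (m + 1)) ℝ} (hr : r.PosDef)
    {u : Fin m → ℝ} (hu : (tailMat r).mulVec u = fun i => r i.succ 0) :
    ((consLower a b t).transpose * r * consLower a b t).trace =
      (r 0 0 - ∑ i, r 0 i.succ * u i) * a ^ 2 +
        (b + a • u) ⬝ᵥ (tailMat r).mulVec (b + a • u) + (t.transpose * tailMat r * t).trace := by
  have hsym : ∀ i j, r i j = r j i := hr.apply_symm
  have h1 : (tailMat r).mulVec (b + a • u) =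
      (tailMat r).mulVec b + a • fun i => r i.succ 0 := by
    rw [Matrix.mulVec_add, Matrix.mulVec_smul, hu]
  have h2 : u ⬝ᵥ (tailMat r).mulVec b = ∑ i, r i.succ 0 * b i := by
    rw [Matrix.dotProduct_mulVec, ← Matrix.mulVec_transpose]
    have : (tailMat r).transpose = tailMat r := by
      ext i j; simp [tailMat, hsym j.succ i.succ]
    rw [this, hu]; rfl
  rw [h1, add_dotProduct, dotProduct_add, dotProduct_add, smul_dotProduct, h2, Matrix.trace,
    Fin.sum_univ_succ]
  have h3 : ∀ j : Fin m, ((consLower a b t).transpose * r * consLower a b t).diag j.succ =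
      (t.transpose * tailMat r * t).diag j := by
    intro j
    simp [Matrix.diag, Matrix.mul_apply, Fin.sum_univ_succ, tailMat]
  simp_rw [h3]
  have h4 : ((consLower a b t).transpose * r * consLower a b t).diag 0 =
      a * r 0 0 * a + a * ∑ i, r 0 i.succ * b i +
        ((∑ i, b i * r i.succ 0) * a + b ⬝ᵥ (tailMat r).mulVec b) := by
    simp only [Matrix.diag, Matrix.mul_apply, Fin.sum_univ_succ, Matrix.transpose_apply,
      consLower_zero_zero, consLower_succ_zero, tailMat, dotProduct, Matrix.mulVec,
      Matrix.submatrix_apply, add_mul, Finset.sum_add_distrib, Finset.mul_sum, Finset.sum_mul]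
    congr 2
    · exact Finset.sum_congr rfl fun i _ => by ring
    · rw [Finset.sum_comm (γ := Fin m)]
      exact Finset.sum_congr rfl fun i _ => Finset.sum_congr rfl fun j _ => by ring
  rw [h4]
  have h5 : ∑ i, b i * r i.succ 0 = b ⬝ᵥ fun i => r i.succ 0 := rfl
  have h6 : ∑ i, r 0 i.succ * b i = b ⬝ᵥ fun i => r i.succ 0 :=
    Finset.sum_congr rfl fun i _ => by rw [hsym]; ring
  have h7 : ∑ i : Fin m, r i.succ 0 * b i = b ⬝ᵥ fun i => r i.succ 0 :=
    Finset.sum_congr rfl fun i _ => by ring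
  have h8 : ∑ i, r 0 i.succ * u i = u ⬝ᵥ fun i => r i.succ 0 :=
    Finset.sum_congr rfl fun i _ => by rw [hsym]; ring
  have h9 : b ⬝ᵥ (a • fun i => r i.succ 0) = a * (b ⬝ᵥ fun i : Fin m => r i.succ 0) :=
    dotProduct_smul _ _ _
  have h10 : (a • u) ⬝ᵥ (a • fun i : Fin m => r i.succ 0) =
      a * (a * (u ⬝ᵥ fun i : Fin m => r i.succ 0)) := by
    rw [smul_dotProduct, dotProduct_smul]; rfl
  rw [h5, h6, h7, h8, h9, h10, Matrix.trace, smul_eq_mul]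
  ring

/-- The same completion of the square for the inverse matrix. It now leaves the Schur complement of
the upper left entry, which is why the inverted integrals produce powers of `r` and not of `revMat
r`. -/
lemma trace_conj_consLower_inv {r : Matrix (Fin (m + 1)) (Fin (m + 1)) ℝ} (hr : r.PosDef)
    (ha : a ≠ 0) (s : Matrix (Fin m) (Fin m) ℝ) :
    (consLower a⁻¹ (-(a⁻¹ • s.mulVec b)) s * r *
      (consLower a⁻¹ (-(a⁻¹ • s.mulVec b)) s).transpose).trace =
      r 0 0 / a ^ 2 + r 0 0 *
        ((a⁻¹ • s).mulVec (b - (a / r 0 0) • fun i => r i.succ 0) ⬝ᵥ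
          (a⁻¹ • s).mulVec (b - (a / r 0 0) • fun i => r i.succ 0)) +
        (s * schurMat r * s.transpose).trace := by
  have hsym : ∀ i j, r i j = r j i := hr.apply_symm
  have h0 : r 0 0 ≠ 0 := hr.diag_pos.ne'
  have h1 : (a⁻¹ • s).mulVec (b - (a / r 0 0) • fun i => r i.succ 0) =
      a⁻¹ • s.mulVec b - (r 0 0)⁻¹ • s.mulVec (fun i => r i.succ 0) := by
    rw [Matrix.smul_mulVec, Matrix.mulVec_sub, Matrix.mulVec_smul, smul_sub, smul_smul]
    congr 2
    field_simp
  rw [h1]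
  set p := s.mulVec b
  set q := s.mulVec (fun i => r i.succ 0) with hq
  rw [Matrix.trace, Fin.sum_univ_succ]
  have h2 : (consLower a⁻¹ (-(a⁻¹ • p)) s * r * (consLower a⁻¹ (-(a⁻¹ • p)) s).transpose).diag 0 =
      r 0 0 / a ^ 2 := by
    simp [Matrix.diag, Matrix.mul_apply, Fin.sum_univ_succ]
    field_simp
  rw [h2, add_assoc]
  congr 1
  rw [Matrix.trace, dotProduct, Finset.mul_sum, ← Finset.sum_add_distrib]
  refine Finset.sum_congr rfl fun i _ => ?_
  have hS : (s * schurMat r * s.transpose).diag i =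
      (s * tailMat r * s.transpose).diag i - q i * q i / r 0 0 := by
    have : schurMat r = tailMat r -
        (r 0 0)⁻¹ • Matrix.vecMulVec (fun i : Fin m => r i.succ 0) (fun i : Fin m => r i.succ 0) := by
      ext i j
      simp only [schurMat, tailMat, Matrix.of_apply, Matrix.sub_apply, Matrix.submatrix_apply,
        Matrix.smul_apply, Matrix.vecMulVec_apply, smul_eq_mul]
      rw [hsym 0 j.succ]
      ring
    rw [this, Matrix.mul_sub, Matrix.sub_mul, Matrix.mul_smul, Matrix.smul_mul,
      Matrix.mul_vecMulVec, Matrix.vecMulVec_mul, Matrix.vecMul_transpose]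
    simp [Matrix.diag, Matrix.vecMulVec_apply, hq]
    ring
  have hL : (consLower a⁻¹ (-(a⁻¹ • p)) s * r *
      (consLower a⁻¹ (-(a⁻¹ • p)) s).transpose).diag i.succ =
      (a⁻¹ * p i) * (r 0 0 * (a⁻¹ * p i)) - 2 * (a⁻¹ * p i) * q i +
        (s * tailMat r * s.transpose).diag i := by
    have hq1 : q i = ∑ j, s i j * r j.succ 0 := rfl
    have hq2 : q i = ∑ j, r 0 j.succ * s i j := by
      rw [hq1]; exact Finset.sum_congr rfl fun j _ => by rw [hsym]; ring
    simp only [Matrix.diag, Matrix.mul_apply, Fin.sum_univ_succ, Matrix.transpose_apply,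
      consLower_succ_zero, consLower_succ_succ, tailMat, Matrix.submatrix_apply, add_mul,
      Finset.sum_add_distrib, Pi.neg_apply, Pi.smul_apply, smul_eq_mul]
    rw [← hq1]
    have : ∑ x, -(a⁻¹ * p i) * r 0 x.succ * s i x = -(a⁻¹ * p i) * q i := by
      rw [hq2, Finset.mul_sum]; exact Finset.sum_congr rfl fun j _ => by ring
    rw [this]
    ring
  rw [hS, hL]
  simp only [Pi.sub_apply, Pi.smul_apply, smul_eq_mul]
  field_simp
  ring

/-- Multiplying by the unipotent matrix `consLower 1 (-u) 1` clears the first column below the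
diagonal. -/
lemma det_eq_mul_det_tailMat {r : Matrix (Fin (m + 1)) (Fin (m + 1)) ℝ}
    {u : Fin m → ℝ} (hu : (tailMat r).mulVec u = fun i => r i.succ 0) :
    r.det = (r 0 0 - ∑ i, r 0 i.succ * u i) * (tailMat r).det := by
  have h : (r * consLower 1 (-u) 1).det =
      (r 0 0 - ∑ i, r 0 i.succ * u i) * (tailMat r).det := by
    rw [Matrix.det_succ_column_zero, Fin.sum_univ_succ]
    have h0 : ∀ i : Fin m, (r * consLower 1 (-u) 1) i.succ 0 = 0 := by
      intro i
      rw [Matrix.mul_apply, Fin.sum_univ_succ]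
      have := congrFun hu i
      simp only [tailMat, Matrix.mulVec, dotProduct, Matrix.submatrix_apply] at this
      simp [this]
    simp only [h0, mul_zero, zero_mul, Finset.sum_const_zero, add_zero]
    have : (r * consLower 1 (-u) 1).submatrix (Fin.succAbove 0) Fin.succ = tailMat r := by
      ext i j
      simp [Matrix.mul_apply, Fin.sum_univ_succ, tailMat, Matrix.one_apply]
    rw [this]
    simp [Matrix.mul_apply, Fin.sum_univ_succ, sub_eq_add_neg]
  rw [← h, Matrix.det_mul, det_consLower]
  simp

end consLower

/-! ### Gamma integrals over the group of triangular matrices -/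

/-- The value at the unit matrix of the gamma integral of `∏ t_ii ^ μ_i`. -/
noncomputable def triGamma {m : ℕ} (μ : Fin m → ℂ) : ℂ :=
  ∏ i : Fin m, ((Real.pi : ℂ) ^ (((m : ℂ) - 1 - (i.val : ℂ)) / 2) *
    (1 / 2 * Complex.Gamma ((μ i + 1) / 2)))

/-- The value at the unit matrix of the inverted gamma integral of `∏ t_ii ^ ν_i`. -/
noncomputable def triGammaInv {m : ℕ} (ν : Fin m → ℂ) : ℂ :=
  ∏ i : Fin m, ((4 * Real.pi : ℝ) : ℂ) ^ (((m : ℂ) - 1 - (i.val : ℂ)) / 2) *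
    (1 / 2 * (2 : ℂ) ^ (-(ν i + m)) * Complex.Gamma (-((ν i + m) / 2)))

/-- A measure space of lower triangular matrices `t` with positive diagonal, with inverses `s`,
for which the gamma integrals are evaluated. -/
structure TriangularFamily (m : ℕ) where
  carrier : Type
  [measurableSpace : MeasurableSpace carrier]
  measure : Measure carrier
  [sFinite : SFinite measure]
  t : carrier → Matrix (Fin m) (Fin m) ℝ
  s : carrier → Matrix (Fin m) (Fin m) ℝ
  measurable_t : ∀ i j, Measurable fun a => t a i j
  measurable_s : ∀ i j, Measurable fun a => s a i j
  mul_eq_one : ∀ a, t a * s a = 1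
  diag_pos : ∀ a i, 0 < t a i i
  det_eq : ∀ a, (t a).det = ∏ i, t a i i
  -- These two evaluations are all that is ever used about the measure, so no Haar measure on the
  -- triangular group is needed and the family can be built by induction on the size.
  integral_gauss : ∀ μ : Fin m → ℂ, (∀ i, -1 < (μ i).re) →
    ∀ r : Matrix (Fin m) (Fin m) ℝ, r.PosDef →
    Integrable (fun a => (∏ i, (t a i i : ℂ) ^ μ i) *
      (Real.exp (-((t a).transpose * r * t a).trace) : ℂ)) measure ∧
    ∫ a, (∏ i, (t a i i : ℂ) ^ μ i) *
      (Real.exp (-((t a).transpose * r * t a).trace) : ℂ) ∂measure =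
      triGamma μ * compPow (revMat r) (fun j => -(μ j.rev + j.rev.val + 1))
  integral_gauss_inv : ∀ ν : Fin m → ℂ, (∀ i, (ν i).re + m < 0) →
    ∀ r : Matrix (Fin m) (Fin m) ℝ, r.PosDef →
    Integrable (fun a => (∏ i, (t a i i : ℂ) ^ ν i) *
      (Real.exp (-(1 / 4 * (s a * r * (s a).transpose).trace)) : ℂ)) measure ∧
    ∫ a, (∏ i, (t a i i : ℂ) ^ ν i) *
      (Real.exp (-(1 / 4 * (s a * r * (s a).transpose).trace)) : ℂ) ∂measure =
      triGammaInv ν * compPow r (fun j => ν j + j.val + 1)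

attribute [instance] TriangularFamily.measurableSpace TriangularFamily.sFinite

/-- The unique family of matrices of size zero. -/
noncomputable def TriangularFamily.zero : TriangularFamily 0 where
  carrier := Unit
  measure := Measure.dirac ()
  t := fun _ => 1
  s := fun _ => 1
  measurable_t := fun i => i.elim0
  measurable_s := fun i => i.elim0
  mul_eq_one := fun _ => by simp
  diag_pos := fun _ i => i.elim0
  det_eq := fun _ => by simp
  integral_gauss := fun μ _ r _ => by
    constructor
    · simp
    · simp [triGamma, compPow, Matrix.trace]
  integral_gauss_inv := fun ν _ r _ => by
    constructor
    · simp
    · simp [triGammaInv, compPow, Matrix.trace]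

/-- A positive extension of the identity on the positive half-line. -/
noncomputable def posVal (a : ℝ) : ℝ := if 0 < a then a else 1

lemma posVal_pos (a : ℝ) : 0 < posVal a := by
  unfold posVal; split_ifs with h
  · exact h
  · exact one_pos

lemma posVal_of_pos {a : ℝ} (h : 0 < a) : posVal a = a := if_pos h

lemma measurable_posVal : Measurable posVal :=
  Measurable.ite measurableSet_Ioi measurable_id measurable_const

lemma exists_transpose_mul_self {m : ℕ} {r : Matrix (Fin m) (Fin m) ℝ} (hr : r.PosDef) :
    ∃ B : Matrix (Fin m) (Fin m) ℝ, r = B.transpose * B ∧ |B.det| ^ 2 = r.det := by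
  obtain ⟨B, hB⟩ := CStarAlgebra.nonneg_iff_eq_star_mul_self.1
    (Matrix.nonneg_iff_posSemidef.2 hr.posSemidef)
  rw [Matrix.star_eq_conjTranspose] at hB
  refine ⟨B, by rw [hB, Matrix.conjTranspose_eq_transpose_of_trivial], ?_⟩
  rw [hB, Matrix.det_mul, Matrix.conjTranspose_eq_transpose_of_trivial, Matrix.det_transpose,
    sq_abs, pow_two]

lemma dotProduct_mulVec_transpose_mul {m : ℕ} (B : Matrix (Fin m) (Fin m) ℝ) (v : Fin m → ℝ) :
    v ⬝ᵥ (B.transpose * B).mulVec v = B.mulVec v ⬝ᵥ B.mulVec v := by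
  rw [← Matrix.mulVec_mulVec, Matrix.dotProduct_mulVec, Matrix.vecMul_transpose]

namespace TriangularFamily

variable {m : ℕ} (T : TriangularFamily m)

lemma det_pos (a : T.carrier) : 0 < (T.t a).det := by
  rw [T.det_eq]; exact Finset.prod_pos fun i _ => T.diag_pos a i

lemma det_s (a : T.carrier) : (T.s a).det = ((T.t a).det)⁻¹ := by
  have := congrArg Matrix.det (T.mul_eq_one a)
  rw [Matrix.det_mul, Matrix.det_one] at this
  exact eq_inv_of_mul_eq_one_right this

lemma measurable_trace_s (r : Matrix (Fin m) (Fin m) ℝ) :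
    Measurable fun a => (T.s a * r * (T.s a).transpose).trace := by
  have := T.measurable_s
  simp only [Matrix.trace, Matrix.diag, Matrix.mul_apply, Matrix.transpose_apply]
  fun_prop

lemma measurable_prod_cpow (μ : Fin m → ℂ) :
    Measurable fun a => ∏ i, (T.t a i i : ℂ) ^ μ i :=
  Finset.measurable_prod _ fun i _ =>
    (Complex.measurable_ofReal.comp (T.measurable_t i i)).pow_const _

/-- The diagonal entry, the lower block and the first column of the enlarged matrices. -/
abbrev SuccCarrier : Type := (ℝ × T.carrier) × (Fin m → ℝ)

/-- The measure on the enlarged matrices. -/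
noncomputable abbrev succMeasure : Measure T.SuccCarrier :=
  ((volume.restrict (Set.Ioi (0 : ℝ))).prod T.measure).prod volume

/-- The enlarged matrices. -/
noncomputable def succT (p : T.SuccCarrier) : Matrix (Fin (m + 1)) (Fin (m + 1)) ℝ :=
  consLower (posVal p.1.1) p.2 (T.t p.1.2)

/-- The inverses of the enlarged matrices. -/
noncomputable def succS (p : T.SuccCarrier) : Matrix (Fin (m + 1)) (Fin (m + 1)) ℝ :=
  consLower (posVal p.1.1)⁻¹ (-((posVal p.1.1)⁻¹ • (T.s p.1.2).mulVec p.2)) (T.s p.1.2)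

lemma prod_succT (μ : Fin (m + 1) → ℂ) (p : T.SuccCarrier) :
    (∏ i, (T.succT p i i : ℂ) ^ μ i) =
      (posVal p.1.1 : ℂ) ^ μ 0 * ∏ i, (T.t p.1.2 i i : ℂ) ^ μ i.succ := by
  rw [Fin.prod_univ_succ]
  rfl

/-- The Gaussian integral over `b` gives π^(m/2) det(tail)^(-1/2), the integral over `a` a gamma
function with a power of det r / det tail, and the rest is the induction hypothesis. The factor
det(tail)^(-1/2) lowers every remaining exponent by 1, which accounts for the index in the exponents
of the result. -/
lemma integral_gauss_succ (μ : Fin (m + 1) → ℂ) (hμ : ∀ i, -1 < (μ i).re)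
    (r : Matrix (Fin (m + 1)) (Fin (m + 1)) ℝ) (hr : r.PosDef) :
    Integrable (fun a => (∏ i, (T.succT a i i : ℂ) ^ μ i) *
      (Real.exp (-((T.succT a).transpose * r * T.succT a).trace) : ℂ)) T.succMeasure ∧
    ∫ a, (∏ i, (T.succT a i i : ℂ) ^ μ i) *
      (Real.exp (-((T.succT a).transpose * r * T.succT a).trace) : ℂ) ∂T.succMeasure =
      triGamma μ * compPow (revMat r) (fun j => -(μ j.rev + j.rev.val + 1)) := by
  have hr' := hr.tailMat
  have hdet' : 0 < (tailMat r).det := hr'.det_pos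
  obtain ⟨B, hB, hBdet⟩ := exists_transpose_mul_self hr'
  have hBpos : 0 < |B.det| := by
    refine abs_pos.2 fun h => ?_
    rw [h] at hBdet; simp at hBdet; exact hdet'.ne hBdet
  obtain ⟨u, hu⟩ : ∃ u : Fin m → ℝ, (tailMat r).mulVec u = fun i => r i.succ 0 :=
    ⟨(tailMat r)⁻¹.mulVec fun i => r i.succ 0, by
      rw [Matrix.mulVec_mulVec, Matrix.mul_nonsing_inv _ (isUnit_iff_ne_zero.2 hdet'.ne'),
        Matrix.one_mulVec]⟩
  set σ : ℝ := r 0 0 - ∑ i, r 0 i.succ * u i with hσ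
  have hdet : r.det = σ * (tailMat r).det := det_eq_mul_det_tailMat hu
  have hσeq : r.det / (tailMat r).det = σ := by rw [hdet]; field_simp
  have hσpos : 0 < σ := by rw [← hσeq]; exact div_pos hr.det_pos hdet'
  obtain ⟨i1, e1⟩ := integral_cpow_mul_gaussian (hμ 0) hσpos
  obtain ⟨i2, e2⟩ := T.integral_gauss (fun i => μ i.succ) (fun i => hμ _) _ hr'
  let h1 : ℝ → ℂ := fun a => (posVal a : ℂ) ^ μ 0 * (Real.exp (-(σ * posVal a ^ 2)) : ℂ)
  let h2 : T.carrier → ℂ := fun a => (∏ i, (T.t a i i : ℂ) ^ μ i.succ) *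
    (Real.exp (-((T.t a).transpose * tailMat r * T.t a).trace) : ℂ)
  -- The measure lives on the half-line, where `posVal a = a`. The value 1 elsewhere only makes
  -- every point of the carrier a matrix with positive diagonal.
  have hh1 : ∀ a ∈ Set.Ioi (0 : ℝ), (a : ℂ) ^ μ 0 * (Real.exp (-(σ * a ^ 2)) : ℂ) = h1 a := by
    intro a ha
    simp only [h1, posVal_of_pos ha]
  have i1' : IntegrableOn h1 (Set.Ioi 0) := i1.congr_fun hh1 measurableSet_Ioi
  rw [setIntegral_congr_fun measurableSet_Ioi hh1] at e1
  let E : T.SuccCarrier → ℝ := fun p => Real.exp (-(1 *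
    (B.mulVec (p.2 - (-(posVal p.1.1) • u)) ⬝ᵥ B.mulVec (p.2 - (-(posVal p.1.1) • u)))))
  have hE := fun a : ℝ => integral_exp_neg_mulVec B (abs_pos.1 hBpos) one_pos (-(posVal a) • u)
  have hEmeas : Measurable E := by
    have := measurable_posVal
    simp only [E, dotProduct, Matrix.mulVec, Pi.sub_apply, Pi.smul_apply]
    fun_prop
  have hkey := integral_prod_kernel (X := ℝ × T.carrier) (Y := Fin m → ℝ)
    (μ := (volume.restrict (Set.Ioi (0 : ℝ))).prod T.measure) (ν := volume)
    (h := fun x => h1 x.1 * h2 x.2) (E := E)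
    (c := fun _ => |B.det|⁻¹ * (Real.pi / 1) ^ ((m : ℝ) / 2))
    (i1'.mul_prod i2).aestronglyMeasurable hEmeas.aestronglyMeasurable
    (fun p => (Real.exp_pos _).le) (fun x => (hE x.1).1) (fun x => (hE x.1).2)
    ((i1'.mul_prod i2).mul_const _)
  have hfun : (fun a => (∏ i, (T.succT a i i : ℂ) ^ μ i) *
      (Real.exp (-((T.succT a).transpose * r * T.succT a).trace) : ℂ)) =
      fun p : T.SuccCarrier => (h1 p.1.1 * h2 p.1.2) * (E p : ℂ) := by
    funext p
    rw [prod_succT, succT, trace_conj_consLower _ _ _ hr hu, ← hσ, neg_add, neg_add, Real.exp_add,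
      Real.exp_add]
    simp only [h1, h2, E]
    rw [hB, dotProduct_mulVec_transpose_mul, ← hB, one_mul, neg_smul, sub_neg_eq_add]
    push_cast
    ring
  rw [hfun]
  refine ⟨hkey.1, hkey.2.trans ?_⟩
  rw [integral_mul_const, integral_prod_mul, e1, e2, compPow_revMat_succ, hσeq]
  have hB' : |B.det|⁻¹ = (tailMat r).det ^ (-(1 / 2) : ℝ) := by
    rw [← hBdet, ← Real.rpow_natCast, ← Real.rpow_mul hBpos.le]
    norm_num
    rw [Real.rpow_neg_one]
  have hshift : compPow (revMat (tailMat r))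
      (fun j : Fin m => -(μ (j.castSucc).rev + (j.castSucc).rev.val + 1)) =
      ((tailMat r).det : ℂ) ^ ((-1 : ℂ) / 2) *
      compPow (revMat (tailMat r)) (fun j : Fin m => -(μ j.rev.succ + j.rev.val + 1)) := by
    have := compPow_add_const hr'.revMat (fun j : Fin m => -(μ j.rev.succ + j.rev.val + 1)) (-1)
    rw [det_revMat] at this
    rw [← this]
    congr 1
    funext j
    rw [Fin.rev_castSucc, Fin.val_succ]
    push_cast
    ring
  rw [hshift, triGamma, triGamma, Fin.prod_univ_succ, hB', div_one, Complex.ofReal_mul,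
    Complex.ofReal_cpow hdet'.le, Complex.ofReal_cpow Real.pi_pos.le]
  simp only [Fin.rev_last, Fin.val_zero, Fin.val_succ]
  have hprod : ∏ i : Fin m, ((Real.pi : ℂ) ^ ((((m + 1 : ℕ) : ℂ) - 1 - ((i.val + 1 : ℕ) : ℂ)) / 2) *
      (1 / 2 * Complex.Gamma ((μ i.succ + 1) / 2))) =
      ∏ i : Fin m, ((Real.pi : ℂ) ^ (((m : ℂ) - 1 - (i.val : ℂ)) / 2) *
      (1 / 2 * Complex.Gamma ((μ i.succ + 1) / 2))) := by
    refine Finset.prod_congr rfl fun i _ => ?_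
    congr 3
    push_cast; ring
  rw [hprod]
  have q1 : (-(μ 0 + ((0 : ℕ) : ℂ) + 1)) / 2 = -((μ 0 + 1) / 2) := by push_cast; ring
  have q2 : (((m + 1 : ℕ) : ℂ) - 1 - ((0 : ℕ) : ℂ)) / 2 = (((m : ℝ) / 2 : ℝ) : ℂ) := by
    push_cast; ring
  have q3 : ((-(1 / 2) : ℝ) : ℂ) = (-1 : ℂ) / 2 := by push_cast; ring
  rw [q1, q2, q3]
  ring

/-- The Gaussian in `b` now has the matrix `a⁻¹ • s`, so it contributes a^m det(t) (4π/ρ)^(m/2).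
Hence the exponent of `a` rises by `m` and those of the smaller diagonal by 1, and the induction
hypothesis applies to the Schur complement. -/
lemma integral_gauss_inv_succ (ν : Fin (m + 1) → ℂ) (hν : ∀ i, (ν i).re + (m + 1 : ℕ) < 0)
    (r : Matrix (Fin (m + 1)) (Fin (m + 1)) ℝ) (hr : r.PosDef) :
    Integrable (fun a => (∏ i, (T.succT a i i : ℂ) ^ ν i) *
      (Real.exp (-(1 / 4 * (T.succS a * r * (T.succS a).transpose).trace)) : ℂ)) T.succMeasure ∧
    ∫ a, (∏ i, (T.succT a i i : ℂ) ^ ν i) *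
      (Real.exp (-(1 / 4 * (T.succS a * r * (T.succS a).transpose).trace)) : ℂ) ∂T.succMeasure =
      triGammaInv ν * compPow r (fun j => ν j + j.val + 1) := by
  set ρ : ℝ := r 0 0 with hρdef
  have hρ : 0 < ρ := hr.diag_pos
  have hρ4 : 0 < ρ / 4 := by positivity
  have hν' : ∀ i, (ν i).re + ((m : ℝ) + 1) < 0 := fun i => by exact_mod_cast hν i
  obtain ⟨i1, e1⟩ := integral_cpow_mul_inv_gaussian (ν := ν 0 + m)
    (by simp; linarith [hν' 0]) hρ4
  obtain ⟨i2, e2⟩ := T.integral_gauss_inv (fun i => ν i.succ + 1)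
    (fun i => by simp; linarith [hν' i.succ]) _ hr.schurMat
  let h1 : ℝ → ℂ := fun a => (posVal a : ℂ) ^ (ν 0 + m) *
    (Real.exp (-(ρ / 4 / posVal a ^ 2)) : ℂ)
  let h2 : T.carrier → ℂ := fun a => (∏ i, (T.t a i i : ℂ) ^ (ν i.succ + 1)) *
    (Real.exp (-(1 / 4 * (T.s a * schurMat r * (T.s a).transpose).trace)) : ℂ)
  have hh1 : ∀ a ∈ Set.Ioi (0 : ℝ), (a : ℂ) ^ (ν 0 + m) *
      (Real.exp (-(ρ / 4 / a ^ 2)) : ℂ) = h1 a := by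
    intro a ha
    simp only [h1, posVal_of_pos ha]
  have i1' : IntegrableOn h1 (Set.Ioi 0) := i1.congr_fun hh1 measurableSet_Ioi
  rw [setIntegral_congr_fun measurableSet_Ioi hh1] at e1
  let w : ℝ → (Fin m → ℝ) := fun a => (posVal a / ρ) • fun i => r i.succ 0
  let M : ℝ × T.carrier → Matrix (Fin m) (Fin m) ℝ := fun x => (posVal x.1)⁻¹ • T.s x.2
  let E : T.SuccCarrier → ℝ := fun p => Real.exp (-(ρ / 4 *
    ((M p.1).mulVec (p.2 - w p.1.1) ⬝ᵥ (M p.1).mulVec (p.2 - w p.1.1))))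
  have hMdet : ∀ x, |(M x).det|⁻¹ = posVal x.1 ^ m * (T.t x.2).det := by
    intro x
    have h1 := posVal_pos x.1
    have h2 := T.det_pos x.2
    rw [Matrix.det_smul, T.det_s, Fintype.card_fin, abs_of_pos (by positivity)]
    simp [mul_comm]
  have hMne : ∀ x, (M x).det ≠ 0 := by
    intro x h
    have h1 := posVal_pos x.1
    have h2 := T.det_pos x.2
    have := hMdet x
    rw [h, abs_zero, inv_zero] at this
    have : 0 < posVal x.1 ^ m * (T.t x.2).det := by positivity
    linarith
  have hE := fun x : ℝ × T.carrier => integral_exp_neg_mulVec (M x) (hMne x) hρ4 (w x.1)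
  have hEmeas : Measurable E := by
    have := measurable_posVal
    have := T.measurable_s
    simp only [E, M, w, dotProduct, Matrix.mulVec, Pi.sub_apply, Pi.smul_apply, Matrix.smul_apply]
    fun_prop
  let g : ℝ × T.carrier → ℂ := fun x => ((posVal x.1 : ℂ) ^ (ν 0) *
    (Real.exp (-(ρ / 4 / posVal x.1 ^ 2)) : ℂ)) * ((∏ i, (T.t x.2 i i : ℂ) ^ (ν i.succ)) *
    (Real.exp (-(1 / 4 * (T.s x.2 * schurMat r * (T.s x.2).transpose).trace)) : ℂ))
  have hgc : ∀ x, g x * ((|(M x).det|⁻¹ * (Real.pi / (ρ / 4)) ^ ((m : ℝ) / 2) : ℝ) : ℂ) =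
      h1 x.1 * h2 x.2 * (((Real.pi / (ρ / 4)) ^ ((m : ℝ) / 2) : ℝ) : ℂ) := by
    intro x
    rw [hMdet, T.det_eq]
    simp only [g, h1, h2]
    have hp : (posVal x.1 : ℂ) ≠ 0 := by exact_mod_cast (posVal_pos x.1).ne'
    rw [Complex.cpow_add _ _ hp, Complex.cpow_natCast]
    have : ∏ i, (T.t x.2 i i : ℂ) ^ (ν i.succ + 1) =
        (∏ i, (T.t x.2 i i : ℂ) ^ (ν i.succ)) * ∏ i, (T.t x.2 i i : ℂ) := by
      rw [← Finset.prod_mul_distrib]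
      refine Finset.prod_congr rfl fun i _ => ?_
      rw [Complex.cpow_add _ _ (by exact_mod_cast (T.diag_pos x.2 i).ne'), Complex.cpow_one]
    rw [this]
    push_cast
    ring
  have hgmeas : Measurable g := by
    have := measurable_posVal
    have h3 := T.measurable_prod_cpow (fun i => ν i.succ)
    have h4 := T.measurable_trace_s (schurMat r)
    have h5 : Measurable fun a : ℝ => (posVal a : ℂ) ^ ν 0 :=
      (Complex.measurable_ofReal.comp measurable_posVal).pow_const _
    exact ((h5.comp measurable_fst).mul (by fun_prop)).mul
      ((h3.mul (Complex.measurable_ofReal.comp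
        (Real.measurable_exp.comp (h4.const_mul (1 / 4)).neg))).comp measurable_snd)
  have hkey := integral_prod_kernel (X := ℝ × T.carrier) (Y := Fin m → ℝ)
    (μ := (volume.restrict (Set.Ioi (0 : ℝ))).prod T.measure) (ν := volume)
    (h := g) (E := E)
    (c := fun x => |(M x).det|⁻¹ * (Real.pi / (ρ / 4)) ^ ((m : ℝ) / 2))
    hgmeas.aestronglyMeasurable hEmeas.aestronglyMeasurable
    (fun p => (Real.exp_pos _).le) (fun x => (hE x).1) (fun x => (hE x).2)
    (by
      simp_rw [hgc]
      exact (i1'.mul_prod i2).mul_const _)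
  have hfun : (fun a => (∏ i, (T.succT a i i : ℂ) ^ ν i) *
      (Real.exp (-(1 / 4 * (T.succS a * r * (T.succS a).transpose).trace)) : ℂ)) =
      fun p : T.SuccCarrier => g p.1 * (E p : ℂ) := by
    funext p
    rw [prod_succT, succS, trace_conj_consLower_inv _ _ hr (posVal_pos _).ne', ← hρdef, mul_add,
      mul_add, neg_add, neg_add, Real.exp_add, Real.exp_add]
    simp only [g, E, M, w]
    rw [show -(1 / 4 * (ρ / posVal p.1.1 ^ 2)) = -(ρ / 4 / posVal p.1.1 ^ 2) by ring,
      ← mul_assoc (1 / 4) ρ, show 1 / 4 * ρ = ρ / 4 by ring]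
    push_cast
    ring
  rw [hfun]
  refine ⟨hkey.1, hkey.2.trans ?_⟩
  simp_rw [hgc]
  rw [integral_mul_const, integral_prod_mul, e1, e2, compPow_succ_schurMat hr, ← hρdef]
  have hshift : (fun j : Fin m => ν j.succ + 1 + (j.val : ℂ) + 1) =
      fun j : Fin m => ν j.succ + (j.succ.val : ℂ) + 1 := by
    funext j
    rw [Fin.val_succ]; push_cast; ring
  rw [hshift, triGammaInv, triGammaInv, Fin.prod_univ_succ]
  simp only [Fin.val_zero, Fin.val_succ]
  have hprod : ∏ i : Fin m, (((4 * Real.pi : ℝ) : ℂ) ^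
      ((((m + 1 : ℕ) : ℂ) - 1 - ((i.val + 1 : ℕ) : ℂ)) / 2) *
      (1 / 2 * (2 : ℂ) ^ (-(ν i.succ + (m + 1 : ℕ))) *
        Complex.Gamma (-((ν i.succ + (m + 1 : ℕ)) / 2)))) =
      ∏ i : Fin m, (((4 * Real.pi : ℝ) : ℂ) ^ (((m : ℂ) - 1 - (i.val : ℂ)) / 2) *
      (1 / 2 * (2 : ℂ) ^ (-(ν i.succ + 1 + m)) *
        Complex.Gamma (-((ν i.succ + 1 + m) / 2)))) := by
    refine Finset.prod_congr rfl fun i _ => ?_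
    have h1 : (((m + 1 : ℕ) : ℂ) - 1 - ((i.val + 1 : ℕ) : ℂ)) / 2 =
        ((m : ℂ) - 1 - (i.val : ℂ)) / 2 := by push_cast; ring
    have h2 : ν i.succ + ((m + 1 : ℕ) : ℂ) = ν i.succ + 1 + m := by push_cast; ring
    rw [h1, h2]
  rw [hprod]
  have hρc : (ρ : ℂ) ≠ 0 := by exact_mod_cast hρ.ne'
  have q1 : (((Real.pi / (ρ / 4)) ^ ((m : ℝ) / 2) : ℝ) : ℂ) =
      ((4 * Real.pi : ℝ) : ℂ) ^ ((m : ℂ) / 2) * (ρ : ℂ) ^ (-((m : ℂ) / 2)) := by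
    rw [show Real.pi / (ρ / 4) = (4 * Real.pi) * ρ⁻¹ by field_simp,
      Real.mul_rpow (by positivity) (by positivity), Real.inv_rpow hρ.le, ← Real.rpow_neg hρ.le,
      Complex.ofReal_mul, Complex.ofReal_cpow (by positivity), Complex.ofReal_cpow hρ.le]
    push_cast
    rfl
  have q2 : (((ρ / 4 : ℝ)) : ℂ) ^ ((ν 0 + m + 1) / 2) =
      (ρ : ℂ) ^ ((ν 0 + m + 1) / 2) * (2 : ℂ) ^ (-(ν 0 + (m + 1 : ℕ))) := by
    have h4 : (((1 / 2) ^ 2 : ℝ) : ℂ) ^ ((ν 0 + m + 1) / 2) =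
        (2 : ℂ) ^ (-(ν 0 + (m + 1 : ℕ))) := by
      have h5 : (((1 / 2) ^ 2 : ℝ) : ℂ) = (2 : ℂ) ^ (-2 : ℂ) := by
        rw [Complex.cpow_neg]; norm_num
      have h6 : Complex.log 2 = ((Real.log 2 : ℝ) : ℂ) := by
        rw [Complex.ofReal_log (by norm_num)]; norm_num
      have h7 : (Complex.log 2).im = 0 := by rw [h6, Complex.ofReal_im]
      rw [h5, ← Complex.cpow_mul]
      · congr 1; push_cast; ring
      · simp [h7, Real.pi_pos]
      · simp [h7, Real.pi_pos.le]
    rw [show ρ / 4 = ρ * (1 / 2) ^ 2 by ring, Complex.ofReal_mul,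
      Complex.mul_cpow_ofReal_nonneg hρ.le (by norm_num), h4]
  have q3 : (ρ : ℂ) ^ ((ν 0 + ((0 : ℕ) : ℂ) + 1) / 2) =
      (ρ : ℂ) ^ ((ν 0 + m + 1) / 2) * (ρ : ℂ) ^ (-((m : ℂ) / 2)) := by
    rw [← Complex.cpow_add _ _ hρc]
    congr 1
    push_cast; ring
  have q4 : (((m + 1 : ℕ) : ℂ) - 1 - ((0 : ℕ) : ℂ)) / 2 = (m : ℂ) / 2 := by push_cast; ring
  have q5 : ν 0 + ((m + 1 : ℕ) : ℂ) = ν 0 + m + 1 := by push_cast; ring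
  rw [q1, q2, q3, q4, q5]
  ring

/-- Enlarging the matrices by a row and a column. -/
noncomputable def succ : TriangularFamily (m + 1) where
  carrier := T.SuccCarrier
  measure := T.succMeasure
  t := T.succT
  s := T.succS
  measurable_t := fun i j => by
    have := measurable_posVal
    have := T.measurable_t
    refine Fin.cases ?_ (fun i => ?_) i <;> refine Fin.cases ?_ (fun j => ?_) j <;>
    · simp only [succT, consLower_zero_zero, consLower_zero_succ, consLower_succ_zero,
        consLower_succ_succ]
      fun_prop
  measurable_s := fun i j => by
    have := measurable_posVal
    have := T.measurable_s
    refine Fin.cases ?_ (fun i => ?_) i <;> refine Fin.cases ?_ (fun j => ?_) j <;>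
    · simp only [succS, consLower_zero_zero, consLower_zero_succ, consLower_succ_zero,
        consLower_succ_succ, Pi.neg_apply, Pi.smul_apply, Matrix.mulVec, dotProduct]
      fun_prop
  mul_eq_one := fun p => consLower_mul_inv _ _ _ (posVal_pos _).ne' (T.mul_eq_one _)
  diag_pos := fun p i => by
    refine Fin.cases ?_ (fun i => ?_) i
    · exact posVal_pos _
    · exact T.diag_pos _ _
  det_eq := fun p => by
    rw [succT, det_consLower, T.det_eq, Fin.prod_univ_succ]
    rfl
  integral_gauss := T.integral_gauss_succ
  integral_gauss_inv := T.integral_gauss_inv_succ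

end TriangularFamily

/-- The lower triangular matrices of size `m` with positive diagonal. -/
noncomputable def triangularFamily : (m : ℕ) → TriangularFamily m
  | 0 => TriangularFamily.zero
  | m + 1 => (triangularFamily m).succ

/-! ### Gaussian Fourier transforms of harmonic polynomials -/

section Hecke

set_option linter.unusedSectionVars false

variable {ι : Type*} [Fintype ι]

/-- The value of a complex polynomial at a real point. -/
noncomputable def realEval (Q : MvPolynomial ι ℂ) (x : EuclideanSpace ℝ ι) : ℂ :=
  MvPolynomial.eval (fun i => ((x i : ℝ) : ℂ)) Q

lemma continuous_realEval (Q : MvPolynomial ι ℂ) : Continuous (realEval Q) := by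
  have := MvPolynomial.continuous_eval Q
  unfold realEval
  refine this.comp (continuous_pi fun i => ?_)
  fun_prop

lemma exists_norm_realEval_le (Q : MvPolynomial ι ℂ) :
    ∃ (C : ℝ) (d : ℕ), 0 ≤ C ∧ ∀ x, ‖realEval Q x‖ ≤ C * (1 + ‖x‖) ^ d := by
  induction Q using MvPolynomial.induction_on with
  | C a => exact ⟨‖a‖, 0, norm_nonneg _, fun x => by simp [realEval]⟩
  | add p q hp hq =>
    obtain ⟨C, d, hC, h⟩ := hp
    obtain ⟨C', d', hC', h'⟩ := hq
    refine ⟨C + C', max d d', by positivity, fun x => ?_⟩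
    have h1 : (1 : ℝ) ≤ 1 + ‖x‖ := by linarith [norm_nonneg x]
    calc ‖realEval (p + q) x‖ ≤ ‖realEval p x‖ + ‖realEval q x‖ := by
          simpa [realEval] using norm_add_le (realEval p x) (realEval q x)
      _ ≤ C * (1 + ‖x‖) ^ d + C' * (1 + ‖x‖) ^ d' := add_le_add (h x) (h' x)
      _ ≤ C * (1 + ‖x‖) ^ max d d' + C' * (1 + ‖x‖) ^ max d d' := by
          gcongr
          · exact le_max_left _ _
          · exact le_max_right _ _
      _ = _ := by ring
  | mul_X p i hp =>
    obtain ⟨C, d, hC, h⟩ := hp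
    refine ⟨C, d + 1, hC, fun x => ?_⟩
    have h2 : ‖(x i : ℂ)‖ ≤ 1 + ‖x‖ := by
      rw [Complex.norm_real]
      linarith [PiLp.norm_apply_le x i]
    calc ‖realEval (p * MvPolynomial.X i) x‖ = ‖realEval p x‖ * ‖(x i : ℂ)‖ := by
          simp [realEval]
      _ ≤ (C * (1 + ‖x‖) ^ d) * (1 + ‖x‖) :=
          mul_le_mul (h x) h2 (norm_nonneg _) (by positivity)
      _ = _ := by ring

lemma integrable_pow_mul_exp_neg_sq_norm (d : ℕ) :
    Integrable (fun x : EuclideanSpace ℝ ι => (1 + ‖x‖) ^ d * Real.exp (-‖x‖ ^ 2)) := by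
  set N := Module.finrank ℝ (EuclideanSpace ℝ ι) + 1 with hN
  have hi : Integrable (fun x : EuclideanSpace ℝ ι => (1 + ‖x‖) ^ (-(N : ℝ))) :=
    integrable_one_add_norm (by rw [hN]; push_cast; linarith)
  refine (hi.const_mul ((d + N).factorial * Real.exp 2)).mono'
    (by apply Continuous.aestronglyMeasurable; fun_prop) (Eventually.of_forall fun x => ?_)
  have h0 : 0 ≤ ‖x‖ := norm_nonneg x
  rw [Real.norm_of_nonneg (by positivity), Real.rpow_neg (by positivity), Real.rpow_natCast,
    ← div_eq_mul_inv, le_div_iff₀ (by positivity)]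
  have h1 := Real.pow_div_factorial_le_exp (x := 1 + ‖x‖) (by positivity) (d + N)
  rw [div_le_iff₀ (by positivity)] at h1
  calc (1 + ‖x‖) ^ d * Real.exp (-‖x‖ ^ 2) * (1 + ‖x‖) ^ N
      = (1 + ‖x‖) ^ (d + N) * Real.exp (-‖x‖ ^ 2) := by ring
    _ ≤ (Real.exp (1 + ‖x‖) * (d + N).factorial) * Real.exp (-‖x‖ ^ 2) := by gcongr
    _ = (d + N).factorial * Real.exp (1 + ‖x‖ + -‖x‖ ^ 2) := by
        rw [Real.exp_add (1 + ‖x‖)]; ring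
    _ ≤ (d + N).factorial * Real.exp 2 := by
        gcongr
        nlinarith [sq_nonneg (‖x‖ - 1 / 2)]

/-- The modulated Gaussian. -/
noncomputable def modGauss (y x : EuclideanSpace ℝ ι) : ℂ :=
  Complex.exp (-1 * (‖x‖ : ℂ) ^ 2 + Complex.I * (inner ℝ y x : ℝ))

lemma norm_modGauss (y x : EuclideanSpace ℝ ι) : ‖modGauss y x‖ = Real.exp (-‖x‖ ^ 2) := by
  rw [modGauss, Complex.norm_exp]
  congr 1
  simp [← Complex.ofReal_pow]

lemma continuous_modGauss (y : EuclideanSpace ℝ ι) : Continuous (modGauss y) := by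
  unfold modGauss; fun_prop

lemma integrable_realEval_mul_modGauss (Q : MvPolynomial ι ℂ) (y : EuclideanSpace ℝ ι) :
    Integrable (fun x => realEval Q x * modGauss y x) := by
  obtain ⟨C, d, hC, h⟩ := exists_norm_realEval_le Q
  refine ((integrable_pow_mul_exp_neg_sq_norm d).const_mul C).mono'
    ((continuous_realEval Q).mul (continuous_modGauss y)).aestronglyMeasurable
    (Eventually.of_forall fun x => ?_)
  rw [norm_mul, norm_modGauss, ← mul_assoc]
  exact mul_le_mul_of_nonneg_right (h x) (Real.exp_pos _).le

lemma hasLineDerivAt_realEval [DecidableEq ι] (Q : MvPolynomial ι ℂ) (j : ι) (x : EuclideanSpace ℝ ι) :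
    HasLineDerivAt ℝ (realEval Q) (realEval (MvPolynomial.pderiv j Q) x) x
      (EuclideanSpace.single j 1) := by
  induction Q using MvPolynomial.induction_on with
  | C a => simpa [realEval, HasLineDerivAt] using hasDerivAt_const (0 : ℝ) a
  | add p q hp hq =>
    have := HasDerivAt.add hp hq
    simpa [realEval, HasLineDerivAt, Pi.add_def] using this
  | mul_X p i hp =>
    have hX : HasDerivAt (fun t : ℝ => (((x + t • EuclideanSpace.single j (1 : ℝ)) i : ℝ) : ℂ))
        ((Pi.single j (1 : ℂ) : ι → ℂ) i) 0 := by
      have h1 : HasDerivAt (fun t : ℝ => (x + t • EuclideanSpace.single j (1 : ℝ)) i)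
          ((Pi.single j (1 : ℝ) : ι → ℝ) i) 0 := by
        have := ((hasDerivAt_id (0 : ℝ)).mul_const
          ((Pi.single j (1 : ℝ) : ι → ℝ) i)).const_add (x i)
        simpa [Pi.single_apply] using this
      convert! h1.ofReal_comp using 1
      by_cases hij : i = j
      · subst hij; simp
      · simp [hij]
    have := HasDerivAt.mul hp hX
    simp only [HasLineDerivAt, realEval] at this ⊢
    convert! this using 1
    · funext t; simp
    · simp only [Derivation.leibniz, MvPolynomial.pderiv_X, smul_eq_mul, map_add, map_mul,
        MvPolynomial.eval_X, zero_smul, add_zero]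
      by_cases hij : i = j
      · subst hij; simp; ring
      · simp [hij]; ring

lemma hasLineDerivAt_modGauss [DecidableEq ι] (y x : EuclideanSpace ℝ ι) (j : ι) :
    HasLineDerivAt ℝ (modGauss y) ((-2 * x j + Complex.I * y j) * modGauss y x) x
      (EuclideanSpace.single j 1) := by
  have h1 : HasDerivAt (fun t : ℝ => ‖x + t • EuclideanSpace.single j (1 : ℝ)‖ ^ 2) (2 * x j) 0 := by
    have h2 : ∀ t : ℝ, ‖x + t • EuclideanSpace.single j (1 : ℝ)‖ ^ 2 =
        ‖x‖ ^ 2 + t * (2 * x j) + t ^ 2 := by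
      intro t
      rw [norm_add_sq_real, norm_smul, inner_smul_right, EuclideanSpace.inner_single_right]
      simp
      ring
    simp_rw [h2]
    have := (((hasDerivAt_id (0 : ℝ)).mul_const (2 * x j)).const_add (‖x‖ ^ 2)).add
      (hasDerivAt_pow 2 (0 : ℝ))
    simpa [Pi.add_def] using this
  have h3 : HasDerivAt (fun t : ℝ => inner ℝ y (x + t • EuclideanSpace.single j (1 : ℝ)))
      (y j) 0 := by
    have h2 : ∀ t : ℝ, inner ℝ y (x + t • EuclideanSpace.single j (1 : ℝ)) =
        inner ℝ y x + t * y j := by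
      intro t
      rw [inner_add_right, inner_smul_right, EuclideanSpace.inner_single_right]
      simp
    simp_rw [h2]
    simpa using ((hasDerivAt_id (0 : ℝ)).mul_const (y j)).const_add (inner ℝ y x)
  have h4 := ((h1.ofReal_comp.const_mul (-1 : ℂ)).add
    (h3.ofReal_comp.const_mul Complex.I)).cexp
  simp only [HasLineDerivAt, modGauss]
  convert! h4 using 1
  · funext t; simp
  · simp; ring

/-- Integration by parts in the direction `j`, since the Gaussian has logarithmic derivative `-2 x_j
+ i y_j`. -/
lemma integral_X_mul_modGauss [DecidableEq ι] (Q : MvPolynomial ι ℂ) (y : EuclideanSpace ℝ ι) (j : ι) :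
    ∫ x, realEval (MvPolynomial.X j * Q) x * modGauss y x =
      1 / 2 * (∫ x, realEval (MvPolynomial.pderiv j Q) x * modGauss y x) +
        Complex.I / 2 * y j * ∫ x, realEval Q x * modGauss y x := by
  have iX := integrable_realEval_mul_modGauss (MvPolynomial.X j * Q) y
  have iQ := integrable_realEval_mul_modGauss Q y
  have e : (fun x => realEval Q x * ((-2 * x j + Complex.I * y j) * modGauss y x)) =
      fun x => -2 * (realEval (MvPolynomial.X j * Q) x * modGauss y x) +
        Complex.I * y j * (realEval Q x * modGauss y x) := by
    funext x
    simp only [realEval, map_mul, MvPolynomial.eval_X]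
    ring
  have h := integral_bilinear_hasLineDerivAt_right_eq_neg_left_of_integrable
    (μ := (volume : Measure (EuclideanSpace ℝ ι))) (B := ContinuousLinearMap.mul ℝ ℂ)
    (f := realEval Q) (f' := realEval (MvPolynomial.pderiv j Q)) (g := modGauss y)
    (g' := fun x => (-2 * x j + Complex.I * y j) * modGauss y x) (v := EuclideanSpace.single j 1)
    (integrable_realEval_mul_modGauss _ y)
    (by
      simp only [ContinuousLinearMap.mul_apply']
      rw [e]
      exact (iX.const_mul _).add (iQ.const_mul _))
    iQ (fun x _ => hasLineDerivAt_realEval Q j x) (fun x _ => hasLineDerivAt_modGauss y x j)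
  simp only [ContinuousLinearMap.mul_apply'] at h
  rw [e, integral_add (iX.const_mul _) (iQ.const_mul _), integral_const_mul, integral_const_mul]
    at h
  linear_combination (-1 / 2) * h

/-- The Fourier transform of a homogeneous harmonic polynomial times a Gaussian. -/
lemma integral_harmonic_mul_modGauss (d : ℕ) (Q : MvPolynomial ι ℂ) (hQ : Q.IsHomogeneous d)
    (hharm : ∑ i, MvPolynomial.pderiv i (MvPolynomial.pderiv i Q) = 0)
    (y : EuclideanSpace ℝ ι) :
    ∫ x, realEval Q x * modGauss y x =
      (Complex.I / 2) ^ d * realEval Q y * ∫ x, modGauss y x := by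
  classical
  induction d generalizing Q with
  | zero =>
    rw [← MvPolynomial.totalDegree_zero_iff_isHomogeneous,
      MvPolynomial.totalDegree_eq_zero_iff_eq_C] at hQ
    rw [hQ]
    simp only [realEval, MvPolynomial.eval_C, pow_zero, one_mul]
    rw [integral_const_mul]
  | succ d ih =>
    -- The partial derivatives of `Q` are again harmonic and homogeneous, of degree `d`.
    have hpd : ∀ i, ∫ x, realEval (MvPolynomial.pderiv i Q) x * modGauss y x =
        (Complex.I / 2) ^ d * realEval (MvPolynomial.pderiv i Q) y * ∫ x, modGauss y x := by
      intro i
      refine ih _ (by simpa using hQ.pderiv (i := i)) ?_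
      have := congrArg (MvPolynomial.pderiv i) hharm
      rw [map_sum, map_zero] at this
      rw [← this]
      refine Finset.sum_congr rfl fun j _ => ?_
      have comm : ∀ (a b : ι) (R : MvPolynomial ι ℂ), MvPolynomial.pderiv a
          (MvPolynomial.pderiv b R) = MvPolynomial.pderiv b (MvPolynomial.pderiv a R) := by
        intro a b R
        let D : ι → Derivation ℂ (MvPolynomial ι ℂ) (MvPolynomial ι ℂ) := MvPolynomial.pderiv
        -- The commutator of two derivations is a derivation, and it vanishes on the variables.
        have h0 : ⁅D a, D b⁆ = 0 := by
          refine MvPolynomial.derivation_ext fun k => ?_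
          rw [Derivation.commutator_apply]
          simp only [D, MvPolynomial.pderiv_X, Derivation.zero_apply, Pi.single_apply]
          split_ifs <;> simp
        have h1 := congrArg (fun D : Derivation ℂ (MvPolynomial ι ℂ) (MvPolynomial ι ℂ) => D R) h0
        simpa [D, Derivation.commutator_apply, sub_eq_zero] using h1
      rw [comm j i Q, comm j i]
    have hEuler := hQ.sum_X_mul_pderiv
    have hd : ((d + 1 : ℕ) : ℂ) ≠ 0 := by exact_mod_cast Nat.succ_ne_zero d
    -- Euler's identity writes `(d + 1) Q` as the sum of the `x_i ∂_i Q`. Integration by parts turns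
    -- it into a Laplacian term, which vanishes, and `i/2` times the sum of `y_i` times the
    -- transform of `∂_i Q`; Euler's identity at `y` reassembles `Q`.
    have h1 : ((d + 1 : ℕ) : ℂ) * ∫ x, realEval Q x * modGauss y x =
        ∑ i, ∫ x, realEval (MvPolynomial.X i * MvPolynomial.pderiv i Q) x * modGauss y x := by
      rw [← integral_finsetSum _ fun i _ => integrable_realEval_mul_modGauss _ y,
        ← integral_const_mul]
      refine integral_congr_ae (Eventually.of_forall fun x => ?_)
      simp only
      rw [← Finset.sum_mul, ← mul_assoc]
      congr 1
      have := congrArg (fun R => realEval R x) hEuler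
      simp only [realEval, map_sum, nsmul_eq_mul] at this ⊢
      rw [this, map_mul, map_natCast]
    have h2 : ∑ i, ∫ x, realEval (MvPolynomial.pderiv i (MvPolynomial.pderiv i Q)) x *
        modGauss y x = 0 := by
      rw [← integral_finsetSum _ fun i _ => integrable_realEval_mul_modGauss _ y]
      rw [← integral_zero (EuclideanSpace ℝ ι) ℂ (μ := volume)]
      refine integral_congr_ae (Eventually.of_forall fun x => ?_)
      simp only
      rw [← Finset.sum_mul]
      have := congrArg (fun R => realEval R x) hharm
      simp only [realEval, map_sum, map_zero] at this ⊢
      rw [this, zero_mul]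
    have h3 : ((d + 1 : ℕ) : ℂ) * realEval Q y =
        ∑ i, (y i : ℂ) * realEval (MvPolynomial.pderiv i Q) y := by
      have := congrArg (fun R => realEval R y) hEuler
      simp only [realEval, map_sum, nsmul_eq_mul, map_mul, MvPolynomial.eval_X, map_natCast]
        at this ⊢
      rw [this]
    simp_rw [integral_X_mul_modGauss, hpd] at h1
    rw [Finset.sum_add_distrib, ← Finset.mul_sum, h2, mul_zero, zero_add] at h1
    have h4 : ∑ i, Complex.I / 2 * (y i : ℂ) * ((Complex.I / 2) ^ d *
        realEval (MvPolynomial.pderiv i Q) y * ∫ x, modGauss y x) =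
        (Complex.I / 2) ^ (d + 1) * (∫ x, modGauss y x) *
          ∑ i, (y i : ℂ) * realEval (MvPolynomial.pderiv i Q) y := by
      rw [Finset.mul_sum]
      exact Finset.sum_congr rfl fun i _ => by ring
    rw [h4, ← h3] at h1
    have : ((d + 1 : ℕ) : ℂ) * ((∫ x, realEval Q x * modGauss y x) -
        (Complex.I / 2) ^ (d + 1) * realEval Q y * ∫ x, modGauss y x) = 0 := by
      linear_combination h1
    exact sub_eq_zero.1 ((mul_eq_zero.1 this).resolve_left hd)

lemma integral_modGauss (y : EuclideanSpace ℝ ι) :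
    ∫ x, modGauss y x =
      (Real.pi : ℂ) ^ (Fintype.card ι / 2 : ℂ) * (Real.exp (-(1 / 4 * ‖y‖ ^ 2)) : ℂ) := by
  have := GaussianFourier.integral_cexp_neg_mul_sq_norm_add_of_euclideanSpace (b := 1)
    (by simp) Complex.I y
  simp only [modGauss]
  rw [this]
  simp [Complex.I_sq]
  ring_nf

/-- The difference of the two sides is the polynomial `Q'`, with coefficients multiplied by `2 ^ |s|
- 2 ^ d`. It vanishes at all real points, hence identically, so only monomials of degree `d`
survive. -/
lemma isHomogeneous_of_eval_two_mul (Q : MvPolynomial ι ℂ) (d : ℕ)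
    (h : ∀ x : ι → ℝ, MvPolynomial.eval (fun i => ((2 * x i : ℝ) : ℂ)) Q =
      2 ^ d * MvPolynomial.eval (fun i => (x i : ℂ)) Q) : Q.IsHomogeneous d := by
  let Q' : MvPolynomial ι ℂ :=
    ∑ s ∈ Q.support, MvPolynomial.monomial s (Q.coeff s * (2 ^ s.degree - 2 ^ d))
  have hev : ∀ x : ι → ℝ, MvPolynomial.eval (fun i => (x i : ℂ)) Q' = 0 := by
    intro x
    have hx := h x
    rw [MvPolynomial.eval_eq, MvPolynomial.eval_eq, Finset.mul_sum] at hx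
    rw [map_sum, ← sub_eq_zero.2 hx, ← Finset.sum_sub_distrib]
    refine Finset.sum_congr rfl fun s _ => ?_
    rw [MvPolynomial.eval_monomial, Finsupp.prod]
    simp only [Complex.ofReal_mul, Complex.ofReal_ofNat, mul_pow, Finset.prod_mul_distrib,
      Finset.prod_pow_eq_pow_sum, ← Finsupp.degree_apply]
    ring
  have hQ' : Q' = 0 := by
    refine MvPolynomial.funext_set (fun _ => Set.range ((↑) : ℝ → ℂ))
      (fun _ => Set.infinite_range_of_injective Complex.ofReal_injective) fun z hz => ?_
    choose x hx using fun i => hz i (Set.mem_univ i)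
    have : z = fun i => (x i : ℂ) := funext fun i => (hx i).symm
    rw [this, hev, map_zero]
  intro s hs
  have hc : Q'.coeff s = Q.coeff s * (2 ^ s.degree - 2 ^ d) := by
    classical
    rw [MvPolynomial.coeff_sum, Finset.sum_eq_single s]
    · rw [MvPolynomial.coeff_monomial, if_pos rfl]
    · intro b _ hb; rw [MvPolynomial.coeff_monomial, if_neg hb]
    · intro hns
      rw [MvPolynomial.coeff_monomial, if_pos rfl, MvPolynomial.notMem_support_iff.1 hns, zero_mul]
  rw [hQ', MvPolynomial.coeff_zero] at hc
  have h2 := (mul_eq_zero.1 hc.symm).resolve_left hs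
  rw [sub_eq_zero] at h2
  have h3 : (2 : ℕ) ^ s.degree = 2 ^ d := by exact_mod_cast h2
  have h4 := Nat.pow_right_injective le_rfl h3
  rw [← h4, Finsupp.degree_eq_weight_one]
  rfl

end Hecke

/-! ### Right multiplication on matrix space -/

section MatSpace

variable {n m : ℕ}

/-- The point of matrix space with the given coordinates. -/
def ofMat (x : Matrix (Fin n) (Fin m) ℝ) : MatSpace n m := WithLp.toLp 2 fun p => x p.1 p.2

@[simp] lemma toMat_ofMat (x : Matrix (Fin n) (Fin m) ℝ) : toMat (ofMat x) = x := rfl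

lemma toMat_apply (x : MatSpace n m) (i : Fin n) (j : Fin m) : toMat x i j = x (i, j) := rfl

lemma evalMat_toMat (P : MvPolynomial (Fin n × Fin m) ℂ) (x : MatSpace n m) :
    evalMat P (toMat x) = realEval P x := rfl

lemma norm_sq_eq_trace (x : MatSpace n m) : ‖x‖ ^ 2 = ((toMat x).transpose * toMat x).trace := by
  rw [← inner_eq_trace, real_inner_self_eq_norm_sq]

/-- Right multiplication of a matrix. -/
def rmul (x : MatSpace n m) (t : Matrix (Fin m) (Fin m) ℝ) : MatSpace n m := ofMat (toMat x * t)

lemma toMat_rmul (x : MatSpace n m) (t : Matrix (Fin m) (Fin m) ℝ) :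
    toMat (rmul x t) = toMat x * t := rfl

lemma rmul_rmul (x : MatSpace n m) (t s : Matrix (Fin m) (Fin m) ℝ) :
    rmul (rmul x t) s = rmul x (t * s) := by
  simp only [rmul, toMat_ofMat, Matrix.mul_assoc]

lemma rmul_one (x : MatSpace n m) : rmul x 1 = x := by
  simp only [rmul, Matrix.mul_one]; rfl

lemma norm_rmul_sq (x : MatSpace n m) (t : Matrix (Fin m) (Fin m) ℝ) :
    ‖rmul x t‖ ^ 2 = (t.transpose * radial x * t).trace := by
  rw [norm_sq_eq_trace, toMat_rmul, Matrix.transpose_mul, radial]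
  simp only [Matrix.mul_assoc]

lemma inner_rmul (x y : MatSpace n m) (t : Matrix (Fin m) (Fin m) ℝ) :
    inner ℝ (rmul x t) y = inner ℝ x (rmul y t.transpose) := by
  rw [inner_eq_trace, inner_eq_trace, toMat_rmul, toMat_rmul, Matrix.transpose_mul,
    Matrix.transpose_transpose, ← Matrix.mul_assoc, Matrix.trace_mul_comm, Matrix.mul_assoc]

/-- Used for the Jacobian: the determinant of this Kronecker product is `t.det ^ n`. -/
lemma rmul_eq_kronecker (x : MatSpace n m) (t : Matrix (Fin m) (Fin m) ℝ) :
    (rmul x t).ofLp =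
      (Matrix.kronecker (1 : Matrix (Fin n) (Fin n) ℝ) t.transpose).mulVec x.ofLp := by
  funext p
  simp only [rmul, ofMat, Matrix.mul_apply, Matrix.mulVec, dotProduct, Fintype.sum_prod_type,
    Matrix.kronecker, Matrix.kroneckerMap_apply, Matrix.transpose_apply, Matrix.one_apply,
    ite_mul, one_mul, zero_mul, Finset.sum_ite_irrel, Finset.sum_const_zero]
  simp [toMat, mul_comm]

lemma integral_comp_rmul (t : Matrix (Fin m) (Fin m) ℝ) (ht : t.det ≠ 0) (f : MatSpace n m → ℂ) :
    ∫ x, f (rmul x t) = ((|t.det| ^ n)⁻¹ : ℝ) • ∫ x, f x := by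
  set M := Matrix.kronecker (1 : Matrix (Fin n) (Fin n) ℝ) t.transpose with hM
  have hdet : M.det = t.det ^ n := by
    rw [hM, Matrix.kronecker, Matrix.det_kronecker]; simp
  have hMdet : M.det ≠ 0 := by rw [hdet]; exact pow_ne_zero _ ht
  have hvp := PiLp.volume_preserving_ofLp (Fin n × Fin m)
  have hemb : MeasurableEmbedding (@WithLp.ofLp 2 (Fin n × Fin m → ℝ)) :=
    (MeasurableEquiv.toLp 2 (Fin n × Fin m → ℝ)).symm.measurableEmbedding
  have h1 : ∫ x, f (rmul x t) = ∫ x : Fin n × Fin m → ℝ, f (WithLp.toLp 2 (M.mulVec x)) := by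
    rw [← hvp.integral_comp hemb (fun x : Fin n × Fin m → ℝ => f (WithLp.toLp 2 (M.mulVec x)))]
    refine integral_congr_ae (Eventually.of_forall fun x => ?_)
    simp only
    rw [← rmul_eq_kronecker]
  have h2 : ∫ x, f x = ∫ x : Fin n × Fin m → ℝ, f (WithLp.toLp 2 x) := by
    rw [← hvp.integral_comp hemb (fun x : Fin n × Fin m → ℝ => f (WithLp.toLp 2 x))]
  have hmap := Real.map_matrix_volume_pi_eq_smul_volume_pi hMdet
  have hemb2 : MeasurableEmbedding (Matrix.toLin' M) := by
    have hL : LinearMap.det (Matrix.toLin' M) ≠ 0 := by rwa [LinearMap.det_toLin']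
    exact ((LinearMap.equivOfDetNeZero _ hL).toContinuousLinearEquiv.toHomeomorph).measurableEmbedding
  have h3 := hemb2.integral_map (μ := volume) (fun x : Fin n × Fin m → ℝ => f (WithLp.toLp 2 x))
  rw [hmap, integral_smul_measure, ENNReal.toReal_ofReal (abs_nonneg _)] at h3
  rw [h1, h2]
  simp only [Matrix.toLin'_apply] at h3
  rw [← h3, hdet, abs_inv, abs_pow]

/-- The scalar matrix 2 has determinant `2 ^ m`. -/
lemma isHomogeneous_of_isDetHomogeneous {k : ℕ} {P : MvPolynomial (Fin n × Fin m) ℂ}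
    (h : IsDetHomogeneous k P) : P.IsHomogeneous (k * m) := by
  refine isHomogeneous_of_eval_two_mul P (k * m) fun x => ?_
  have hdet : ((2 : ℝ) • (1 : Matrix (Fin m) (Fin m) ℝ)).det = 2 ^ m := by
    rw [Matrix.det_smul]; simp
  have := h ((2 : ℝ) • 1) (by rw [hdet]; exact isUnit_iff_ne_zero.2 (by positivity))
    (Matrix.of fun i j => x (i, j))
  rw [hdet] at this
  simp only [evalMat, Matrix.mul_smul, Matrix.mul_one, Matrix.smul_apply, Matrix.of_apply,
    smul_eq_mul] at this
  rw [this]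
  push_cast
  rw [← pow_mul, mul_comm m k]

/-- The Fourier transform of `P(x) exp (-|x t|²)`. -/
lemma integral_evalMat_mul_gauss {k : ℕ} {P : MvPolynomial (Fin n × Fin m) ℂ}
    (hharm : IsHarmonicPoly P) (hdet : IsDetHomogeneous k P) {t s : Matrix (Fin m) (Fin m) ℝ}
    (hts : t * s = 1) (ht : 0 < t.det) (y : MatSpace n m) :
    ∫ x, evalMat P (toMat x) * (Real.exp (-(t.transpose * radial x * t).trace) : ℂ) *
        Complex.exp (Complex.I * (((toMat y).transpose * toMat x).trace : ℝ)) =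
      (Real.pi : ℂ) ^ ((n : ℂ) * m / 2) * (Complex.I / 2) ^ (k * m) *
        (((t.det ^ (2 * k + n))⁻¹ : ℝ) : ℂ) *
        (evalMat P (toMat y) * (Real.exp (-(1 / 4 * (s * radial y * s.transpose).trace)) : ℂ)) := by
  have hst : s * t = 1 := mul_eq_one_comm.1 hts
  have hsdet : s.det = (t.det)⁻¹ := by
    have := congrArg Matrix.det hts
    rw [Matrix.det_mul, Matrix.det_one] at this
    exact eq_inv_of_mul_eq_one_right this
  have hsu : IsUnit s.det := by rw [hsdet]; exact isUnit_iff_ne_zero.2 (inv_ne_zero ht.ne')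
  -- Substitute `z = x t`. Then `P(x) = det(s)^k P(z)` and the phase becomes the inner product of
  -- `z` with `y s'`, so Hecke's formula is evaluated at `y s'`. There homogeneity gives a second
  -- `det(s)^k`; with the Jacobian this is the power `-(2k + n)` of `det t`.
  let F : MatSpace n m → ℂ := fun z => ((s.det : ℝ) : ℂ) ^ k *
    (realEval P z * modGauss (rmul y s.transpose) z)
  have hfun : ∀ x : MatSpace n m,
      evalMat P (toMat x) * (Real.exp (-(t.transpose * radial x * t).trace) : ℂ) *
        Complex.exp (Complex.I * (((toMat y).transpose * toMat x).trace : ℝ)) =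
      F (rmul x t) := by
    intro x
    have e1 : toMat x = toMat (rmul x t) * s := by
      rw [toMat_rmul, Matrix.mul_assoc, hts, Matrix.mul_one]
    have e2 : evalMat P (toMat x) = ((s.det : ℝ) : ℂ) ^ k * realEval P (rmul x t) := by
      rw [e1, hdet s hsu]; rfl
    have e3 : inner ℝ (rmul y s.transpose) (rmul x t) =
        ((toMat y).transpose * toMat x).trace := by
      rw [inner_rmul, Matrix.transpose_transpose, rmul_rmul, hts, rmul_one, real_inner_comm,
        inner_eq_trace]
    have e5 : (‖rmul x t‖ : ℂ) ^ 2 = ((t.transpose * radial x * t).trace : ℝ) := by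
      rw [← Complex.ofReal_pow, norm_rmul_sq]
    simp only [F, modGauss]
    rw [e2, e3, e5, Complex.exp_add]
    push_cast
    ring_nf
  rw [integral_congr_ae (Eventually.of_forall hfun), integral_comp_rmul t ht.ne' F]
  simp only [F]
  rw [integral_const_mul,
    integral_harmonic_mul_modGauss (k * m) P (isHomogeneous_of_isDetHomogeneous hdet) hharm,
    integral_modGauss, norm_rmul_sq, Matrix.transpose_transpose]
  have e4 : realEval P (rmul y s.transpose) = ((s.det : ℝ) : ℂ) ^ k * evalMat P (toMat y) := by
    rw [← evalMat_toMat, toMat_rmul, hdet _ (by rwa [Matrix.det_transpose]), Matrix.det_transpose]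
  rw [e4, hsdet, abs_of_pos ht]
  simp only [Fintype.card_prod, Fintype.card_fin, Complex.real_smul]
  push_cast
  rw [show 2 * k + n = k + k + n by ring, pow_add, pow_add, mul_inv, mul_inv, inv_pow]
  ring

end MatSpace

/-! ### Parseval's equality for Gaussians times `P` -/

section GaussParseval

variable {n m : ℕ}

/-- Right multiplication by an invertible matrix. -/
noncomputable def rmulEquiv {t s : Matrix (Fin m) (Fin m) ℝ} (hts : t * s = 1) :
    MatSpace n m ≃ₗ[ℝ] MatSpace n m where
  toFun x := rmul x t
  invFun x := rmul x s
  map_add' x y := by ext p; simp [rmul, ofMat, toMat, Matrix.mul_apply, add_mul, Finset.sum_add_distrib]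
  map_smul' c x := by ext p; simp [rmul, ofMat, toMat, Matrix.mul_apply, Finset.mul_sum, mul_assoc]
  left_inv x := by
    change rmul (rmul x t) s = x
    rw [rmul_rmul, hts, rmul_one]
  right_inv x := by
    change rmul (rmul x s) t = x
    rw [rmul_rmul, mul_eq_one_comm.1 hts, rmul_one]

lemma integrable_comp_rmul {t s : Matrix (Fin m) (Fin m) ℝ} (hts : t * s = 1)
    {f : MatSpace n m → ℂ} (hf : Integrable f) : Integrable fun x => f (rmul x t) := by
  have h := Measure.map_linearMap_addHaar_eq_smul_addHaar (volume : Measure (MatSpace n m))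
    (f := (rmulEquiv (n := n) hts : MatSpace n m →ₗ[ℝ] MatSpace n m)) (LinearEquiv.isUnit_det' _).ne_zero
  have hemb : MeasurableEmbedding (rmulEquiv (n := n) hts) :=
    (rmulEquiv (n := n) hts).toContinuousLinearEquiv.toHomeomorph.measurableEmbedding
  have h2 : Integrable f (Measure.map (rmulEquiv (n := n) hts) volume) := by
    have : Measure.map (rmulEquiv (n := n) hts) volume = _ := h
    rw [this]
    exact hf.smul_measure ENNReal.ofReal_ne_top
  exact (hemb.integrable_map_iff.1 h2)

lemma continuous_toMat : Continuous fun x : MatSpace n m => toMat x :=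
  continuous_matrix fun i j => by simp only [toMat_apply]; fun_prop

lemma continuous_radial : Continuous fun x : MatSpace n m => radial x :=
  continuous_toMat.matrix_transpose.matrix_mul continuous_toMat

lemma continuous_evalMat (P : MvPolynomial (Fin n × Fin m) ℂ) :
    Continuous fun x : MatSpace n m => evalMat P (toMat x) := continuous_realEval P

lemma integrable_evalMat_mul_gauss {k : ℕ} {P : MvPolynomial (Fin n × Fin m) ℂ}
    (hdet : IsDetHomogeneous k P) {t s : Matrix (Fin m) (Fin m) ℝ} (hts : t * s = 1) :
    Integrable fun x : MatSpace n m =>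
      evalMat P (toMat x) * (Real.exp (-(t.transpose * radial x * t).trace) : ℂ) := by
  have hsu : IsUnit s.det := by
    have := congrArg Matrix.det hts
    rw [Matrix.det_mul, Matrix.det_one] at this
    exact IsUnit.of_mul_eq_one _ (by rw [mul_comm]; exact this)
  have h := (integrable_comp_rmul (n := n) hts
    (integrable_realEval_mul_modGauss P 0)).const_mul (((s.det : ℝ) : ℂ) ^ k)
  refine h.congr (Eventually.of_forall fun x => ?_)
  have e1 : toMat x = toMat (rmul x t) * s := by
    rw [toMat_rmul, Matrix.mul_assoc, hts, Matrix.mul_one]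
  have e2 : evalMat P (toMat x) = ((s.det : ℝ) : ℂ) ^ k * realEval P (rmul x t) := by
    rw [e1, hdet s hsu]; rfl
  simp only [modGauss, inner_zero_left]
  rw [e2, ← norm_rmul_sq]
  push_cast
  simp [mul_assoc]

/-- The Parseval equality for `P(x) exp (-|x t|²)` and a Schwartz function. -/
lemma integral_evalMat_mul_gauss_mul_fourierS {k : ℕ} {P : MvPolynomial (Fin n × Fin m) ℂ}
    (hharm : IsHarmonicPoly P) (hdet : IsDetHomogeneous k P) {t s : Matrix (Fin m) (Fin m) ℝ}
    (hts : t * s = 1) (ht : 0 < t.det) (φ : 𝓢(MatSpace n m, ℂ)) :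
    ∫ x, evalMat P (toMat x) * (Real.exp (-(t.transpose * radial x * t).trace) : ℂ) *
        fourierS n m φ x =
      (Real.pi : ℂ) ^ ((n : ℂ) * m / 2) * (Complex.I / 2) ^ (k * m) *
        (((t.det ^ (2 * k + n))⁻¹ : ℝ) : ℂ) *
        ∫ y, evalMat P (toMat y) *
          (Real.exp (-(1 / 4 * (s * radial y * s.transpose).trace)) : ℂ) * φ y := by
  set g : MatSpace n m → ℂ := fun x =>
    evalMat P (toMat x) * (Real.exp (-(t.transpose * radial x * t).trace) : ℂ) with hg
  have hgi : Integrable g := integrable_evalMat_mul_gauss hdet hts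
  have hsymm : ∀ x y : MatSpace n m, ((toMat x).transpose * toMat y).trace =
      ((toMat y).transpose * toMat x).trace := fun x y => by
    rw [← inner_eq_trace, ← inner_eq_trace, real_inner_comm]
  have hc : Continuous fun p : MatSpace n m × MatSpace n m =>
      Complex.exp (Complex.I * (((toMat p.1).transpose * toMat p.2).trace : ℝ)) := by
    simp_rw [← inner_eq_trace]
    fun_prop
  have hint : Integrable (fun p : MatSpace n m × MatSpace n m =>
      g p.1 * φ p.2 * Complex.exp (Complex.I * (((toMat p.1).transpose * toMat p.2).trace : ℝ)))
      (volume.prod volume) := by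
    refine (hgi.mul_prod φ.integrable).mul_bdd (c := 1) hc.aestronglyMeasurable ?_
    refine Eventually.of_forall fun p => ?_
    rw [mul_comm, Complex.norm_exp_ofReal_mul_I]
  calc ∫ x, g x * fourierS n m φ x
      = ∫ x, ∫ y, g x * φ y *
          Complex.exp (Complex.I * (((toMat x).transpose * toMat y).trace : ℝ)) := by
        refine integral_congr_ae (Eventually.of_forall fun x => ?_)
        simp only
        rw [fourierS_apply, ← integral_const_mul]
        refine integral_congr_ae (Eventually.of_forall fun y => ?_)
        simp only
        ring
    _ = ∫ y, ∫ x, g x * φ y *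
          Complex.exp (Complex.I * (((toMat x).transpose * toMat y).trace : ℝ)) :=
        integral_integral_swap hint
    _ = _ := by
        rw [← integral_const_mul]
        refine integral_congr_ae (Eventually.of_forall fun y => ?_)
        simp only
        have h := integral_evalMat_mul_gauss hharm hdet hts ht y
        calc ∫ x, g x * φ y *
              Complex.exp (Complex.I * (((toMat x).transpose * toMat y).trace : ℝ))
            = ∫ x, φ y * (g x *
              Complex.exp (Complex.I * (((toMat y).transpose * toMat x).trace : ℝ))) := by
              refine integral_congr_ae (Eventually.of_forall fun x => ?_)
              simp only
              rw [hsymm x y]; ring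
          _ = _ := by
              rw [integral_const_mul, h]; ring

end GaussParseval

/-! ### Integrability of powers of the distance to a subspace -/

open Module in
lemma integrable_norm_rpow_mul {F : Type*} [NormedAddCommGroup F] [InnerProductSpace ℝ F]
    [FiniteDimensional ℝ F] [MeasurableSpace F] [BorelSpace F] (hd : 0 < finrank ℝ F) {a N : ℝ}
    (ha : -(finrank ℝ F : ℝ) < a) (hN : finrank ℝ F + a < N) :
    Integrable fun z : F => ‖z‖ ^ a * (1 + ‖z‖) ^ (-N) := by
  have : Nontrivial F := Module.nontrivial_of_finrank_pos hd
  rw [integrable_fun_norm_addHaar volume (f := fun t => t ^ a * (1 + t) ^ (-N))]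
  set d := finrank ℝ F with hd'
  have hcast : ((d - 1 : ℕ) : ℝ) = d - 1 := by
    rw [Nat.cast_sub hd, Nat.cast_one]
  have hform : ∀ t : ℝ, 0 < t → t ^ (d - 1) • (t ^ a * (1 + t) ^ (-N)) =
      t ^ ((d : ℝ) - 1 + a) * (1 + t) ^ (-N) := fun t ht => by
    rw [smul_eq_mul, ← mul_assoc, ← Real.rpow_natCast, hcast, ← Real.rpow_add ht]
  have hmeas : Measurable fun t : ℝ => t ^ (d - 1) • (t ^ a * (1 + t) ^ (-N)) := by fun_prop
  -- In polar coordinates the singularity at 0 is `t ^ (d - 1 + a)` with `a > -d`, and the decay at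
  -- infinity is `t ^ (d - 1 + a - N)` with exponent below -1.
  rw [← Set.Ioo_union_Ici_eq_Ioi (zero_lt_one (α := ℝ))]
  refine IntegrableOn.union ?_ ?_
  · have h1 : IntegrableOn (fun t : ℝ => t ^ ((d : ℝ) - 1 + a)) (Set.Ioo 0 1) :=
      (intervalIntegral.integrableOn_Ioo_rpow_iff zero_lt_one).2 (by linarith)
    refine Integrable.mono' h1 hmeas.aestronglyMeasurable ?_
    filter_upwards [ae_restrict_mem measurableSet_Ioo] with t ht
    have ht0 : 0 < t := ht.1
    rw [hform t ht0, Real.norm_of_nonneg (by positivity)]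
    exact mul_le_of_le_one_right (by positivity)
      (Real.rpow_le_one_of_one_le_of_nonpos (by linarith) (by linarith))
  · have h1 : IntegrableOn (fun t : ℝ => t ^ ((d : ℝ) - 1 + a - N)) (Set.Ici 1) := by
      rw [integrableOn_Ici_iff_integrableOn_Ioi]
      exact integrableOn_Ioi_rpow_of_lt (by linarith) zero_lt_one
    refine Integrable.mono' h1 hmeas.aestronglyMeasurable ?_
    filter_upwards [ae_restrict_mem measurableSet_Ici] with t ht
    have ht0 : 0 < t := lt_of_lt_of_le zero_lt_one ht
    rw [hform t ht0, Real.norm_of_nonneg (by positivity), sub_eq_add_neg ((d : ℝ) - 1 + a),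
      Real.rpow_add ht0 ((d : ℝ) - 1 + a)]
    exact mul_le_mul_of_nonneg_left
      (Real.rpow_le_rpow_of_nonpos ht0 (by linarith) (by linarith)) (by positivity)

/-- The sum of two powers, a majorant for all powers with intermediate exponents. -/
noncomputable def twoPow (a b s : ℝ) : ℝ := s ^ (a / 2) + s ^ (b / 2)

lemma twoPow_nonneg {a b s : ℝ} (hs : 0 ≤ s) : 0 ≤ twoPow a b s := by
  unfold twoPow; positivity

lemma measurable_twoPow (a b : ℝ) : Measurable (twoPow a b) := by
  unfold twoPow; fun_prop

lemma sq_rpow_half {x : ℝ} (hx : 0 ≤ x) (a : ℝ) : (x ^ 2) ^ (a / 2) = x ^ a := by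
  rw [← Real.rpow_natCast, ← Real.rpow_mul hx]
  congr 1; push_cast; ring

open Module in
lemma lintegral_twoPow_lt_top {F : Type*} [NormedAddCommGroup F] [InnerProductSpace ℝ F]
    [FiniteDimensional ℝ F] [MeasurableSpace F] [BorelSpace F] (hd : 0 < finrank ℝ F) {a b N : ℝ}
    (ha : -(finrank ℝ F : ℝ) < a) (hb : -(finrank ℝ F : ℝ) < b) (hN : finrank ℝ F + a < N)
    (hN' : finrank ℝ F + b < N) :
    ∫⁻ z : F, ENNReal.ofReal (twoPow a b (‖z‖ ^ 2)) * ENNReal.ofReal ((1 + ‖z‖) ^ (-N)) < ⊤ := by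
  have h := ((integrable_norm_rpow_mul hd ha hN).add
    (integrable_norm_rpow_mul hd hb hN')).lintegral_lt_top
  refine lt_of_le_of_lt (lintegral_mono fun z => ?_) h
  rw [← ENNReal.ofReal_mul (twoPow_nonneg (by positivity)), twoPow, sq_rpow_half (norm_nonneg _),
    sq_rpow_half (norm_nonneg _), add_mul]
  rfl

-- Replaces a varying subspace by a standard space of the same dimension, which makes the bounds
-- below uniform in the subspace.
open Module in
lemma lintegral_norm_eq_of_finrank_eq {F G : Type*} [NormedAddCommGroup F] [InnerProductSpace ℝ F]
    [FiniteDimensional ℝ F] [MeasurableSpace F] [BorelSpace F] [NormedAddCommGroup G]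
    [InnerProductSpace ℝ G] [FiniteDimensional ℝ G] [MeasurableSpace G] [BorelSpace G]
    (h : finrank ℝ F = finrank ℝ G) (f : ℝ → ENNReal) :
    ∫⁻ x : F, f ‖x‖ = ∫⁻ x : G, f ‖x‖ := by
  let e : F ≃ₗᵢ[ℝ] G := (stdOrthonormalBasis ℝ F).repr.trans
    ((stdOrthonormalBasis ℝ G).reindex (finCongr h.symm)).repr.symm
  rw [← e.measurePreserving.lintegral_comp_emb e.toHomeomorph.measurableEmbedding]
  simp only [LinearIsometryEquiv.norm_map]

lemma one_add_norm_rpow_le {E : Type*} [NormedAddCommGroup E] {x u z : E} {N : ℝ} (hN : 0 ≤ N)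
    (hu : ‖u‖ ≤ ‖x‖) (hz : ‖z‖ ≤ ‖x‖) :
    (1 + ‖x‖) ^ (-(2 * N)) ≤ (1 + ‖u‖) ^ (-N) * (1 + ‖z‖) ^ (-N) := by
  have h0 : 0 < 1 + ‖x‖ := by positivity
  rw [show -(2 * N) = -N + -N by ring, Real.rpow_add h0]
  refine mul_le_mul ?_ ?_ (by positivity) (by positivity)
  · exact Real.rpow_le_rpow_of_nonpos (by positivity) (by linarith) (by linarith)
  · exact Real.rpow_le_rpow_of_nonpos (by positivity) (by linarith) (by linarith)

open Module in
/-- Integration over one column: the distance to a subspace of dimension `p < n`. -/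
lemma exists_lintegral_dist_subspace_le {n p : ℕ} (hp : p < n) {a b : ℝ} (ha : (p : ℝ) - n < a)
    (hb : (p : ℝ) - n < b) : ∃ N₀ : ℝ, ∀ N ≥ N₀, ∃ B : ENNReal, B < ⊤ ∧
      ∀ K : Submodule ℝ (EuclideanSpace ℝ (Fin n)), finrank ℝ K = p →
        ∫⁻ y, ENNReal.ofReal (twoPow a b (‖y - K.starProjection y‖ ^ 2)) *
          ENNReal.ofReal ((1 + ‖y‖) ^ (-(2 * N))) ≤ B := by
  refine ⟨n + 1 + |a| + |b|, fun N hN => ?_⟩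
  have habs := abs_nonneg a
  have hbbs := abs_nonneg b
  have haa := le_abs_self a
  have hbb := le_abs_self b
  have hpn : (p : ℝ) < n := by exact_mod_cast hp
  have hp0 : (0 : ℝ) ≤ p := Nat.cast_nonneg p
  have hcast : ((n - p : ℕ) : ℝ) = n - p := Nat.cast_sub hp.le
  have hN0 : 0 ≤ N := by linarith
  -- The splitting of `y` along `K` and `Kᗮ` preserves the measure, the power depends only on the
  -- component in `Kᗮ`, of dimension `n - p`, and half of the decay goes to each component. The
  -- witness depends on dimensions only, hence not on `K`.
  refine ⟨(∫⁻ u : EuclideanSpace ℝ (Fin p), ENNReal.ofReal ((1 + ‖u‖) ^ (-N))) *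
    ∫⁻ z : EuclideanSpace ℝ (Fin (n - p)), ENNReal.ofReal (twoPow a b (‖z‖ ^ 2)) *
      ENNReal.ofReal ((1 + ‖z‖) ^ (-N)), ENNReal.mul_lt_top ?_ ?_, fun K hK => ?_⟩
  · exact finite_integral_one_add_norm (by rw [finrank_euclideanSpace_fin]; linarith)
  · apply lintegral_twoPow_lt_top <;> try simp only [finrank_euclideanSpace_fin, hcast]
    · omega
    all_goals linarith
  · have hK' : finrank ℝ Kᗮ = n - p := by
      have := K.finrank_add_finrank_orthogonal
      rw [hK, finrank_euclideanSpace_fin] at this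
      omega
    rw [← lintegral_norm_eq_of_finrank_eq (F := K) (hK.trans finrank_euclideanSpace_fin.symm)
        (fun t => ENNReal.ofReal ((1 + t) ^ (-N))),
      ← lintegral_norm_eq_of_finrank_eq (F := Kᗮ) (hK'.trans finrank_euclideanSpace_fin.symm)
        (fun t => ENNReal.ofReal (twoPow a b (t ^ 2)) * ENNReal.ofReal ((1 + t) ^ (-N)))]
    have hT := measurable_twoPow a b
    rw [← lintegral_prod_mul (by fun_prop) (by fun_prop)]
    have hmp : MeasurePreserving (fun y : EuclideanSpace ℝ (Fin n) =>
        ((K.orthogonalProjectionOnto y, Kᗮ.orthogonalProjectionOnto y) : K × Kᗮ)) := by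
      have h := (WithLp.volume_preserving_ofLp K Kᗮ).comp K.orthogonalDecomposition.measurePreserving
      convert h using 1
      funext y
      simp
    rw [← Measure.volume_eq_prod, ← hmp.lintegral_comp (by fun_prop)]
    refine lintegral_mono fun y => ?_
    have e : ‖y - K.starProjection y‖ = ‖Kᗮ.orthogonalProjectionOnto y‖ := by
      rw [← Submodule.starProjection_orthogonal_val, Submodule.starProjection_apply]
      rfl
    simp only
    rw [e, mul_comm (ENNReal.ofReal ((1 + ‖K.orthogonalProjectionOnto y‖) ^ (-N))), mul_assoc]
    gcongr
    rw [← ENNReal.ofReal_mul (by positivity), mul_comm ((1 + ‖Kᗮ.orthogonalProjectionOnto y‖) ^ (-N))]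
    refine ENNReal.ofReal_le_ofReal ?_
    exact one_add_norm_rpow_le (u := (K.orthogonalProjectionOnto y : EuclideanSpace ℝ (Fin n)))
      (z := (Kᗮ.orthogonalProjectionOnto y : EuclideanSpace ℝ (Fin n))) hN0
      (K.norm_orthogonalProjectionOnto_apply_le y)
      (Kᗮ.norm_orthogonalProjectionOnto_apply_le y)

/-- The ratio of consecutive leading principal minors. -/
noncomputable def minorRatio {m : ℕ} (r : Matrix (Fin m) (Fin m) ℝ) (i : Fin m) : ℝ :=
  leadingMinor r (i.val + 1) / leadingMinor r i.val

lemma minorRatio_revMat_castSucc {m : ℕ} (r : Matrix (Fin (m + 1)) (Fin (m + 1)) ℝ) (i : Fin m) :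
    minorRatio (revMat r) i.castSucc = minorRatio (revMat (tailMat r)) i := by
  simp only [minorRatio, Fin.val_castSucc]
  rw [leadingMinor_castSucc (by omega), leadingMinor_castSucc (i := i.val) (by omega),
    revMat_castSucc]

lemma minorRatio_revMat_last {m : ℕ} (r : Matrix (Fin (m + 1)) (Fin (m + 1)) ℝ) :
    minorRatio (revMat r) (Fin.last m) = r.det / (tailMat r).det := by
  simp only [minorRatio, Fin.val_last]
  rw [leadingMinor_self, leadingMinor_castSucc le_rfl, revMat_castSucc, leadingMinor_self,
    det_revMat, det_revMat]

lemma revMat_revMat {m : ℕ} (r : Matrix (Fin m) (Fin m) ℝ) : revMat (revMat r) = r := by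
  ext i j; simp [revMat]

lemma continuous_leadingMinor {m : ℕ} (i : ℕ) :
    Continuous fun r : Matrix (Fin m) (Fin m) ℝ => leadingMinor r i := by
  unfold leadingMinor
  exact (continuous_id.matrix_submatrix _ _).matrix_det

lemma minorRatio_nonneg {m : ℕ} {r : Matrix (Fin m) (Fin m) ℝ} (hr : r.PosSemidef) (i : Fin m) :
    0 ≤ minorRatio r i :=
  div_nonneg (hr.submatrix _).det_nonneg (hr.submatrix _).det_nonneg

lemma _root_.Matrix.PosSemidef.revMat {m : ℕ} {r : Matrix (Fin m) (Fin m) ℝ} (hr : r.PosSemidef) :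
    (CompositeCosine.revMat r).PosSemidef := hr.submatrix _

/-! ### Gram determinants -/

section Gram

variable {E : Type*} [NormedAddCommGroup E] [InnerProductSpace ℝ E] {m : ℕ}

lemma tailMat_gram_cons (y : E) (X : Fin m → E) :
    tailMat (Matrix.gram ℝ (Fin.cons y X : Fin (m + 1) → E)) = Matrix.gram ℝ X := by
  ext i j
  simp [tailMat, Matrix.gram_apply]

/-- Base times height: the coefficients `u` of the projection of `y` solve the linear system of
`det_eq_mul_det_tailMat`, and the resulting Schur complement is the squared distance of `y` to the
span. -/
lemma det_gram_cons [FiniteDimensional ℝ E] (y : E) (X : Fin m → E) :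
    (Matrix.gram ℝ (Fin.cons y X : Fin (m + 1) → E)).det =
      ‖y - (Submodule.span ℝ (Set.range X)).starProjection y‖ ^ 2 * (Matrix.gram ℝ X).det := by
  set K := Submodule.span ℝ (Set.range X) with hK
  obtain ⟨u, hu⟩ := (Submodule.mem_span_range_iff_exists_fun ℝ).1
    (Submodule.coe_mem (K.orthogonalProjectionOnto y))
  have hPy : K.starProjection y = ∑ i, u i • X i := by
    rw [hu, Submodule.starProjection_apply]
  have hinner : ∀ w ∈ K, inner ℝ (y - K.starProjection y) w = 0 := fun w hw =>
    K.starProjection_inner_eq_zero y w hw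
  have h : (tailMat (Matrix.gram ℝ (Fin.cons y X : Fin (m + 1) → E))).mulVec u =
      fun i => Matrix.gram ℝ (Fin.cons y X : Fin (m + 1) → E) i.succ 0 := by
    rw [tailMat_gram_cons]
    funext i
    have h1 := hinner (X i) (Submodule.subset_span ⟨i, rfl⟩)
    rw [inner_sub_left, sub_eq_zero, hPy, sum_inner] at h1
    simp only [Matrix.mulVec, dotProduct, Matrix.gram_apply, Fin.cons_succ, Fin.cons_zero]
    rw [real_inner_comm, h1]
    refine Finset.sum_congr rfl fun j _ => ?_
    rw [real_inner_smul_left, real_inner_comm, mul_comm]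
  rw [det_eq_mul_det_tailMat h, tailMat_gram_cons]
  congr 1
  have h2 : inner ℝ (y - K.starProjection y) (K.starProjection y) = 0 :=
    hinner _ (by rw [Submodule.starProjection_apply]; exact Submodule.coe_mem _)
  rw [← real_inner_self_eq_norm_sq, inner_sub_right, h2, sub_zero, inner_sub_left, hPy, sum_inner]
  simp only [Matrix.gram_apply, Fin.cons_zero, Fin.cons_succ, real_inner_smul_left]
  congr 1
  refine Finset.sum_congr rfl fun j _ => ?_
  rw [real_inner_comm, mul_comm]

lemma continuous_gram : Continuous fun X : Fin m → E => Matrix.gram ℝ X :=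
  continuous_matrix fun i j => by simp only [Matrix.gram_apply]; fun_prop

lemma measurable_minorRatio_comp {α : Type*} [TopologicalSpace α] [MeasurableSpace α]
    [OpensMeasurableSpace α] {f : α → Matrix (Fin m) (Fin m) ℝ} (hf : Continuous f) (i : Fin m) :
    Measurable fun x => minorRatio (f x) i := by
  unfold minorRatio
  exact ((continuous_leadingMinor _).comp hf).measurable.div
    ((continuous_leadingMinor _).comp hf).measurable

lemma continuous_revMat : Continuous fun r : Matrix (Fin m) (Fin m) ℝ => revMat r :=
  continuous_id.matrix_submatrix _ _

end Gram

/-! ### Integration column by column -/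

section Columns

variable (n : ℕ)

lemma piFinSuccAbove_zero_symm_apply {E : Type*} [MeasurableSpace E] {m : ℕ} (y : E)
    (X : Fin m → E) :
    (MeasurableEquiv.piFinSuccAbove (fun _ : Fin (m + 1) => E) 0).symm (y, X) = Fin.cons y X := by
  simp [MeasurableEquiv.piFinSuccAbove]; rfl

/-- By Fubini: over an independent `X` the exceptional `y` lie in the span of fewer than `n`
vectors, a null set. -/
lemma ae_det_gram_ne_zero : ∀ m ≤ n, ∀ᵐ X : Fin m → EuclideanSpace ℝ (Fin n),
    (Matrix.gram ℝ X).det ≠ 0 := by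
  intro m
  induction m with
  | zero => intro _; exact Eventually.of_forall fun X => by simp
  | succ m ih =>
    intro hm
    have ih' := ih (by omega)
    have hmp := (volume_preserving_piFinSuccAbove (fun _ : Fin (m + 1) => EuclideanSpace ℝ (Fin n))
      0).symm
    have hclosed : MeasurableSet {X : Fin (m + 1) → EuclideanSpace ℝ (Fin n) |
        (Matrix.gram ℝ X).det = 0} :=
      (isClosed_eq continuous_gram.matrix_det continuous_const).measurableSet
    rw [ae_iff]
    simp only [ne_eq, not_not]
    rw [← hmp.measure_preimage hclosed.nullMeasurableSet, Measure.volume_eq_prod,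
      Measure.prod_apply_symm (hmp.measurable hclosed), lintegral_eq_zero_iff' ?_]
    · filter_upwards [ih'] with X hX
      have hlt : Submodule.span ℝ (Set.range X) ≠ ⊤ := by
        intro htop
        have h1 := finrank_range_le_card (R := ℝ) X
        rw [Set.finrank, htop, finrank_top, finrank_euclideanSpace_fin, Fintype.card_fin] at h1
        omega
      refine measure_mono_null (fun y hy => ?_) (Measure.addHaar_submodule volume _ hlt)
      have hy' : (Matrix.gram ℝ (Fin.cons y X : Fin (m + 1) → _)).det = 0 := by
        rw [← piFinSuccAbove_zero_symm_apply]; exact hy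
      rw [det_gram_cons, mul_eq_zero, or_iff_left hX, sq_eq_zero_iff, norm_eq_zero, sub_eq_zero] at hy'
      rw [hy', Submodule.starProjection_apply]
      exact Submodule.coe_mem _
    · exact (measurable_measure_prodMk_right (hmp.measurable hclosed)).aemeasurable

/-- Split off the first vector `y`. Only the last minor ratio of the reversed Gram matrix involves
it, and this ratio is the squared distance of `y` to the span of the others; so the inner integral
is bounded independently of them. -/
lemma exists_lintegral_minorRatio_gram : ∀ m ≤ n, ∀ a b : Fin m → ℝ,
    (∀ i, (i.val : ℝ) - n < a i) → (∀ i, (i.val : ℝ) - n < b i) → ∃ N₀ : ℝ, ∀ N ≥ N₀,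
      ∫⁻ X : Fin m → EuclideanSpace ℝ (Fin n),
        (∏ i, ENNReal.ofReal (twoPow (a i) (b i) (minorRatio (revMat (Matrix.gram ℝ X)) i))) *
          ∏ j, ENNReal.ofReal ((1 + ‖X j‖) ^ (-(2 * N))) < ⊤ := by
  intro m
  induction m with
  | zero =>
    intro _ a b _ _
    refine ⟨0, fun N _ => ?_⟩
    simp
  | succ m ih =>
    intro hm a b ha hb
    obtain ⟨N₁, h₁⟩ := ih (by omega) (fun i => a i.castSucc) (fun i => b i.castSucc)
      (fun i => by simpa using ha i.castSucc) (fun i => by simpa using hb i.castSucc)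
    obtain ⟨N₂, h₂⟩ := exists_lintegral_dist_subspace_le (n := n) (p := m) (by omega)
      (by simpa using ha (Fin.last m)) (by simpa using hb (Fin.last m))
    refine ⟨max (max N₁ N₂) (n + 1), fun N hN => ?_⟩
    have h₁' := h₁ N (le_trans (le_trans (le_max_left _ _) (le_max_left _ _)) hN)
    obtain ⟨B, hB, hBK⟩ := h₂ N (le_trans (le_trans (le_max_right _ _) (le_max_left _ _)) hN)
    have hNn : (n : ℝ) + 1 ≤ N := le_trans (le_max_right _ _) hN
    set aL := a (Fin.last m)
    set bL := b (Fin.last m)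
    -- For linearly dependent `X` the last ratio is 0 by the convention for division by zero. `B₀`
    -- is the inner integral in that case, so the bound holds for every `X` and no null set has to
    -- be removed.
    set B₀ : ENNReal := ENNReal.ofReal (twoPow aL bL 0) *
      ∫⁻ y : EuclideanSpace ℝ (Fin n), ENNReal.ofReal ((1 + ‖y‖) ^ (-(2 * N))) with hB₀
    have hB₀' : B₀ < ⊤ := by
      refine ENNReal.mul_lt_top ENNReal.ofReal_lt_top (finite_integral_one_add_norm ?_)
      rw [finrank_euclideanSpace_fin]
      have : (0 : ℝ) ≤ n := Nat.cast_nonneg n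
      linarith
    have hmp := (volume_preserving_piFinSuccAbove (fun _ : Fin (m + 1) => EuclideanSpace ℝ (Fin n))
      0).symm
    have hmr : ∀ (q : ℕ) (i : Fin q), Measurable fun X : Fin q → EuclideanSpace ℝ (Fin n) =>
        minorRatio (revMat (Matrix.gram ℝ X)) i := fun q i =>
      measurable_minorRatio_comp (continuous_revMat.comp continuous_gram) i
    have hmT : ∀ (a b : ℝ) (q : ℕ) (i : Fin q), Measurable fun X : Fin q → EuclideanSpace ℝ (Fin n) =>
        ENNReal.ofReal (twoPow a b (minorRatio (revMat (Matrix.gram ℝ X)) i)) := fun a b q i =>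
      ((measurable_twoPow a b).comp (hmr q i)).ennreal_ofReal
    have hmeas : Measurable fun X : Fin (m + 1) → EuclideanSpace ℝ (Fin n) =>
        (∏ i, ENNReal.ofReal (twoPow (a i) (b i) (minorRatio (revMat (Matrix.gram ℝ X)) i))) *
          ∏ j, ENNReal.ofReal ((1 + ‖X j‖) ^ (-(2 * N))) :=
      (Finset.measurable_prod _ fun i _ => hmT _ _ _ i).mul
        (Finset.measurable_prod _ fun i _ => by fun_prop)
    have hmeas' := (hmeas.comp hmp.measurable).aemeasurable (μ := volume)
    rw [Measure.volume_eq_prod] at hmeas'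
    simp only [Function.comp_def] at hmeas'
    rw [← hmp.lintegral_comp hmeas, Measure.volume_eq_prod, lintegral_prod_symm _ hmeas']
    simp only [piFinSuccAbove_zero_symm_apply]
    refine lt_of_le_of_lt (lintegral_mono (g := fun X => (B + B₀) *
      ((∏ i, ENNReal.ofReal (twoPow (a i.castSucc) (b i.castSucc)
        (minorRatio (revMat (Matrix.gram ℝ X)) i))) *
          ∏ j, ENNReal.ofReal ((1 + ‖X j‖) ^ (-(2 * N))))) fun X => ?_) ?_
    · simp only
      set c := ((∏ i, ENNReal.ofReal (twoPow (a i.castSucc) (b i.castSucc)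
        (minorRatio (revMat (Matrix.gram ℝ X)) i))) *
          ∏ j, ENNReal.ofReal ((1 + ‖X j‖) ^ (-(2 * N)))) with hc
      have hsplit : ∀ y : EuclideanSpace ℝ (Fin n),
          (∏ i, ENNReal.ofReal (twoPow (a i) (b i)
            (minorRatio (revMat (Matrix.gram ℝ (Fin.cons y X : Fin (m + 1) → _))) i))) *
          ∏ j, ENNReal.ofReal ((1 + ‖(Fin.cons y X : Fin (m + 1) → EuclideanSpace ℝ (Fin n)) j‖) ^
            (-(2 * N))) =
          (ENNReal.ofReal (twoPow aL bL
            (‖y - (Submodule.span ℝ (Set.range X)).starProjection y‖ ^ 2 * (Matrix.gram ℝ X).det /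
              (Matrix.gram ℝ X).det)) * ENNReal.ofReal ((1 + ‖y‖) ^ (-(2 * N)))) * c := fun y => by
        rw [Fin.prod_univ_castSucc, Fin.prod_univ_succ (n := m) (fun j => ENNReal.ofReal _)]
        simp only [minorRatio_revMat_castSucc, tailMat_gram_cons, minorRatio_revMat_last,
          det_gram_cons, Fin.cons_zero, Fin.cons_succ]
        rw [hc]
        ring
      simp only [hsplit]
      rw [lintegral_mul_const'']
      · gcongr
        by_cases hX : (Matrix.gram ℝ X).det = 0
        · simp only [hX, mul_zero, div_zero]
          rw [lintegral_const_mul _ (by fun_prop)]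
          exact le_add_self
        · refine le_trans ?_ le_self_add
          simp only [mul_div_cancel_right₀ _ hX]
          refine hBK _ ?_
          have := Matrix.linearIndependent_of_det_gram_ne_zero hX
          rw [finrank_span_eq_card this, Fintype.card_fin]
      · have hT := measurable_twoPow aL bL
        exact (by fun_prop : Measurable _).aemeasurable
    · rw [lintegral_const_mul]
      · exact ENNReal.mul_lt_top (ENNReal.add_lt_top.2 ⟨hB, hB₀'⟩) h₁'
      · exact (Finset.measurable_prod _ fun i _ => hmT _ _ _ i).mul
          (Finset.measurable_prod _ fun i _ => by fun_prop)

end Columns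

/-! ### From tuples of columns to matrix space -/

section Transfer

variable {n m : ℕ}

/-- The permuted columns of a matrix. -/
noncomputable def columns (σ : Equiv.Perm (Fin m)) :
    MatSpace n m ≃ₗ[ℝ] (Fin m → EuclideanSpace ℝ (Fin n)) where
  toFun x j := WithLp.toLp 2 fun i => x (i, σ j)
  invFun X := WithLp.toLp 2 fun p => X (σ.symm p.2) p.1
  map_add' x y := rfl
  map_smul' c x := rfl
  left_inv x := by ext p; simp
  right_inv X := by funext j; ext i; simp

lemma columns_apply (σ : Equiv.Perm (Fin m)) (x : MatSpace n m) (i : Fin n) (j : Fin m) :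
    columns σ x j i = x (i, σ j) := rfl

lemma gram_columns (σ : Equiv.Perm (Fin m)) (x : MatSpace n m) :
    Matrix.gram ℝ (columns σ x) = (radial x).submatrix σ σ := by
  ext i j
  simp only [Matrix.gram_apply, PiLp.inner_apply, columns_apply, radial, Matrix.submatrix_apply,
    Matrix.mul_apply, Matrix.transpose_apply, toMat_apply]
  exact Finset.sum_congr rfl fun l _ => by simp [mul_comm]

lemma norm_columns_le (σ : Equiv.Perm (Fin m)) (x : MatSpace n m) (j : Fin m) :
    ‖columns σ x j‖ ≤ ‖x‖ := by
  rw [EuclideanSpace.norm_eq, EuclideanSpace.norm_eq]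
  refine Real.sqrt_le_sqrt ?_
  simp only [columns_apply, Fintype.sum_prod_type]
  exact Finset.sum_le_sum fun i _ => Finset.single_le_sum (f := fun j => ‖x (i, j)‖ ^ 2)
    (fun j _ => by positivity) (Finset.mem_univ _)

/-- Uniqueness of Haar measure; since only finiteness of integrals is transferred, the value of the
constant does not matter. -/
lemma exists_map_columns (σ : Equiv.Perm (Fin m)) : ∃ c : ENNReal, c ≠ ⊤ ∧
    Measure.map (columns (n := n) σ) volume = c • volume := by
  have h := (columns (n := n) σ).toContinuousLinearEquiv.isAddHaarMeasure_map volume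
  refine ⟨_, ENNReal.coe_ne_top, Measure.isAddLeftInvariant_eq_smul _ volume⟩

lemma measurable_columns (σ : Equiv.Perm (Fin m)) : Measurable (columns (n := n) σ) :=
  (columns (n := n) σ).toContinuousLinearEquiv.continuous.measurable

lemma posSemidef_radial (x : MatSpace n m) : (radial x).PosSemidef :=
  Matrix.posSemidef_conjTranspose_mul_self (toMat x)

lemma ae_posDef_radial (hmn : m ≤ n) : ∀ᵐ x : MatSpace n m, (radial x).PosDef := by
  obtain ⟨c, -, hc⟩ := exists_map_columns (n := n) (Equiv.refl (Fin m))
  have h : ∀ᵐ X ∂(Measure.map (columns (n := n) (Equiv.refl (Fin m))) volume),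
      (Matrix.gram ℝ X).det ≠ 0 := by
    rw [hc]
    exact Measure.ae_smul_measure (ae_det_gram_ne_zero n m hmn) c
  filter_upwards [ae_of_ae_map (measurable_columns _).aemeasurable h] with x hx
  rw [gram_columns] at hx
  exact (posSemidef_radial x).posDef_iff_det_ne_zero.2 hx

/-- The permutation covers both cases needed: the identity gives `revMat (radial x)`, and the
reversal gives `radial x` because `revMat` is an involution. -/
lemma exists_integrable_prod_twoPow_aux (hmn : m ≤ n) (σ : Equiv.Perm (Fin m)) (a b : Fin m → ℝ)
    (ha : ∀ i, (i.val : ℝ) - n < a i) (hb : ∀ i, (i.val : ℝ) - n < b i) :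
    ∃ N : ℕ, Integrable fun x : MatSpace n m =>
      (∏ i, twoPow (a i) (b i) (minorRatio (revMat ((radial x).submatrix σ σ)) i)) *
        ((1 + ‖x‖) ^ N)⁻¹ := by
  obtain ⟨N₀, h⟩ := exists_lintegral_minorRatio_gram n m hmn a b ha hb
  obtain ⟨N, hN⟩ := exists_nat_ge N₀
  have h1 := h N hN
  obtain ⟨c, hctop, hc⟩ := exists_map_columns (n := n) σ
  have hcont : Continuous fun x : MatSpace n m => revMat ((radial x).submatrix σ σ) :=
    continuous_revMat.comp (continuous_radial.matrix_submatrix _ _)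
  have hnn : ∀ (x : MatSpace n m) i, 0 ≤ twoPow (a i) (b i)
      (minorRatio (revMat ((radial x).submatrix σ σ)) i) := fun x i =>
    twoPow_nonneg (minorRatio_nonneg ((posSemidef_radial x).submatrix σ).revMat i)
  have hmX : Measurable fun X : Fin m → EuclideanSpace ℝ (Fin n) =>
        (∏ i, ENNReal.ofReal (twoPow (a i) (b i) (minorRatio (revMat (Matrix.gram ℝ X)) i))) *
          ∏ j, ENNReal.ofReal ((1 + ‖X j‖) ^ (-(2 * (N : ℝ)))) :=
    (Finset.measurable_prod _ fun i _ => ((measurable_twoPow _ _).comp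
      (measurable_minorRatio_comp (continuous_revMat.comp continuous_gram) i)).ennreal_ofReal).mul
      (Finset.measurable_prod _ fun i _ => by fun_prop)
  have h2 : ∫⁻ x : MatSpace n m,
      (∏ i, ENNReal.ofReal (twoPow (a i) (b i)
        (minorRatio (revMat (Matrix.gram ℝ (columns σ x))) i))) *
          ∏ j, ENNReal.ofReal ((1 + ‖columns σ x j‖) ^ (-(2 * (N : ℝ)))) < ⊤ := by
    rw [← lintegral_map hmX (measurable_columns σ), hc, lintegral_smul_measure]
    exact ENNReal.mul_lt_top hctop.lt_top h1
  -- Each column has norm at most `‖x‖`, so a weight of order `2 * N * m` in `x` is dominated by the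
  -- product of the `m` column weights of order `2 * N`.
  refine ⟨2 * N * m, ⟨(Measurable.mul (Finset.measurable_prod _ fun i _ =>
    (measurable_twoPow _ _).comp (measurable_minorRatio_comp hcont i))
    (by fun_prop)).aestronglyMeasurable, ?_⟩⟩
  rw [hasFiniteIntegral_iff_ofReal (Eventually.of_forall fun x =>
    mul_nonneg (Finset.prod_nonneg fun i _ => hnn x i) (by positivity))]
  refine lt_of_le_of_lt (lintegral_mono fun x => ?_) h2
  rw [ENNReal.ofReal_mul (Finset.prod_nonneg fun i _ => hnn x i), gram_columns,
    ENNReal.ofReal_prod_of_nonneg fun i _ => hnn x i]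
  gcongr
  rw [← ENNReal.ofReal_prod_of_nonneg fun j _ => by positivity]
  refine ENNReal.ofReal_le_ofReal ?_
  calc ((1 + ‖x‖) ^ (2 * N * m))⁻¹ = ∏ _j : Fin m, (1 + ‖x‖) ^ (-(2 * (N : ℝ))) := by
        rw [Finset.prod_const, Finset.card_univ, Fintype.card_fin, Real.rpow_neg (by positivity),
          pow_mul, ← inv_pow]
        congr 2
        exact_mod_cast (Real.rpow_natCast (1 + ‖x‖) (2 * N)).symm
    _ ≤ _ := Finset.prod_le_prod (fun j _ => by positivity) fun j _ =>
        Real.rpow_le_rpow_of_nonpos (by positivity) (by linarith [norm_columns_le σ x j])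
          (by have : (0 : ℝ) ≤ N := Nat.cast_nonneg N
              linarith)

lemma exists_integrable_prod_twoPow_rev (hmn : m ≤ n) (a b : Fin m → ℝ)
    (ha : ∀ i, (i.val : ℝ) - n < a i) (hb : ∀ i, (i.val : ℝ) - n < b i) :
    ∃ N : ℕ, Integrable fun x : MatSpace n m =>
      (∏ i, twoPow (a i) (b i) (minorRatio (revMat (radial x)) i)) * ((1 + ‖x‖) ^ N)⁻¹ :=
  exists_integrable_prod_twoPow_aux hmn 1 a b ha hb

lemma exists_integrable_prod_twoPow (hmn : m ≤ n) (a b : Fin m → ℝ)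
    (ha : ∀ i, (i.val : ℝ) - n < a i) (hb : ∀ i, (i.val : ℝ) - n < b i) :
    ∃ N : ℕ, Integrable fun x : MatSpace n m =>
      (∏ i, twoPow (a i) (b i) (minorRatio (radial x) i)) * ((1 + ‖x‖) ^ N)⁻¹ := by
  obtain ⟨N, h⟩ := exists_integrable_prod_twoPow_aux hmn Fin.revPerm a b ha hb
  refine ⟨N, h.congr (Eventually.of_forall fun x => ?_)⟩
  have : revMat ((radial x).submatrix Fin.revPerm Fin.revPerm) = radial x := revMat_revMat _
  simp only [this]

end Transfer

/-! ### Integrals of composite powers against Schwartz functions -/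

section Decay

variable {n m : ℕ}

/-- A seminorm of Schwartz functions controlling `(1 + ‖x‖) ^ N * ‖φ x‖`. -/
noncomputable def decaySeminorm (N : ℕ) (φ : 𝓢(MatSpace n m, ℂ)) : ℝ :=
  2 ^ N * (Finset.Iic (N, N)).sup (schwartzSeminormFamily ℂ (MatSpace n m) ℂ) φ

lemma decaySeminorm_nonneg (N : ℕ) (φ : 𝓢(MatSpace n m, ℂ)) : 0 ≤ decaySeminorm N φ :=
  mul_nonneg (by positivity) (apply_nonneg _ _)

lemma norm_le_decaySeminorm (N : ℕ) (φ : 𝓢(MatSpace n m, ℂ)) (x : MatSpace n m) :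
    ‖φ x‖ ≤ decaySeminorm N φ * ((1 + ‖x‖) ^ N)⁻¹ := by
  have h := SchwartzMap.one_add_le_sup_seminorm_apply (𝕜 := ℂ) (m := (N, N)) (k := N) (n := 0)
    le_rfl (Nat.zero_le _) φ x
  rw [norm_iteratedFDeriv_zero] at h
  rw [le_mul_inv_iff₀ (by positivity), mul_comm]
  exact h

lemma decaySeminorm_mono {N N' : ℕ} (h : N ≤ N') (φ : 𝓢(MatSpace n m, ℂ)) :
    decaySeminorm N φ ≤ decaySeminorm N' φ := by
  refine mul_le_mul (pow_le_pow_right₀ one_le_two h) ?_ (apply_nonneg _ _) (by positivity)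
  exact Finset.sup_mono (f := schwartzSeminormFamily ℂ (MatSpace n m) ℂ)
    (Finset.Iic_subset_Iic.2 (Prod.mk_le_mk.2 ⟨h, h⟩)) φ

/-- Continuity of `L` in terms of the seminorms. With `L` the Fourier transform, integrals against
Fφ are bounded by seminorms of φ, as the continuation requires on both half spaces. -/
lemma exists_decaySeminorm_comp_le (L : 𝓢(MatSpace n m, ℂ) →L[ℂ] 𝓢(MatSpace n m, ℂ)) (N : ℕ) :
    ∃ (N' : ℕ) (C : ℝ), 0 ≤ C ∧ ∀ φ, decaySeminorm N (L φ) ≤ C * decaySeminorm N' φ := by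
  have hw := schwartz_withSeminorms ℂ (MatSpace n m) ℂ
  set p := ((Finset.Iic (N, N)).sup (schwartzSeminormFamily ℂ (MatSpace n m) ℂ)).comp L.toLinearMap
  have hsup : Continuous ((((Finset.Iic (N, N)).sup (schwartzSeminormFamily ℂ (MatSpace n m) ℂ) :
      Seminorm ℂ 𝓢(MatSpace n m, ℂ))) : 𝓢(MatSpace n m, ℂ) → ℝ) :=
    Seminorm.continuous_finsetSup fun i _ => hw.continuous_seminorm i
  have hp : Continuous p := hsup.comp L.continuous
  obtain ⟨s, C, -, hC⟩ := Seminorm.bound_of_continuous hw p hp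
  set N' := s.sup (fun i => max i.1 i.2) with hN'
  have hs : s ⊆ Finset.Iic (N', N') := fun i hi => by
    have := Finset.le_sup (f := fun i : ℕ × ℕ => max i.1 i.2) hi
    rw [Finset.mem_Iic]
    exact Prod.mk_le_mk.2 ⟨(le_max_left _ _).trans this, (le_max_right _ _).trans this⟩
  refine ⟨N', 2 ^ N * C, by positivity, fun φ => ?_⟩
  have h1 : p φ ≤ C * s.sup (schwartzSeminormFamily ℂ (MatSpace n m) ℂ) φ := hC φ
  have h2 : s.sup (schwartzSeminormFamily ℂ (MatSpace n m) ℂ) φ ≤ decaySeminorm N' φ := by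
    refine (Finset.sup_mono (f := schwartzSeminormFamily ℂ (MatSpace n m) ℂ) hs φ).trans ?_
    exact le_mul_of_one_le_left (apply_nonneg _ _) (one_le_pow₀ one_le_two)
  have h3 : decaySeminorm N (L φ) = 2 ^ N * p φ := rfl
  rw [h3, mul_assoc]
  exact mul_le_mul_of_nonneg_left (h1.trans (mul_le_mul_of_nonneg_left h2 C.2)) (by positivity)

end Decay

lemma norm_compPow_le {m : ℕ} {r : Matrix (Fin m) (Fin m) ℝ} (hr : r.PosDef) {a b : Fin m → ℝ}
    {e : Fin m → ℂ} (ha : ∀ i, a i ≤ (e i).re) (hb : ∀ i, (e i).re ≤ b i) :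
    ‖compPow r e‖ ≤ ∏ i, twoPow (a i) (b i) (minorRatio r i) := by
  rw [compPow, norm_prod]
  refine Finset.prod_le_prod (fun i _ => norm_nonneg _) fun i _ => ?_
  have hpos := hr.ratio_pos i
  rw [Complex.norm_cpow_eq_rpow_re_of_pos hpos]
  have hre : (e i / 2).re = (e i).re / 2 := by simp
  rw [hre, twoPow, minorRatio]
  set x := leadingMinor r (i.val + 1) / leadingMinor r i.val
  rcases le_total 1 x with h | h
  · have h1 : x ^ ((e i).re / 2) ≤ x ^ (b i / 2) :=
      Real.rpow_le_rpow_of_exponent_le h (by linarith [hb i])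
    have h2 : 0 ≤ x ^ (a i / 2) := by positivity
    linarith
  · have h1 : x ^ ((e i).re / 2) ≤ x ^ (a i / 2) :=
      Real.rpow_le_rpow_of_exponent_ge hpos h (by linarith [ha i])
    have h2 : 0 ≤ x ^ (b i / 2) := by positivity
    linarith

lemma differentiable_finsetProd {E ι : Type*} [NormedAddCommGroup E] [NormedSpace ℂ E]
    {u : Finset ι} {f : ι → E → ℂ} (h : ∀ i ∈ u, Differentiable ℂ (f i)) :
    Differentiable ℂ fun x => ∏ i ∈ u, f i x := by
  classical
  exact fun x => (HasFDerivAt.finsetProd fun i hi => (h i hi x).hasFDerivAt).differentiableAt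

lemma differentiable_compPow {m : ℕ} {r : Matrix (Fin m) (Fin m) ℝ} (hr : r.PosDef) :
    Differentiable ℂ fun e : Fin m → ℂ => compPow r e := by
  unfold compPow
  have h : ∀ i ∈ Finset.univ, Differentiable ℂ fun e : Fin m → ℂ =>
      ((leadingMinor r (i.val + 1) / leadingMinor r i.val : ℝ) : ℂ) ^ (e i / 2) := fun i _ => by
    have h0 : ((leadingMinor r (i.val + 1) / leadingMinor r i.val : ℝ) : ℂ) ≠ 0 := by
      exact_mod_cast (hr.ratio_pos i).ne'
    intro e
    exact DifferentiableAt.const_cpow (by fun_prop) (Or.inl h0)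
  exact differentiable_finsetProd h

/-- The exponents for which composite powers are locally integrable. -/
def powDomain (n m : ℕ) : Set (Fin m → ℂ) := {e | ∀ i, (i.val : ℝ) - n < (e i).re}

lemma isOpen_powDomain (n m : ℕ) : IsOpen (powDomain n m) := by
  simp only [powDomain, Set.ofPred_forall]
  exact isOpen_iInter_of_finite fun i => isOpen_lt continuous_const (by fun_prop)

/-- A matrix valued function whose composite powers are integrable, with polynomial weights, for
all exponents in `powDomain n m`. -/
structure IsPowIntegrable {n m : ℕ} (S : MatSpace n m → Matrix (Fin m) (Fin m) ℝ) : Prop where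
  continuous : Continuous S
  ae_posDef : ∀ᵐ x, (S x).PosDef
  exists_integrable : ∀ a b : Fin m → ℝ, (∀ i, (i.val : ℝ) - n < a i) →
    (∀ i, (i.val : ℝ) - n < b i) → ∃ N : ℕ, Integrable fun x : MatSpace n m =>
      (∏ i, twoPow (a i) (b i) (minorRatio (S x) i)) * ((1 + ‖x‖) ^ N)⁻¹

lemma isPowIntegrable_radial {n m : ℕ} (hmn : m ≤ n) :
    IsPowIntegrable fun x : MatSpace n m => radial x :=
  ⟨continuous_radial, ae_posDef_radial hmn, exists_integrable_prod_twoPow hmn⟩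

lemma isPowIntegrable_revMat_radial {n m : ℕ} (hmn : m ≤ n) :
    IsPowIntegrable fun x : MatSpace n m => revMat (radial x) :=
  ⟨continuous_revMat.comp continuous_radial,
    (ae_posDef_radial hmn).mono fun _ hx => hx.revMat, exists_integrable_prod_twoPow_rev hmn⟩

/-- A measurable essentially bounded function. -/
def IsEssBounded {n m : ℕ} (A : MatSpace n m → ℂ) : Prop :=
  AEStronglyMeasurable A ∧ ∃ C : ℝ, 0 ≤ C ∧ ∀ᵐ x, ‖A x‖ ≤ C

section PowInt

variable {n m : ℕ} {S : MatSpace n m → Matrix (Fin m) (Fin m) ℝ} {A : MatSpace n m → ℂ}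

/-- The integral of a composite power against a bounded function and a Schwartz function. -/
noncomputable def powInt (S : MatSpace n m → Matrix (Fin m) (Fin m) ℝ) (A : MatSpace n m → ℂ)
    (e : Fin m → ℂ) (φ : 𝓢(MatSpace n m, ℂ)) : ℂ :=
  ∫ x, compPow (S x) e * A x * φ x

lemma measurable_compPow (hS : Continuous S) (e : Fin m → ℂ) :
    Measurable fun x => compPow (S x) e := by
  unfold compPow
  exact Finset.measurable_prod _ fun i _ =>
    (Complex.measurable_ofReal.comp (measurable_minorRatio_comp hS i)).pow_const _

lemma aestronglyMeasurable_powInt (hS : IsPowIntegrable S) (hA : IsEssBounded A) (e : Fin m → ℂ)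
    (φ : 𝓢(MatSpace n m, ℂ)) : AEStronglyMeasurable fun x => compPow (S x) e * A x * φ x :=
  ((measurable_compPow hS.continuous e).aestronglyMeasurable.mul hA.1).mul
    φ.continuous.aestronglyMeasurable

/-- One integrable majorant serves all exponents in a real box and all Schwartz functions. Absolute
convergence, seminorm bounds and holomorphy in the exponent all follow from it. -/
lemma exists_powInt_majorant (hS : IsPowIntegrable S) (hA : IsEssBounded A) {a b : Fin m → ℝ}
    (ha : ∀ i, (i.val : ℝ) - n < a i) (hb : ∀ i, (i.val : ℝ) - n < b i) :
    ∃ (N : ℕ) (g : MatSpace n m → ℝ), Integrable g ∧ ∀ᵐ x, ∀ e : Fin m → ℂ,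
      (∀ i, a i ≤ (e i).re) → (∀ i, (e i).re ≤ b i) → ∀ φ : 𝓢(MatSpace n m, ℂ),
        ‖compPow (S x) e * A x * φ x‖ ≤ g x * decaySeminorm N φ := by
  obtain ⟨N, hN⟩ := hS.exists_integrable a b ha hb
  obtain ⟨-, C, hC, hAC⟩ := hA
  refine ⟨N, _, hN.const_mul C, ?_⟩
  filter_upwards [hS.ae_posDef, hAC] with x hx hAx e hae hbe φ
  rw [norm_mul, norm_mul]
  calc ‖compPow (S x) e‖ * ‖A x‖ * ‖φ x‖
      ≤ (∏ i, twoPow (a i) (b i) (minorRatio (S x) i)) * C *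
        (decaySeminorm N φ * ((1 + ‖x‖) ^ N)⁻¹) := by
        have h0 : 0 ≤ ∏ i, twoPow (a i) (b i) (minorRatio (S x) i) :=
          (norm_nonneg _).trans (norm_compPow_le hx hae hbe)
        exact mul_le_mul (mul_le_mul (norm_compPow_le hx hae hbe) hAx (norm_nonneg _) h0)
          (norm_le_decaySeminorm N φ x) (norm_nonneg _) (by positivity)
    _ = _ := by ring

lemma integrable_powInt (hS : IsPowIntegrable S) (hA : IsEssBounded A) {e : Fin m → ℂ}
    (he : e ∈ powDomain n m) (φ : 𝓢(MatSpace n m, ℂ)) :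
    Integrable fun x => compPow (S x) e * A x * φ x := by
  obtain ⟨N, g, hg, hbd⟩ := exists_powInt_majorant hS hA he he
  refine (hg.mul_const (decaySeminorm N φ)).mono' (aestronglyMeasurable_powInt hS hA e φ) ?_
  filter_upwards [hbd] with x hx
  exact hx e (fun _ => le_rfl) (fun _ => le_rfl) φ

lemma exists_norm_powInt_le (hS : IsPowIntegrable S) (hA : IsEssBounded A) {a b : Fin m → ℝ}
    (ha : ∀ i, (i.val : ℝ) - n < a i) (hb : ∀ i, (i.val : ℝ) - n < b i) :
    ∃ (N : ℕ) (C : ℝ), 0 ≤ C ∧ ∀ e : Fin m → ℂ,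
      (∀ i, a i ≤ (e i).re) → (∀ i, (e i).re ≤ b i) → ∀ φ : 𝓢(MatSpace n m, ℂ),
        ‖powInt S A e φ‖ ≤ C * decaySeminorm N φ := by
  obtain ⟨N, g, hg, hbd⟩ := exists_powInt_majorant hS hA ha hb
  refine ⟨N, |∫ x, g x|, abs_nonneg _, fun e hae hbe φ => ?_⟩
  calc ‖powInt S A e φ‖ ≤ ∫ x, g x * decaySeminorm N φ := by
        refine norm_integral_le_of_norm_le (hg.mul_const _) ?_
        filter_upwards [hbd] with x hx
        exact hx e hae hbe φ
    _ ≤ |∫ x, g x| * decaySeminorm N φ := by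
        rw [integral_mul_const]
        exact mul_le_mul_of_nonneg_right (le_abs_self _) (decaySeminorm_nonneg _ _)

lemma differentiableOn_powInt (hS : IsPowIntegrable S) (hA : IsEssBounded A)
    (φ : 𝓢(MatSpace n m, ℂ)) :
    DifferentiableOn ℂ (fun e => powInt S A e φ) (powDomain n m) := by
  intro e₀ he₀
  obtain ⟨ε, hε, hball⟩ := Metric.isOpen_iff.1 (isOpen_powDomain n m) e₀ he₀
  have hmem : ∀ s : ℝ, |s| < ε → ∀ i : Fin m, (i.val : ℝ) - n < (e₀ i).re + s := fun s hs i => by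
    have : (fun j => e₀ j + (s : ℂ)) ∈ powDomain n m := hball (by
      rw [Metric.mem_ball, dist_pi_lt_iff hε]
      intro j
      simpa using hs)
    simpa using this i
  obtain ⟨N, g, hg, hbd⟩ := exists_powInt_majorant hS hA
    (hmem (-(ε / 2)) (by rw [abs_neg, abs_of_pos] <;> linarith))
    (hmem (ε / 2) (by rw [abs_of_pos] <;> linarith))
  have hre : ∀ e ∈ Metric.ball e₀ (ε / 2), ∀ i, |(e i).re - (e₀ i).re| ≤ ε / 2 := fun e he i => by
    have h1 := (dist_le_pi_dist e e₀ i).trans (Metric.mem_ball.1 he).le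
    rw [Complex.dist_eq] at h1
    exact (by simpa using Complex.abs_re_le_norm (e i - e₀ i) : _ ≤ _).trans h1
  refine (differentiableAt_integral_of_dominated (ε := ε / 2) (by linarith)
    (fun e _ => aestronglyMeasurable_powInt hS hA e φ) ?_ ?_
    (hg.mul_const (decaySeminorm N φ))).differentiableWithinAt
  · filter_upwards [hS.ae_posDef] with x hx
    have := differentiable_compPow hx
    exact (by fun_prop : Differentiable ℂ fun e => compPow (S x) e * A x * φ x).differentiableOn
  · filter_upwards [hbd] with x hx e he
    exact hx e (fun i => by linarith [(abs_le.1 (hre e he i)).1])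
      (fun i => by linarith [(abs_le.1 (hre e he i)).2]) φ

lemma powInt_add (hS : IsPowIntegrable S) (hA : IsEssBounded A) {e : Fin m → ℂ}
    (he : e ∈ powDomain n m) (φ ψ : 𝓢(MatSpace n m, ℂ)) :
    powInt S A e (φ + ψ) = powInt S A e φ + powInt S A e ψ := by
  rw [powInt, powInt, powInt, ← integral_add (integrable_powInt hS hA he φ)
    (integrable_powInt hS hA he ψ)]
  simp only [add_apply, mul_add]

lemma powInt_smul (e : Fin m → ℂ) (c : ℂ) (φ : 𝓢(MatSpace n m, ℂ)) :
    powInt S A e (c • φ) = c * powInt S A e φ := by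
  rw [powInt, powInt, ← integral_const_mul]
  refine integral_congr_ae (Eventually.of_forall fun x => ?_)
  simp only [smul_apply, smul_eq_mul]
  ring

end PowInt

/-! ### The angular part -/

section Angular

variable {n m : ℕ}

lemma sqrt_mul_sqrt_radial (x : MatSpace n m) :
    CFC.sqrt (radial x) * CFC.sqrt (radial x) = radial x :=
  CFC.sqrt_mul_sqrt_self _ (Matrix.nonneg_iff_posSemidef.2 (posSemidef_radial x))

lemma posSemidef_sqrt_radial (x : MatSpace n m) : (CFC.sqrt (radial x)).PosSemidef :=
  Matrix.nonneg_iff_posSemidef.1 (CFC.sqrt_nonneg _)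

lemma det_sqrt_radial_sq (x : MatSpace n m) :
    (CFC.sqrt (radial x)).det ^ 2 = (radial x).det := by
  rw [sq, ← Matrix.det_mul, sqrt_mul_sqrt_radial]

lemma det_sqrt_radial_pos {x : MatSpace n m} (hx : (radial x).PosDef) :
    0 < (CFC.sqrt (radial x)).det := by
  refine lt_of_le_of_ne (posSemidef_sqrt_radial x).det_nonneg fun h => ?_
  have h1 := det_sqrt_radial_sq x
  rw [← h] at h1
  exact hx.det_pos.ne (by simpa using h1)

/-- Determinantal homogeneity with `g` the inverse square root of `radial x`. -/
lemma evalMat_angular {k : ℕ} {P : MvPolynomial (Fin n × Fin m) ℂ} (hdet : IsDetHomogeneous k P)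
    {x : MatSpace n m} (hx : (radial x).PosDef) :
    evalMat P (angular x) = ((radial x).det : ℂ) ^ (-(k : ℂ) / 2) * evalMat P (toMat x) := by
  have hd := det_sqrt_radial_pos hx
  rw [angular, hdet _ (by
    rw [Matrix.det_nonsing_inv, Ring.inverse_eq_inv']
    exact isUnit_iff_ne_zero.2 (inv_ne_zero hd.ne'))]
  congr 1
  rw [Matrix.det_nonsing_inv, Ring.inverse_eq_inv', ← det_sqrt_radial_sq]
  have h := sq_rpow_half hd.le (-(k : ℝ))
  have h2 : (((((CFC.sqrt (radial x)).det ^ 2 : ℝ)) ^ (-(k : ℝ) / 2) : ℝ) : ℂ) =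
      (((CFC.sqrt (radial x)).det ^ 2 : ℝ) : ℂ) ^ (-(k : ℂ) / 2) := by
    rw [Complex.ofReal_cpow (by positivity)]
    push_cast
    rfl
  rw [← h2, h, Real.rpow_neg hd.le, Real.rpow_natCast]
  push_cast
  rw [inv_pow]

lemma angular_transpose_mul_self {x : MatSpace n m} (hx : (radial x).PosDef) :
    (angular x).transpose * angular x = 1 := by
  have hu : IsUnit (CFC.sqrt (radial x)).det := isUnit_iff_ne_zero.2 (det_sqrt_radial_pos hx).ne'
  have hs : (CFC.sqrt (radial x)).transpose = CFC.sqrt (radial x) :=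
    (posSemidef_sqrt_radial x).isHermitian
  rw [angular, Matrix.transpose_mul, Matrix.transpose_nonsing_inv, hs, Matrix.mul_assoc,
    ← Matrix.mul_assoc (toMat x).transpose]
  change _ * (radial x * _) = _
  nth_rewrite 2 [← sqrt_mul_sqrt_radial x]
  rw [Matrix.mul_assoc, Matrix.mul_nonsing_inv _ hu, Matrix.mul_one, Matrix.nonsing_inv_mul _ hu]

/-- Almost everywhere the angular part has orthonormal columns, hence norm √m, and `P` is bounded on
that sphere. Measurability is read off from `evalMat_angular`. -/
lemma isEssBounded_evalMat_angular (hmn : m ≤ n) {k : ℕ} {P : MvPolynomial (Fin n × Fin m) ℂ}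
    (hdet : IsDetHomogeneous k P) :
    IsEssBounded fun x : MatSpace n m => evalMat P (angular x) := by
  constructor
  · have hmeas : Measurable fun x : MatSpace n m =>
        ((radial x).det : ℂ) ^ (-(k : ℂ) / 2) * evalMat P (toMat x) :=
      ((Complex.measurable_ofReal.comp continuous_radial.matrix_det.measurable).pow_const _).mul
        (continuous_evalMat P).measurable
    refine hmeas.aestronglyMeasurable.congr ?_
    filter_upwards [ae_posDef_radial hmn] with x hx
    exact (evalMat_angular hdet hx).symm
  · obtain ⟨C, d, hC, h⟩ := exists_norm_realEval_le P
    refine ⟨C * (1 + √m) ^ d, by positivity, ?_⟩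
    filter_upwards [ae_posDef_radial hmn] with x hx
    have hn : ‖ofMat (angular x)‖ = √m := by
      rw [← Real.sqrt_sq (norm_nonneg _), norm_sq_eq_trace, toMat_ofMat,
        angular_transpose_mul_self hx, Matrix.trace_one, Fintype.card_fin]
    have := h (ofMat (angular x))
    rwa [hn] at this

end Angular

/-! ### The functional equation -/

section FunctionalEquation

variable {n m : ℕ}

/-- The exponent of the dual composite power. -/
def dualExp (n : ℕ) {m : ℕ} (l : Fin m → ℂ) : Fin m → ℂ := -revVec l - constVec m n

lemma prod_cpow_eq_cpow_sum {ι : Type*} {z : ℂ} (hz : z ≠ 0) (s : Finset ι) (f : ι → ℂ) :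
    ∏ i ∈ s, z ^ f i = z ^ ∑ i ∈ s, f i := by
  classical
  induction s using Finset.induction_on with
  | empty => simp
  | insert a s ha ih => rw [Finset.prod_insert ha, Finset.sum_insert ha, ih, Complex.cpow_add _ _ hz]

lemma sum_fin_sub_half (m : ℕ) :
    ∑ i : Fin m, ((m : ℂ) - 1 - (i.val : ℂ)) / 2 = (m : ℂ) * ((m : ℂ) - 1) / 4 := by
  have h : ∀ (p : ℕ) (c : ℂ), ∑ i ∈ Finset.range p, (c - (i : ℂ)) / 2 =
      p * c / 2 - p * ((p : ℂ) - 1) / 4 := fun p c => by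
    induction p with
    | zero => simp
    | succ p ih => rw [Finset.sum_range_succ, ih]; push_cast; ring
  rw [Fin.sum_univ_eq_sum_range (fun i => ((m : ℂ) - 1 - (i : ℂ)) / 2), h]
  ring

lemma val_rev_cast {m : ℕ} (j : Fin m) : (j.rev.val : ℂ) = m - 1 - j.val := by
  have h : j.rev.val + (j.val + 1) = m := by rw [Fin.val_rev]; omega
  have h' := congrArg (Nat.cast : ℕ → ℂ) h
  push_cast at h'
  linear_combination h'

lemma triGamma_eq (n k : ℕ) (l : Fin m → ℂ) :
    triGamma (fun i => l i + n + k - (i.val + 1)) =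
      (1 / 2) ^ m * gammaCone (l + constVec m k + constVec m n) := by
  have hpi : (Real.pi : ℂ) ≠ 0 := by exact_mod_cast Real.pi_ne_zero
  simp only [triGamma, gammaCone]
  rw [Finset.prod_mul_distrib, prod_cpow_eq_cpow_sum hpi, sum_fin_sub_half,
    Finset.prod_mul_distrib, Finset.prod_const, Finset.card_univ, Fintype.card_fin]
  have : ∀ i : Fin m, (l i + n + k - ((i.val : ℂ) + 1) + 1) / 2 =
      ((l + constVec m k + constVec m n) i - (i.val : ℂ)) / 2 := fun i => by
    simp only [Pi.add_apply, constVec]; ring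
  simp only [this]
  ring

/-- Reversing the index turns the gamma factors into those of Γ_Ω(k₀ - λ_*). The powers of 4π, of 2
and of i/2 combine to the constant `dConst`, up to the factor (1/2)^m also present in `triGamma_eq`.
-/
lemma triGammaInv_eq (n k : ℕ) (l : Fin m → ℂ) :
    (Real.pi : ℂ) ^ ((n : ℂ) * m / 2) * (Complex.I / 2) ^ (k * m) *
      triGammaInv (fun i => l i - k - (i.val + 1)) =
      (1 / 2) ^ m * (dConst n k l * gammaCone (constVec m k - revVec l)) := by
  have hpi : (Real.pi : ℂ) ≠ 0 := by exact_mod_cast Real.pi_ne_zero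
  have h4pi : ((4 * Real.pi : ℝ) : ℂ) ≠ 0 := by
    exact_mod_cast (by positivity : (4 * Real.pi) ≠ 0)
  have h4 : ((4 * Real.pi : ℝ) : ℂ) ^ ((m : ℂ) * ((m : ℂ) - 1) / 4) =
      2 ^ ((m : ℂ) * ((m : ℂ) - 1) / 2) * (Real.pi : ℂ) ^ ((m : ℂ) * ((m : ℂ) - 1) / 4) := by
    rw [Complex.ofReal_mul, Complex.mul_cpow_ofReal_nonneg (by norm_num) Real.pi_pos.le,
      show ((4 : ℝ) : ℂ) = ((2 : ℝ) : ℂ) * ((2 : ℝ) : ℂ) by norm_num,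
      Complex.mul_cpow_ofReal_nonneg (by norm_num) (by norm_num), ← Complex.cpow_add _ _ (by simp)]
    congr 2
    ring
  have hsum : ∑ i : Fin m, -(l i - k - ((i.val : ℂ) + 1) + m) =
      -∑ i, l i + (k * m : ℕ) - (m : ℂ) * ((m : ℂ) - 1) / 2 := by
    have h1 : ∀ i : Fin m, -(l i - k - ((i.val : ℂ) + 1) + m) =
        -l i + k - 2 * (((m : ℂ) - 1 - (i.val : ℂ)) / 2) := fun i => by ring
    simp only [h1, Finset.sum_sub_distrib, Finset.sum_add_distrib, Finset.sum_neg_distrib,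
      ← Finset.mul_sum, sum_fin_sub_half, Finset.sum_const, Finset.card_univ, Fintype.card_fin]
    push_cast
    rw [nsmul_eq_mul]
    ring
  have hG : ∏ i : Fin m, Complex.Gamma (-((l i - k - ((i.val : ℂ) + 1) + m) / 2)) =
      ∏ j : Fin m, Complex.Gamma (((constVec m k - revVec l) j - (j.val : ℂ)) / 2) := by
    rw [← Equiv.prod_comp Fin.revPerm]
    refine Finset.prod_congr rfl fun j _ => ?_
    simp only [Fin.revPerm_apply, Pi.sub_apply, constVec, revVec]
    rw [val_rev_cast]
    congr 1; ring
  simp only [triGammaInv, gammaCone, dConst]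
  rw [Finset.prod_mul_distrib, prod_cpow_eq_cpow_sum h4pi, sum_fin_sub_half,
    Finset.prod_mul_distrib, Finset.prod_mul_distrib, prod_cpow_eq_cpow_sum two_ne_zero,
    Finset.prod_const, Finset.card_univ, Fintype.card_fin, hsum, hG, h4,
    Complex.cpow_sub _ _ two_ne_zero, Complex.cpow_add _ _ two_ne_zero, Complex.cpow_natCast, div_pow]
  have h2 : (2 : ℂ) ^ (k * m) ≠ 0 := pow_ne_zero _ two_ne_zero
  have h2' : (2 : ℂ) ^ ((m : ℂ) * ((m : ℂ) - 1) / 2) ≠ 0 := by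
    rw [Complex.cpow_ne_zero_iff]; exact Or.inl two_ne_zero
  field_simp

end FunctionalEquation

section FunctionalEquation

variable {n m : ℕ}

lemma measurable_radial_apply (i j : Fin m) : Measurable fun x : MatSpace n m => radial x i j :=
  (continuous_radial.matrix_elem i j).measurable

lemma TriangularFamily.measurable_gauss (T : TriangularFamily m) (μ : Fin m → ℂ) :
    Measurable fun p : MatSpace n m × T.carrier => (∏ i, (T.t p.2 i i : ℂ) ^ μ i) *
      (Real.exp (-((T.t p.2).transpose * radial p.1 * T.t p.2).trace) : ℂ) := by
  have h1 := T.measurable_t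
  have h2 := measurable_radial_apply (n := n) (m := m)
  refine ((T.measurable_prod_cpow μ).comp measurable_snd).mul
    (Complex.measurable_ofReal.comp (Real.measurable_exp.comp (Measurable.neg ?_)))
  simp only [Matrix.trace, Matrix.diag, Matrix.mul_apply, Matrix.transpose_apply]
  fun_prop

lemma TriangularFamily.measurable_gauss_inv (T : TriangularFamily m) (ν : Fin m → ℂ) :
    Measurable fun p : MatSpace n m × T.carrier => (∏ i, (T.t p.2 i i : ℂ) ^ ν i) *
      (Real.exp (-(1 / 4 * (T.s p.2 * radial p.1 * (T.s p.2).transpose).trace)) : ℂ) := by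
  have h1 := T.measurable_s
  have h2 := measurable_radial_apply (n := n) (m := m)
  refine ((T.measurable_prod_cpow ν).comp measurable_snd).mul
    (Complex.measurable_ofReal.comp (Real.measurable_exp.comp (Measurable.neg ?_)))
  simp only [Matrix.trace, Matrix.diag, Matrix.mul_apply, Matrix.transpose_apply]
  fun_prop

/-- Fubini's theorem for a superposition of kernels whose absolute values are superpositions of the
same form. -/
lemma integral_mul_integral_swap {X Ω : Type*} [MeasurableSpace X] [MeasurableSpace Ω]
    {μ : Measure X} [SFinite μ] {κ : Measure Ω} [SFinite κ] {g : X → ℂ} {K : X → Ω → ℂ}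
    (hg : AEStronglyMeasurable g μ) (hK : Measurable fun p : X × Ω => K p.1 p.2)
    (hKi : ∀ᵐ x ∂μ, Integrable (K x) κ)
    (h : Integrable (fun x => ‖g x‖ * ∫ a, ‖K x a‖ ∂κ) μ) :
    ∫ x, g x * ∫ a, K x a ∂κ ∂μ = ∫ a, ∫ x, g x * K x a ∂μ ∂κ := by
  have hint : Integrable (Function.uncurry fun x a => g x * K x a) (μ.prod κ) := by
    have hm : AEStronglyMeasurable (fun p : X × Ω => g p.1 * K p.1 p.2) (μ.prod κ) :=
      hg.comp_fst.mul hK.aestronglyMeasurable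
    refine (integrable_prod_iff hm).2 ⟨?_, ?_⟩
    · filter_upwards [hKi] with x hx
      exact hx.const_mul (g x)
    · simpa only [norm_mul, integral_const_mul] using h
  rw [← integral_integral_swap hint]
  simp only [integral_const_mul]

/-- The integral of the norm of a superposition of powers of positive numbers. -/
lemma integral_norm_prod_cpow_mul {Ω ι : Type*} [Fintype ι] [MeasurableSpace Ω] {κ : Measure Ω}
    {t : Ω → ι → ℝ} (ht : ∀ a i, 0 < t a i) (μ : ι → ℂ) (w : Ω → ℝ) (hw : ∀ a, 0 ≤ w a) :
    ∫ a, ‖(∏ i, (t a i : ℂ) ^ μ i) * (w a : ℂ)‖ ∂κ =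
      ‖∫ a, (∏ i, (t a i : ℂ) ^ (((μ i).re : ℝ) : ℂ)) * (w a : ℂ) ∂κ‖ := by
  have h : ∀ a, (∏ i, (t a i : ℂ) ^ (((μ i).re : ℝ) : ℂ)) * (w a : ℂ) =
      ((‖(∏ i, (t a i : ℂ) ^ μ i) * (w a : ℂ)‖ : ℝ) : ℂ) := fun a => by
    rw [norm_mul, norm_prod, Complex.norm_real, Real.norm_of_nonneg (hw a)]
    push_cast
    congr 1
    refine Finset.prod_congr rfl fun i _ => ?_
    rw [Complex.norm_cpow_eq_rpow_re_of_pos (ht a i), Complex.ofReal_cpow (ht a i).le]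
  simp only [h]
  rw [integral_complex_ofReal, Complex.norm_real,
    Real.norm_of_nonneg (integral_nonneg fun a => norm_nonneg _)]

/-- Passing from P(v) to P(x) costs a factor det(r)^(k/2), which is a shift of all exponents by `k`.
Only the determinant of `r` matters, so this serves `radial x` and `revMat (radial x)` alike. -/
lemma compPow_sub_mul_evalMat {k : ℕ} {P : MvPolynomial (Fin n × Fin m) ℂ}
    (hdet : IsDetHomogeneous k P) {x : MatSpace n m} (hx : (radial x).PosDef)
    {r : Matrix (Fin m) (Fin m) ℝ} (hr : r.PosDef) (hrd : r.det = (radial x).det) (e : Fin m → ℂ) :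
    compPow r (fun i => e i - k) * evalMat P (toMat x) = compPow r e * evalMat P (angular x) := by
  have h := compPow_add_const hr e (-(k : ℂ))
  simp only [← sub_eq_add_neg] at h
  rw [h, evalMat_angular hdet hx, hrd]
  ring

lemma dualExp_mem_powDomain (n : ℕ) {l : Fin m → ℂ} (h : ∀ i, (l i).re < (i.val : ℝ) + 1 - m) :
    dualExp n l ∈ powDomain n m := fun i => by
  simp only [dualExp, revVec, constVec, Pi.sub_apply, Pi.neg_apply, Complex.sub_re,
    Complex.neg_re, Complex.natCast_re]
  have h2 : (i.rev.val : ℝ) + (i.val + 1) = m := by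
    rw [Fin.val_rev]; exact_mod_cast Nat.sub_add_cancel i.2
  linarith [h i.rev]

/-- The functional equation of the zeta integrals. -/
theorem gammaCone_mul_powInt_fourierS (hmn : m ≤ n) {k : ℕ} {P : MvPolynomial (Fin n × Fin m) ℂ}
    (hharm : IsHarmonicPoly P) (hdet : IsDetHomogeneous k P) {l : Fin m → ℂ}
    (h1 : ∀ i, (i.val : ℝ) - n < (l i).re) (h2 : ∀ i, (l i).re < (i.val : ℝ) + 1 - m)
    (φ : 𝓢(MatSpace n m, ℂ)) :
    gammaCone (l + constVec m k + constVec m n) *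
        powInt (fun x => revMat (radial x)) (fun x => evalMat P (angular x)) (dualExp n l)
          (fourierS n m φ) =
      dConst n k l * gammaCone (constVec m k - revVec l) *
        powInt (fun x => radial x) (fun x => evalMat P (angular x)) l φ := by
  set T := triangularFamily m
  set ψ := fourierS n m φ
  -- `μ` is chosen so that the gamma integral yields the exponents `dualExp n l - k`. The Fourier
  -- transform contributes `det(t) ^ (-(2k + n))`, which changes `μ` into `ν`, and the inverted
  -- integral with `ν` yields the exponents `l - k`.
  set μ : Fin m → ℂ := fun i => l i + n + k - (i.val + 1) with hμ
  set ν : Fin m → ℂ := fun i => l i - k - (i.val + 1) with hν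
  have hk0 : (0 : ℝ) ≤ k := Nat.cast_nonneg k
  have hμre : ∀ i, -1 < (μ i).re := fun i => by
    simp only [hμ, Complex.sub_re, Complex.add_re, Complex.natCast_re, Complex.one_re]
    linarith [h1 i]
  have hνre : ∀ i, (ν i).re + m < 0 := fun i => by
    simp only [hν, Complex.sub_re, Complex.add_re, Complex.natCast_re, Complex.one_re]
    linarith [h2 i]
  have hA := isEssBounded_evalMat_angular hmn hdet
  have hS := isPowIntegrable_radial (n := n) hmn
  have hS' := isPowIntegrable_revMat_radial (n := n) hmn
  have hpd := ae_posDef_radial (n := n) hmn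
  set Kt : MatSpace n m → T.carrier → ℂ := fun x a => (∏ i, (T.t a i i : ℂ) ^ μ i) *
      (Real.exp (-((T.t a).transpose * radial x * T.t a).trace) : ℂ) with hKt
  set Ks : MatSpace n m → T.carrier → ℂ := fun x a => (∏ i, (T.t a i i : ℂ) ^ ν i) *
      (Real.exp (-(1 / 4 * (T.s a * radial x * (T.s a).transpose).trace)) : ℂ) with hKs
  have hPm : ∀ φ : 𝓢(MatSpace n m, ℂ), AEStronglyMeasurable fun x : MatSpace n m =>
      evalMat P (toMat x) * φ x := fun φ =>
    ((continuous_evalMat P).mul φ.continuous).aestronglyMeasurable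
  have expt : ∀ l : Fin m → ℂ, ∀ j : Fin m,
      -((l j.rev + n + k - ((j.rev.val : ℂ) + 1)) + j.rev.val + 1) = dualExp n l j - k := fun l j => by
    simp only [dualExp, revVec, constVec, Pi.sub_apply, Pi.neg_apply]; ring
  have exps : ∀ l : Fin m → ℂ, ∀ j : Fin m,
      (l j - k - ((j.val : ℂ) + 1)) + j.val + 1 = l j - k := fun l j => by ring
  have hswap1 : ∫ x, (evalMat P (toMat x) * ψ x) * ∫ a, Kt x a ∂T.measure =
      ∫ a, (∫ x, (evalMat P (toMat x) * ψ x) * Kt x a) ∂T.measure := by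
    refine integral_mul_integral_swap (hPm ψ) (T.measurable_gauss μ) ?_ ?_
    · filter_upwards [hpd] with x hx
      exact (T.integral_gauss μ hμre _ hx).1
    -- Taking absolute values under the integral over `t` replaces the exponents by their real
    -- parts. The double integral thus converges absolutely because the zeta integral at the real
    -- point `lr` does.
    · set lr : Fin m → ℂ := fun i => (((l i).re : ℝ) : ℂ) with hlr
      have hlrD : dualExp n lr ∈ powDomain n m :=
        dualExp_mem_powDomain n fun i => by simpa [hlr] using h2 i
      have hI := ((integrable_powInt hS' hA hlrD ψ).norm).const_mul
        ‖triGamma (fun i => (((μ i).re : ℝ) : ℂ))‖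
      refine hI.congr ?_
      filter_upwards [hpd] with x hx
      rw [integral_norm_prod_cpow_mul (fun a i => T.diag_pos a i) μ _ fun a => (Real.exp_pos _).le,
        (T.integral_gauss (fun i => (((μ i).re : ℝ) : ℂ)) (by simpa using hμre) _ hx).2]
      have e : (fun j : Fin m => -(((((μ j.rev).re : ℝ) : ℂ)) + j.rev.val + 1)) =
          fun j => dualExp n lr j - k := by
        funext j
        rw [← expt lr j]
        simp [hμ, hlr]
      rw [e, ← norm_mul, ← norm_mul]
      congr 1
      rw [← compPow_sub_mul_evalMat hdet hx hx.revMat (det_revMat _)]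
      ring
  have hswap2 : ∫ x, (evalMat P (toMat x) * φ x) * ∫ a, Ks x a ∂T.measure =
      ∫ a, (∫ x, (evalMat P (toMat x) * φ x) * Ks x a) ∂T.measure := by
    refine integral_mul_integral_swap (hPm φ) (T.measurable_gauss_inv ν) ?_ ?_
    · filter_upwards [hpd] with x hx
      exact (T.integral_gauss_inv ν hνre _ hx).1
    · set lr : Fin m → ℂ := fun i => (((l i).re : ℝ) : ℂ) with hlr
      have hlrD : lr ∈ powDomain n m := fun i => by simpa [hlr] using h1 i
      have hI := ((integrable_powInt hS hA hlrD φ).norm).const_mul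
        ‖triGammaInv (fun i => (((ν i).re : ℝ) : ℂ))‖
      refine hI.congr ?_
      filter_upwards [hpd] with x hx
      rw [integral_norm_prod_cpow_mul (fun a i => T.diag_pos a i) ν _ fun a => (Real.exp_pos _).le,
        (T.integral_gauss_inv (fun i => (((ν i).re : ℝ) : ℂ)) (by simpa using hνre) _ hx).2]
      have e : (fun j : Fin m => ((((ν j).re : ℝ) : ℂ)) + j.val + 1) = fun j => lr j - k := by
        funext j
        rw [← exps lr j]
        simp [hν, hlr]
      rw [e, ← norm_mul, ← norm_mul]
      congr 1
      rw [← compPow_sub_mul_evalMat hdet hx hx rfl]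
      ring
  have hleft : ∫ x, (evalMat P (toMat x) * ψ x) * ∫ a, Kt x a ∂T.measure = triGamma μ *
      powInt (fun x => revMat (radial x)) (fun x => evalMat P (angular x)) (dualExp n l) ψ := by
    rw [powInt, ← integral_const_mul]
    refine integral_congr_ae ?_
    filter_upwards [hpd] with x hx
    simp only [hKt]
    rw [(T.integral_gauss μ hμre _ hx).2, ← compPow_sub_mul_evalMat hdet hx hx.revMat (det_revMat _)]
    simp only [hμ, expt]
    ring
  have hright : ∫ x, (evalMat P (toMat x) * φ x) * ∫ a, Ks x a ∂T.measure = triGammaInv ν *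
      powInt (fun x => radial x) (fun x => evalMat P (angular x)) l φ := by
    rw [powInt, ← integral_const_mul]
    refine integral_congr_ae ?_
    filter_upwards [hpd] with x hx
    simp only [hKs]
    rw [(T.integral_gauss_inv ν hνre _ hx).2, ← compPow_sub_mul_evalMat hdet hx hx rfl]
    simp only [hν, exps]
    ring
  have hmid : ∀ a, ∫ x, (evalMat P (toMat x) * ψ x) * Kt x a =
      (Real.pi : ℂ) ^ ((n : ℂ) * m / 2) * (Complex.I / 2) ^ (k * m) *
        ∫ x, (evalMat P (toMat x) * φ x) * Ks x a := fun a => by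
    have hP := integral_evalMat_mul_gauss_mul_fourierS hharm hdet (T.mul_eq_one a) (T.det_pos a) φ
    have e1 : ∫ x, (evalMat P (toMat x) * ψ x) * Kt x a = (∏ i, (T.t a i i : ℂ) ^ μ i) *
        ∫ x, evalMat P (toMat x) * (Real.exp (-((T.t a).transpose * radial x * T.t a).trace) : ℂ) *
          ψ x := by
      rw [← integral_const_mul]
      refine integral_congr_ae (Eventually.of_forall fun x => ?_)
      simp only [hKt]; ring
    have e2 : ∫ x, (evalMat P (toMat x) * φ x) * Ks x a = (∏ i, (T.t a i i : ℂ) ^ ν i) *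
        ∫ x, evalMat P (toMat x) *
          (Real.exp (-(1 / 4 * (T.s a * radial x * (T.s a).transpose).trace)) : ℂ) * φ x := by
      rw [← integral_const_mul]
      refine integral_congr_ae (Eventually.of_forall fun x => ?_)
      simp only [hKs]; ring
    have e3 : ∏ i, (T.t a i i : ℂ) ^ ν i = (∏ i, (T.t a i i : ℂ) ^ μ i) *
        ((((T.t a).det ^ (2 * k + n))⁻¹ : ℝ) : ℂ) := by
      rw [T.det_eq, ← Finset.prod_pow, ← Finset.prod_inv_distrib, Complex.ofReal_prod,
        ← Finset.prod_mul_distrib]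
      refine Finset.prod_congr rfl fun i _ => ?_
      have h0 : (T.t a i i : ℂ) ≠ 0 := by exact_mod_cast (T.diag_pos a i).ne'
      have : ν i = μ i - (2 * k + n : ℕ) := by simp only [hν, hμ]; push_cast; ring
      rw [this, Complex.cpow_sub _ _ h0, Complex.cpow_natCast]
      push_cast
      rw [div_eq_mul_inv]
    rw [e1, e2, hP, e3]
    ring
  have hfin : triGamma μ *
      powInt (fun x => revMat (radial x)) (fun x => evalMat P (angular x)) (dualExp n l) ψ =
      (Real.pi : ℂ) ^ ((n : ℂ) * m / 2) * (Complex.I / 2) ^ (k * m) * triGammaInv ν *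
        powInt (fun x => radial x) (fun x => evalMat P (angular x)) l φ := by
    rw [← hleft, hswap1]
    simp only [hmid]
    rw [integral_const_mul, ← hswap2, hright]
    ring
  rw [triGamma_eq, triGammaInv_eq] at hfin
  have h2 : ((1 : ℂ) / 2) ^ m ≠ 0 := pow_ne_zero _ (by norm_num)
  apply mul_left_cancel₀ h2
  linear_combination hfin

end FunctionalEquation

/-! ### Continuation across two half spaces -/

section Continuation

variable {ι X : Type*} [Fintype ι]

/-- The points whose real parts lie between two vectors. -/
def reBox (a b : ι → ℝ) : Set (ι → ℂ) := {l | ∀ i, a i ≤ (l i).re ∧ (l i).re ≤ b i}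

/-- A family of functions holomorphic on `D`, of exponential growth in the imaginary directions,
bounded in terms of the functions `q N` of the parameter. -/
structure HasStripGrowth (q : ℕ → X → ℝ) (D : Set (ι → ℂ)) (f : X → (ι → ℂ) → ℂ) : Prop where
  isOpen : IsOpen D
  differentiableOn : ∀ φ, DifferentiableOn ℂ (f φ) D
  bound : ∀ a b : ι → ℝ, reBox a b ⊆ D → ∃ (N : ℕ) (C A : ℝ), 0 ≤ C ∧ 0 ≤ A ∧ ∀ φ, ∀ l ∈ reBox a b,
    ‖f φ l‖ ≤ C * Real.exp (A * ∑ i, |(l i).im|) * q N φ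

/-- The integral of `z ↦ f (l + z) exp (z ^ 2) / z` over a vertical line. -/
noncomputable def stripInt (f : (ι → ℂ) → ℂ) (c : ℝ) (l : ι → ℂ) : ℂ :=
  ∫ τ : ℝ, f (fun j => l j + (c + τ * Complex.I)) *
    (Complex.exp ((c + τ * Complex.I) ^ 2) / (c + τ * Complex.I))

lemma norm_exp_sq_div_le {c : ℝ} (hc : c ≠ 0) (τ : ℝ) :
    ‖Complex.exp ((c + τ * Complex.I) ^ 2) / (c + τ * Complex.I)‖ ≤
      Real.exp (c ^ 2) / |c| * Real.exp (-|τ| ^ 2) := by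
  rw [norm_div, Complex.norm_exp]
  have h1 : (((c : ℂ) + τ * Complex.I) ^ 2).re = c ^ 2 - |τ| ^ 2 := by
    simp [sq]
  have h2 : |c| ≤ ‖(c : ℂ) + τ * Complex.I‖ := by
    simpa using Complex.abs_re_le_norm ((c : ℂ) + τ * Complex.I)
  have hc' : 0 < |c| := abs_pos.2 hc
  rw [h1, sub_eq_add_neg, Real.exp_add, div_mul_eq_mul_div]
  exact div_le_div_of_nonneg_left (by positivity) hc' h2

lemma integrable_exp_neg_abs : Integrable fun τ : ℝ => Real.exp (-|τ|) := by
  rw [← integrableOn_univ, ← Set.Iic_union_Ioi (a := (0 : ℝ))]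
  refine IntegrableOn.union ?_ ?_
  · refine (integrableOn_exp_Iic 0).congr_fun (fun τ hτ => ?_) measurableSet_Iic
    simp only [abs_of_nonpos (Set.mem_Iic.1 hτ), neg_neg]
  · refine (integrableOn_exp_neg_Ioi 0).congr_fun (fun τ hτ => ?_) measurableSet_Ioi
    simp only [abs_of_pos (Set.mem_Ioi.1 hτ)]

variable {q : ℕ → X → ℝ} {D : Set (ι → ℂ)} {f : X → (ι → ℂ) → ℂ}

/-- Moving by `iτ` in every coordinate adds at most `card ι * |τ|` to the sum of imaginary parts,
and the Gaussian kernel absorbs that exponential growth. -/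
lemma HasStripGrowth.exists_majorant (hf : HasStripGrowth q D f) (hq : ∀ N φ, 0 ≤ q N φ) {c : ℝ}
    (hc : c ≠ 0) {l₀ : ι → ℂ} {ε : ℝ}
    (hbox : reBox (fun j => (l₀ j).re + c - ε) (fun j => (l₀ j).re + c + ε) ⊆ D) :
    ∃ (N : ℕ) (C : ℝ), 0 ≤ C ∧ ∀ φ, ∀ l ∈ Metric.ball l₀ ε, ∀ τ : ℝ,
      ‖f φ (fun j => l j + (c + τ * Complex.I)) *
        (Complex.exp ((c + τ * Complex.I) ^ 2) / (c + τ * Complex.I))‖ ≤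
        C * q N φ * Real.exp (-|τ|) := by
  obtain ⟨N, C, A, hC, hA, hbd⟩ := hf.bound _ _ hbox
  set B : ℝ := A * ∑ j, (|(l₀ j).im| + ε) with hB
  refine ⟨N, C * Real.exp B * (Real.exp (c ^ 2) / |c|) *
    Real.exp ((A * Fintype.card ι + 1) ^ 2), by positivity, fun φ l hl τ => ?_⟩
  have hd : ∀ j, ‖l j - l₀ j‖ ≤ ε := fun j => by
    rw [← Complex.dist_eq]
    exact (dist_le_pi_dist l l₀ j).trans (Metric.mem_ball.1 hl).le
  have hmem : (fun j => l j + ((c : ℂ) + τ * Complex.I)) ∈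
      reBox (fun j => (l₀ j).re + c - ε) (fun j => (l₀ j).re + c + ε) := fun j => by
    have h := (Complex.abs_re_le_norm (l j - l₀ j)).trans (hd j)
    rw [Complex.sub_re, abs_le] at h
    simp only [Complex.add_re, Complex.ofReal_re, Complex.mul_re, Complex.I_re, mul_zero,
      Complex.ofReal_im, Complex.I_im, zero_mul, sub_self, add_zero]
    constructor <;> linarith [h.1, h.2]
  have him : ∑ j, |(l j + ((c : ℂ) + τ * Complex.I)).im| ≤
      (∑ j, (|(l₀ j).im| + ε)) + Fintype.card ι * |τ| := by
    rw [← nsmul_eq_mul, ← Finset.card_univ, ← Finset.sum_const, ← Finset.sum_add_distrib]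
    refine Finset.sum_le_sum fun j _ => ?_
    have h := (Complex.abs_im_le_norm (l j - l₀ j)).trans (hd j)
    rw [Complex.sub_im] at h
    have e : (l j + ((c : ℂ) + τ * Complex.I)).im = (l₀ j).im + ((l j).im - (l₀ j).im) + τ := by
      simp
    rw [e]
    exact (abs_add_three _ _ _).trans (by linarith)
  have h1 := hbd φ _ hmem
  have h2 : Real.exp (A * ∑ j, |(l j + ((c : ℂ) + τ * Complex.I)).im|) ≤
      Real.exp B * Real.exp (A * Fintype.card ι * |τ|) := by
    rw [← Real.exp_add]
    refine Real.exp_le_exp.2 ((mul_le_mul_of_nonneg_left him hA).trans (le_of_eq ?_))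
    rw [hB]; ring
  rw [norm_mul]
  calc _ ≤ (C * (Real.exp B * Real.exp (A * Fintype.card ι * |τ|)) * q N φ) *
        (Real.exp (c ^ 2) / |c| * Real.exp (-|τ| ^ 2)) :=
        mul_le_mul (h1.trans (mul_le_mul_of_nonneg_right
          (mul_le_mul_of_nonneg_left h2 hC) (hq N φ))) (norm_exp_sq_div_le hc τ) (norm_nonneg _)
          (mul_nonneg (by positivity) (hq N φ))
    _ = C * Real.exp B * (Real.exp (c ^ 2) / |c|) * q N φ *
        (Real.exp (A * Fintype.card ι * |τ|) * Real.exp (-|τ| ^ 2)) := by ring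
    _ ≤ C * Real.exp B * (Real.exp (c ^ 2) / |c|) * q N φ *
        (Real.exp ((A * Fintype.card ι + 1) ^ 2) * Real.exp (-|τ|)) :=
        mul_le_mul_of_nonneg_left (exp_linear_sub_sq_le _ _)
          (mul_nonneg (by positivity) (hq N φ))
    _ = _ := by ring

lemma HasStripGrowth.differentiableAt_stripInt (hf : HasStripGrowth q D f)
    (hq : ∀ N φ, 0 ≤ q N φ) {c : ℝ} (hc : c ≠ 0) {l₀ : ι → ℂ} {ε : ℝ} (hε : 0 < ε)
    (hbox : reBox (fun j => (l₀ j).re + c - ε) (fun j => (l₀ j).re + c + ε) ⊆ D) (φ : X) :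
    DifferentiableAt ℂ (stripInt (f φ) c) l₀ := by
  obtain ⟨N, C, hC, h⟩ := hf.exists_majorant hq hc hbox
  have hmem : ∀ l ∈ Metric.ball l₀ ε, ∀ τ : ℝ, (fun j => l j + ((c : ℂ) + τ * Complex.I)) ∈ D :=
    fun l hl τ => hbox fun j => by
      have h := ((Complex.abs_re_le_norm (l j - l₀ j)).trans
        ((Complex.dist_eq _ _).symm.le.trans (dist_le_pi_dist l l₀ j))).trans
        (Metric.mem_ball.1 hl).le
      rw [Complex.sub_re, abs_le] at h
      simp only [Complex.add_re, Complex.ofReal_re, Complex.mul_re, Complex.I_re, mul_zero,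
        Complex.ofReal_im, Complex.I_im, zero_mul, sub_self, add_zero]
      constructor <;> linarith [h.1, h.2]
  have hne : ∀ τ : ℝ, (c : ℂ) + τ * Complex.I ≠ 0 := fun τ h0 => by
    have := congrArg Complex.re h0
    simp at this; exact hc this
  refine differentiableAt_integral_of_dominated hε (bound := fun τ => C * q N φ * Real.exp (-|τ|))
    (fun l hl => ?_) (Eventually.of_forall fun τ => ?_)
    (Eventually.of_forall fun τ l hl => h φ l hl τ) (integrable_exp_neg_abs.const_mul _)
  · refine Continuous.aestronglyMeasurable (Continuous.mul ?_ ?_)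
    · exact (hf.differentiableOn φ).continuousOn.comp_continuous (by fun_prop) (hmem l hl)
    · exact Continuous.div (by fun_prop) (by fun_prop) hne
  · refine DifferentiableOn.mul_const ?_ _
    exact (hf.differentiableOn φ).comp (by fun_prop) fun l hl => hmem l hl τ

lemma HasStripGrowth.exists_norm_stripInt_le (hf : HasStripGrowth q D f)
    (hq : ∀ N φ, 0 ≤ q N φ) {c : ℝ} (hc : c ≠ 0) {l₀ : ι → ℂ} {ε : ℝ} (hε : 0 < ε)
    (hbox : reBox (fun j => (l₀ j).re + c - ε) (fun j => (l₀ j).re + c + ε) ⊆ D) :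
    ∃ (N : ℕ) (C : ℝ), 0 ≤ C ∧ ∀ φ, ‖stripInt (f φ) c l₀‖ ≤ C * q N φ := by
  obtain ⟨N, C, hC, h⟩ := hf.exists_majorant hq hc hbox
  refine ⟨N, C * ∫ τ : ℝ, Real.exp (-|τ|), mul_nonneg hC (integral_nonneg fun τ => by positivity),
    fun φ => ?_⟩
  refine (norm_integral_le_of_norm_le (integrable_exp_neg_abs.const_mul (C * q N φ))
    (Eventually.of_forall fun τ => h φ l₀ (Metric.mem_ball_self hε) τ)).trans (le_of_eq ?_)
  rw [integral_const_mul]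
  ring

end Continuation

section Continuation

set_option linter.unusedSectionVars false

variable {ι X : Type*} [Fintype ι] {q : ℕ → X → ℝ} {α β v : ι → ℝ} {f₁ f₂ : X → (ι → ℂ) → ℂ}

/-- The combination of integrals over two vertical lines that recovers the value at a point. -/
noncomputable def twoStripInt (f₁ f₂ : (ι → ℂ) → ℂ) (c : ℝ) (l : ι → ℂ) : ℂ :=
  (2 * (Real.pi : ℂ))⁻¹ * (stripInt f₁ c l - stripInt f₂ (-c) l)

/-- Along `z ↦ l + z (1, …, 1)` with `l` near `v`, the functions `f₁` and `f₂` glue to one entire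
function with exponential growth in vertical strips, and `cauchy_strip` recovers its value at 0. -/
lemma twoStripInt_eq (h₁ : HasStripGrowth q {l | ∀ i, α i < (l i).re} f₁)
    (h₂ : HasStripGrowth q {l | ∀ i, (l i).re < β i} f₂) (hq : ∀ N φ, 0 ≤ q N φ)
    (hα : ∀ i, α i + 1 / 2 ≤ v i) (hβ : ∀ i, v i + 1 / 2 ≤ β i) (φ : X)
    (heq : ∀ l : ι → ℂ, (∀ i, α i < (l i).re) → (∀ i, (l i).re < β i) → f₁ φ l = f₂ φ l)
    {c : ℝ} (hc : 0 < c) {l : ι → ℂ} (hl : ∀ i, |(l i).re - v i| < 1 / 4) :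
    twoStripInt (f₁ φ) (f₂ φ) c l = f₁ φ l := by
  have hl' := fun i => abs_lt.1 (hl i)
  let L : ℂ → (ι → ℂ) := fun z i => l i + z
  have hL : Differentiable ℂ L := by fun_prop
  have hLre : ∀ z i, (L z i).re = (l i).re + z.re := fun z i => Complex.add_re _ _
  -- The overlap reaches at least 1/2 to either side of `v` and `l` is within 1/4 of it. So for |Re
  -- z| < 1/4 both formulas are valid, and the choice at Re z = 0 is harmless.
  let f : ℂ → ℂ := fun z => if 0 < z.re then f₁ φ (L z) else f₂ φ (L z)
  have hD₁ : ∀ z : ℂ, -(1 / 4) < z.re → ∀ i, α i < (L z i).re := fun z hz i => by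
    rw [hLre]; linarith [hα i, (hl' i).1]
  have hD₂ : ∀ z : ℂ, z.re < 1 / 4 → ∀ i, (L z i).re < β i := fun z hz i => by
    rw [hLre]; linarith [hβ i, (hl' i).2]
  have hf₁ : ∀ z : ℂ, -(1 / 4) < z.re → f z = f₁ φ (L z) := fun z hz => by
    by_cases h : 0 < z.re
    · simp only [f, if_pos h]
    · simp only [f, if_neg h]
      exact (heq _ (hD₁ z hz) (hD₂ z (by linarith [not_lt.1 h]))).symm
  have hf₂ : ∀ z : ℂ, z.re < 1 / 4 → f z = f₂ φ (L z) := fun z hz => by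
    by_cases h : 0 < z.re
    · simp only [f, if_pos h]
      exact heq _ (hD₁ z (by linarith)) (hD₂ z hz)
    · simp only [f, if_neg h]
  have hfd : Differentiable ℂ f := by
    intro z
    by_cases h : 0 < z.re
    · have ho : IsOpen {z : ℂ | 0 < z.re} := isOpen_lt continuous_const Complex.continuous_re
      have hd : DifferentiableAt ℂ (fun z => f₁ φ (L z)) z :=
        ((h₁.differentiableOn φ).differentiableAt (h₁.isOpen.mem_nhds (hD₁ z (by linarith)))).comp z
          (hL z)
      refine hd.congr_of_eventuallyEq ?_
      filter_upwards [ho.mem_nhds h] with w hw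
      exact hf₁ w (lt_trans (by norm_num) hw)
    · have ho : IsOpen {z : ℂ | z.re < 1 / 4} := isOpen_lt Complex.continuous_re continuous_const
      have hz : z.re < 1 / 4 := by linarith [not_lt.1 h]
      have hd : DifferentiableAt ℂ (fun z => f₂ φ (L z)) z :=
        ((h₂.differentiableOn φ).differentiableAt (h₂.isOpen.mem_nhds (hD₂ z hz))).comp z (hL z)
      refine hd.congr_of_eventuallyEq ?_
      filter_upwards [ho.mem_nhds hz] with w hw
      exact hf₂ w hw
  obtain ⟨N₁, C₁, A₁, hC₁, hA₁, hb₁⟩ := h₁.bound (fun i => v i - 1 / 4) (fun i => v i + 1 / 4 + c)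
    fun w hw i => by linarith [hα i, (hw i).1]
  obtain ⟨N₂, C₂, A₂, hC₂, hA₂, hb₂⟩ := h₂.bound (fun i => v i - 1 / 4 - c) (fun i => v i + 1 / 4)
    fun w hw i => by linarith [hβ i, (hw i).2]
  set s : ℝ := ∑ i, |(l i).im| with hs
  have hs0 : 0 ≤ s := Finset.sum_nonneg fun i _ => abs_nonneg _
  have hLim : ∀ x τ : ℝ, ∑ i, |(L (x + τ * Complex.I) i).im| ≤ s + Fintype.card ι * |τ| :=
    fun x τ => by
      rw [hs, ← nsmul_eq_mul, ← Finset.card_univ, ← Finset.sum_const, ← Finset.sum_add_distrib]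
      refine Finset.sum_le_sum fun j _ => ?_
      have e : (L (x + τ * Complex.I) j).im = (l j).im + τ := by simp [L]
      rw [e]
      exact abs_add_le _ _
  have hexp : ∀ (A : ℝ), 0 ≤ A → ∀ x τ : ℝ, Real.exp (A * ∑ i, |(L (x + τ * Complex.I) i).im|) ≤
      Real.exp (A * s) * Real.exp (A * Fintype.card ι * |τ|) := fun A hA x τ => by
    rw [← Real.exp_add]
    refine Real.exp_le_exp.2 ((mul_le_mul_of_nonneg_left (hLim x τ) hA).trans (le_of_eq ?_))
    ring
  set A := max A₁ A₂ * Fintype.card ι with hA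
  have hmono : ∀ (A' : ℝ), A' ≤ max A₁ A₂ → ∀ τ : ℝ,
      Real.exp (A' * Fintype.card ι * |τ|) ≤ Real.exp (A * |τ|) := fun A' h τ => by
    refine Real.exp_le_exp.2 ?_
    rw [hA]
    gcongr
  have hcs := cauchy_strip hfd hc
    (C := C₁ * Real.exp (A₁ * s) * q N₁ φ + C₂ * Real.exp (A₂ * s) * q N₂ φ) (A := A)
    (add_nonneg (mul_nonneg (by positivity) (hq _ _)) (mul_nonneg (by positivity) (hq _ _)))
    (by positivity) ?_
  · have e₁ : stripInt (f₁ φ) c l = ∫ τ : ℝ, f (c + τ * Complex.I) *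
        (Complex.exp ((c + τ * Complex.I) ^ 2) / (c + τ * Complex.I)) := by
      refine integral_congr_ae (Eventually.of_forall fun τ => ?_)
      simp only
      rw [hf₁ _ (by simp; linarith)]
    have e₂ : stripInt (f₂ φ) (-c) l = ∫ τ : ℝ, f (-c + τ * Complex.I) *
        (Complex.exp ((-c + τ * Complex.I) ^ 2) / (-c + τ * Complex.I)) := by
      refine integral_congr_ae (Eventually.of_forall fun τ => ?_)
      simp only [Complex.ofReal_neg]
      rw [hf₂ _ (by simp; linarith)]
    rw [twoStripInt, e₁, e₂, hcs, hf₁ 0 (by simp)]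
    have hpi : (Real.pi : ℂ) ≠ 0 := by exact_mod_cast Real.pi_ne_zero
    have : L 0 = l := by funext i; simp [L]
    rw [this]
    field_simp
  · intro x τ hx
    have hx' := abs_le.1 hx
    have hre : ((x : ℂ) + τ * Complex.I).re = x := by simp
    have p₁ : 0 ≤ C₁ * Real.exp (A₁ * s) * q N₁ φ := mul_nonneg (by positivity) (hq _ _)
    have p₂ : 0 ≤ C₂ * Real.exp (A₂ * s) * q N₂ φ := mul_nonneg (by positivity) (hq _ _)
    rw [add_mul]
    rcases le_total 0 x with h | h
    · rw [hf₁ _ (by rw [hre]; linarith)]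
      have hb := hb₁ φ (L (x + τ * Complex.I)) fun i => by
        simp only [hLre, hre]
        constructor <;> linarith [(hl' i).1, (hl' i).2]
      refine le_trans ?_ (le_add_of_nonneg_right (mul_nonneg p₂ (Real.exp_pos _).le))
      calc _ ≤ C₁ * (Real.exp (A₁ * s) * Real.exp (A * |τ|)) * q N₁ φ := by
            refine hb.trans (mul_le_mul_of_nonneg_right (mul_le_mul_of_nonneg_left ?_ hC₁) (hq _ _))
            exact (hexp A₁ hA₁ x τ).trans
              (mul_le_mul_of_nonneg_left (hmono A₁ (le_max_left _ _) τ) (Real.exp_pos _).le)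
        _ = _ := by ring
    · rw [hf₂ _ (by rw [hre]; linarith)]
      have hb := hb₂ φ (L (x + τ * Complex.I)) fun i => by
        simp only [hLre, hre]
        constructor <;> linarith [(hl' i).1, (hl' i).2]
      refine le_trans ?_ (le_add_of_nonneg_left (mul_nonneg p₁ (Real.exp_pos _).le))
      calc _ ≤ C₂ * (Real.exp (A₂ * s) * Real.exp (A * |τ|)) * q N₂ φ := by
            refine hb.trans (mul_le_mul_of_nonneg_right (mul_le_mul_of_nonneg_left ?_ hC₂) (hq _ _))
            exact (hexp A₂ hA₂ x τ).trans
              (mul_le_mul_of_nonneg_left (hmono A₂ (le_max_right _ _) τ) (Real.exp_pos _).le)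
        _ = _ := by ring

lemma isOpen_setOf_lt_re (β : ι → ℝ) : IsOpen {l : ι → ℂ | ∀ i, (l i).re < β i} := by
  simp only [Set.ofPred_forall]
  exact isOpen_iInter_of_finite fun i => isOpen_lt (by fun_prop) continuous_const

lemma convex_setOf_re_mem (s : ι → Set ℝ) (hs : ∀ i, Convex ℝ (s i)) :
    Convex ℝ {l : ι → ℂ | ∀ i, (l i).re ∈ s i} := by
  intro x hx y hy a b ha hb hab i
  have := hs i (hx i) (hy i) ha hb hab
  simpa using this

/-- Functions holomorphic on two opposite half spaces, which overlap and where they agree on the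
overlap, have a common entire extension. -/
theorem exists_entire_extension (h₁ : HasStripGrowth q {l | ∀ i, α i < (l i).re} f₁)
    (h₂ : HasStripGrowth q {l | ∀ i, (l i).re < β i} f₂) (hq : ∀ N φ, 0 ≤ q N φ)
    (hqm : ∀ N N', N ≤ N' → ∀ φ, q N φ ≤ q N' φ)
    (hα : ∀ i, α i + 1 / 2 ≤ v i) (hβ : ∀ i, v i + 1 / 2 ≤ β i)
    (heq : ∀ φ, ∀ l : ι → ℂ, (∀ i, α i < (l i).re) → (∀ i, (l i).re < β i) → f₁ φ l = f₂ φ l) :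
    ∃ F : X → (ι → ℂ) → ℂ, (∀ φ, Differentiable ℂ (F φ)) ∧
      (∀ φ l, (∀ i, α i < (l i).re) → F φ l = f₁ φ l) ∧
      (∀ φ l, (∀ i, (l i).re < β i) → F φ l = f₂ φ l) ∧
      ∀ l, ∃ (N : ℕ) (C : ℝ), 0 ≤ C ∧ ∀ φ, ‖F φ l‖ ≤ C * q N φ := by
  set C₀ : ℝ := ∑ i, (|α i| + |β i| + |v i|) + 1 with hC₀
  have hle : ∀ i, |α i| + |β i| + |v i| + 1 ≤ C₀ := fun i => by
    have := Finset.single_le_sum (f := fun i => |α i| + |β i| + |v i|)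
      (fun i _ => by positivity) (Finset.mem_univ i)
    linarith
  have hC₀' : 1 ≤ C₀ := by
    have : 0 ≤ ∑ i, (|α i| + |β i| + |v i|) := Finset.sum_nonneg fun i _ => by positivity
    linarith
  -- For `l` in `S c`, the translates of `l` by `c` and by `-c` lie in the domains of `f₁` and `f₂`,
  -- with a margin of 1/2 for holomorphy.
  let S : ℝ → Set (ι → ℂ) := fun c => {l | ∀ i, (l i).re ∈ Set.Ioo (-(c - C₀)) (c - C₀)}
  have hSo : ∀ c, IsOpen (S c) := fun c => by
    simp only [S, Set.ofPred_forall]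
    exact isOpen_iInter_of_finite fun i => isOpen_Ioo.preimage (by fun_prop)
  have hSc : ∀ c, Convex ℝ (S c) := fun c => convex_setOf_re_mem _ fun i => convex_Ioo _ _
  let V : ι → ℂ := fun i => (v i : ℂ)
  have hVS : ∀ c, 2 * C₀ + 1 ≤ c → V ∈ S c := fun c hc i => by
    have h1 := hle i
    have h2 := abs_nonneg (α i)
    have h3 := abs_nonneg (β i)
    have h4 : |v i| < c - C₀ := by linarith
    exact abs_lt.1 (by simpa [V] using h4)
  have box₁ : ∀ c, ∀ l ∈ S c,
      reBox (fun j => (l j).re + c - 1 / 2) (fun j => (l j).re + c + 1 / 2) ⊆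
        {l | ∀ i, α i < (l i).re} := fun c l hl w hw i => by
    have h1 := hle i
    linarith [(hw i).1, (hl i).1, le_abs_self (α i), abs_nonneg (β i), abs_nonneg (v i)]
  have box₂ : ∀ c, ∀ l ∈ S c,
      reBox (fun j => (l j).re + -c - 1 / 2) (fun j => (l j).re + -c + 1 / 2) ⊆
        {l | ∀ i, (l i).re < β i} := fun c l hl w hw i => by
    have h1 := hle i
    linarith [(hw i).2, (hl i).2, neg_abs_le (β i), abs_nonneg (α i), abs_nonneg (v i)]
  have hdiff : ∀ c, 0 < c → ∀ φ, DifferentiableOn ℂ (twoStripInt (f₁ φ) (f₂ φ) c) (S c) :=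
    fun c hc φ l hl => by
      refine (DifferentiableAt.const_mul (DifferentiableAt.sub ?_ ?_) _).differentiableWithinAt
      · exact h₁.differentiableAt_stripInt hq hc.ne' (by norm_num) (box₁ c l hl) φ
      · exact h₂.differentiableAt_stripInt hq (neg_ne_zero.2 hc.ne') (by norm_num) (box₂ c l hl) φ
  have hnear : ∀ c, 0 < c → ∀ φ, twoStripInt (f₁ φ) (f₂ φ) c =ᶠ[𝓝 V] f₁ φ := fun c hc φ => by
    filter_upwards [Metric.ball_mem_nhds V (by norm_num : (0 : ℝ) < 1 / 4)] with l hl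
    refine twoStripInt_eq h₁ h₂ hq hα hβ φ (heq φ) hc fun i => ?_
    have := (Complex.abs_re_le_norm (l i - V i)).trans
      ((Complex.dist_eq _ _).symm.le.trans (dist_le_pi_dist l V i))
    exact lt_of_le_of_lt (by simpa [V] using this) (Metric.mem_ball.1 hl)
  have hV₁ : V ∈ {l : ι → ℂ | ∀ i, α i < (l i).re} := fun i => by
    simp only [V, Complex.ofReal_re]; linarith [hα i]
  have hV₂ : V ∈ {l : ι → ℂ | ∀ i, (l i).re < β i} := fun i => by
    simp only [V, Complex.ofReal_re]; linarith [hβ i]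
  have h12 : ∀ φ, f₁ φ =ᶠ[𝓝 V] f₂ φ := fun φ => by
    filter_upwards [h₁.isOpen.mem_nhds hV₁, h₂.isOpen.mem_nhds hV₂] with l hl hl'
    exact heq φ l hl hl'
  -- The shift must grow with `l`. Formulas with different shifts agree: they coincide with `f₁`
  -- near `V`, which lies in every `S c` with `c ≥ 2 * C₀ + 1`, and these sets are convex.
  let cc : (ι → ℂ) → ℝ := fun l => 2 * C₀ + 1 + ‖l‖
  have hcc : ∀ l, 2 * C₀ + 1 ≤ cc l := fun l => le_add_of_nonneg_right (norm_nonneg l)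
  have hcpos : ∀ l, 0 < cc l := fun l => by linarith [hcc l]
  have hmem : ∀ l, l ∈ S (cc l) := fun l i => by
    have h1 : |(l i).re| ≤ ‖l‖ := (Complex.abs_re_le_norm _).trans (norm_le_pi_norm l i)
    refine abs_lt.1 (lt_of_le_of_lt h1 ?_)
    simp only [cc]; linarith
  refine ⟨fun φ l => twoStripInt (f₁ φ) (f₂ φ) (cc l) l, fun φ l₀ => ?_, fun φ l hl => ?_,
    fun φ l hl => ?_, fun l => ?_⟩
  · have hc1 : 0 < cc l₀ + 1 := by linarith [hcpos l₀]
    have hSub : ∀ c c', c ≤ c' → S c ⊆ S c' := fun c c' h l hl i =>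
      ⟨by linarith [(hl i).1], by linarith [(hl i).2]⟩
    have hd : DifferentiableAt ℂ (twoStripInt (f₁ φ) (f₂ φ) (cc l₀ + 1)) l₀ :=
      (hdiff _ hc1 φ).differentiableAt
        ((hSo _).mem_nhds (hSub _ _ (by linarith) (hmem l₀)))
    refine hd.congr_of_eventuallyEq ?_
    filter_upwards [Metric.ball_mem_nhds l₀ zero_lt_one] with l hl
    have hcl : cc l ≤ cc l₀ + 1 := by
      have h1 : ‖l‖ ≤ ‖l₀‖ + ‖l - l₀‖ := by simpa using norm_add_le l₀ (l - l₀)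
      rw [Metric.mem_ball, dist_eq_norm] at hl
      simp only [cc]; linarith
    exact eqOn_of_convex_of_eventuallyEq (hSo (cc l)) (hSc _) (hdiff _ (hcpos l) φ)
      ((hdiff _ hc1 φ).mono (hSub _ _ hcl)) (hVS _ (hcc l))
      ((hnear _ (hcpos l) φ).trans (hnear _ hc1 φ).symm) (hmem l)
  · exact eqOn_of_convex_of_eventuallyEq ((hSo (cc l)).inter h₁.isOpen)
      ((hSc _).inter (convex_setOf_re_mem (fun i => Set.Ioi (α i)) fun i => convex_Ioi _))
      ((hdiff _ (hcpos l) φ).mono Set.inter_subset_left)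
      ((h₁.differentiableOn φ).mono Set.inter_subset_right) ⟨hVS _ (hcc l), hV₁⟩
      (hnear _ (hcpos l) φ) ⟨hmem l, hl⟩
  · exact eqOn_of_convex_of_eventuallyEq ((hSo (cc l)).inter h₂.isOpen)
      ((hSc _).inter (convex_setOf_re_mem (fun i => Set.Iio (β i)) fun i => convex_Iio _))
      ((hdiff _ (hcpos l) φ).mono Set.inter_subset_left)
      ((h₂.differentiableOn φ).mono Set.inter_subset_right) ⟨hVS _ (hcc l), hV₂⟩
      ((hnear _ (hcpos l) φ).trans (h12 φ)) ⟨hmem l, hl⟩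
  · obtain ⟨N₁, C₁, hC₁, hb₁⟩ := h₁.exists_norm_stripInt_le hq (hcpos l).ne'
      (by norm_num : (0 : ℝ) < 1 / 2) (box₁ _ l (hmem l))
    obtain ⟨N₂, C₂, hC₂, hb₂⟩ := h₂.exists_norm_stripInt_le hq (neg_ne_zero.2 (hcpos l).ne')
      (by norm_num : (0 : ℝ) < 1 / 2) (box₂ _ l (hmem l))
    refine ⟨max N₁ N₂, ‖(2 * (Real.pi : ℂ))⁻¹‖ * (C₁ + C₂), by positivity, fun φ => ?_⟩
    change ‖(2 * (Real.pi : ℂ))⁻¹ *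
      (stripInt (f₁ φ) (cc l) l - stripInt (f₂ φ) (-(cc l)) l)‖ ≤ _
    rw [norm_mul, mul_assoc]
    refine mul_le_mul_of_nonneg_left ((norm_sub_le _ _).trans ?_) (norm_nonneg _)
    rw [add_mul]
    exact add_le_add
      ((hb₁ φ).trans (mul_le_mul_of_nonneg_left (hqm _ _ (le_max_left _ _) φ) hC₁))
      ((hb₂ φ).trans (mul_le_mul_of_nonneg_left (hqm _ _ (le_max_right _ _) φ) hC₂))

end Continuation

/-! ### The gamma function of the cone -/

section GammaCone

variable {m : ℕ}

lemma gamma_ne_zero_of_not_isGammaConePole {l : Fin m → ℂ} (h : ¬ IsGammaConePole l) (j : Fin m) :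
    ∀ p : ℕ, (l j - (j.val : ℂ)) / 2 ≠ -(p : ℂ) := fun p hp => h ⟨j, p, hp⟩

lemma pi_cpow_ne_zero (c : ℂ) : (Real.pi : ℂ) ^ c ≠ 0 := by
  rw [Complex.cpow_ne_zero_iff]
  exact Or.inl (by exact_mod_cast Real.pi_ne_zero)

lemma gammaCone_ne_zero {l : Fin m → ℂ} (h : ¬ IsGammaConePole l) : gammaCone l ≠ 0 :=
  mul_ne_zero (pi_cpow_ne_zero _) (Finset.prod_ne_zero_iff.2 fun j _ =>
    Complex.Gamma_ne_zero (gamma_ne_zero_of_not_isGammaConePole h j))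

lemma not_isGammaConePole_of_re_pos {l : Fin m → ℂ} (h : ∀ j, (j.val : ℝ) < (l j).re) :
    ¬ IsGammaConePole l := by
  rintro ⟨j, p, hp⟩
  have h1 := congrArg Complex.re hp
  have e1 : ((l j - (j.val : ℂ)) / 2).re = ((l j).re - j.val) / 2 := by
    rw [show (2 : ℂ) = ((2 : ℝ) : ℂ) by norm_num, Complex.div_ofReal_re]; simp
  rw [e1] at h1
  simp only [Complex.neg_re, Complex.natCast_re] at h1
  have := h j
  have hp0 : (0 : ℝ) ≤ p := Nat.cast_nonneg p
  linarith

/-- `Complex.Gamma` takes the value 0 at its poles, so the inverse is the entire function 1/Γ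
everywhere, with its correct zeros. -/
lemma differentiable_inv_gammaCone : Differentiable ℂ fun l : Fin m → ℂ => (gammaCone l)⁻¹ := by
  have h : ∀ j ∈ Finset.univ, Differentiable ℂ fun l : Fin m → ℂ =>
      (Complex.Gamma ((l j - (j.val : ℂ)) / 2))⁻¹ := fun j _ =>
    Complex.differentiable_one_div_Gamma.comp
      (by fun_prop : Differentiable ℂ fun l : Fin m → ℂ => (l j - (j.val : ℂ)) / 2)
  have h2 := (differentiable_finsetProd h).const_mul
    ((Real.pi : ℂ) ^ ((m : ℂ) * ((m : ℂ) - 1) / 4))⁻¹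
  have e : (fun l : Fin m → ℂ => (gammaCone l)⁻¹) = fun l =>
      ((Real.pi : ℂ) ^ ((m : ℂ) * ((m : ℂ) - 1) / 4))⁻¹ *
        ∏ j : Fin m, (Complex.Gamma ((l j - (j.val : ℂ)) / 2))⁻¹ := by
    funext l
    rw [gammaCone, mul_inv, Finset.prod_inv_distrib]
  rw [e]
  exact h2

lemma differentiableAt_gammaCone {l : Fin m → ℂ} (h : ¬ IsGammaConePole l) :
    DifferentiableAt ℂ (fun l : Fin m → ℂ => gammaCone l) l := by
  have h1 := (differentiable_inv_gammaCone l).inv (inv_ne_zero (gammaCone_ne_zero h))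
  refine h1.congr_of_eventuallyEq (Eventually.of_forall fun w => ?_)
  exact (inv_inv _).symm

/-- The bound for 1/Γ in each factor; the arguments have imaginary part `(l j).im / 2`, which halves
the rate 4. -/
lemma exists_norm_inv_gammaCone_le (a b : Fin m → ℝ) : ∃ C : ℝ, 0 ≤ C ∧ ∀ l ∈ reBox a b,
    ‖(gammaCone l)⁻¹‖ ≤ C * Real.exp (2 * ∑ i, |(l i).im|) := by
  choose C hC hb using fun j : Fin m =>
    exists_norm_inv_Gamma_le ((a j - j.val) / 2) ((b j - j.val) / 2)
  refine ⟨‖((Real.pi : ℂ) ^ ((m : ℂ) * ((m : ℂ) - 1) / 4))⁻¹‖ * ∏ j, C j,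
    mul_nonneg (norm_nonneg _) (Finset.prod_nonneg fun j _ => hC j), fun l hl => ?_⟩
  rw [gammaCone, mul_inv, norm_mul, mul_assoc, ← Finset.prod_inv_distrib, norm_prod, Finset.mul_sum,
    Real.exp_sum, ← Finset.prod_mul_distrib]
  refine mul_le_mul_of_nonneg_left ?_ (norm_nonneg _)
  refine Finset.prod_le_prod (fun j _ => norm_nonneg _) fun j _ => ?_
  have e : (l j - (j.val : ℂ)) / 2 = ⟨((l j).re - j.val) / 2, (l j).im / 2⟩ := by
    apply Complex.ext
    · rw [show (2 : ℂ) = ((2 : ℝ) : ℂ) by norm_num, Complex.div_ofReal_re]; simp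
    · rw [show (2 : ℂ) = ((2 : ℝ) : ℂ) by norm_num, Complex.div_ofReal_im]; simp
  have h := hb j ((l j - (j.val : ℂ)) / 2) (by rw [e]; simp only; linarith [(hl j).1])
    (by rw [e]; simp only; linarith [(hl j).2])
  refine h.trans (le_of_eq ?_)
  rw [e]
  simp only [abs_div]
  rw [abs_of_pos (zero_lt_two (α := ℝ))]
  ring_nf

end GammaCone

/-! ### The quotient of gamma functions -/

section GammaRatio

/-- The holomorphic version of `Γ_Ω(k₀ - l_*) / Γ_Ω(-l_*)`. -/
noncomputable def gammaRatio {m : ℕ} (k : ℕ) (l : Fin m → ℂ) : ℂ :=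
  if Even k then ∏ j : Fin m, ∏ i ∈ Finset.range (k / 2), ((-revVec l j - (j.val : ℂ)) / 2 + i)
  else gammaCone (constVec m k - revVec l) * (gammaCone (-revVec l))⁻¹

lemma gamma_add_nat (p : ℕ) (s : ℂ) (h : ∀ i < p, s + i ≠ 0) :
    Complex.Gamma (s + p) = (∏ i ∈ Finset.range p, (s + i)) * Complex.Gamma s := by
  induction p with
  | zero => simp
  | succ p ih =>
    rw [Finset.prod_range_succ, Nat.cast_succ, ← add_assoc, Complex.Gamma_add_one _ (h p (by omega)),
      ih fun i hi => h i (by omega)]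
    ring

/-- If a factor on the left vanishes, then `s` is a pole, where `Complex.Gamma` is 0 by convention,
and division by zero makes the right side 0 as well. Otherwise the hypothesis rules out a pole at
`s`. -/
lemma prod_range_eq_gamma_div (p : ℕ) (s : ℂ) (h : ∀ q : ℕ, s + p ≠ -(q : ℂ)) :
    ∏ i ∈ Finset.range p, (s + i) = Complex.Gamma (s + p) / Complex.Gamma s := by
  by_cases h0 : ∀ i < p, s + (i : ℂ) ≠ 0
  · have hs : Complex.Gamma s ≠ 0 := by
      refine Complex.Gamma_ne_zero fun q hq => ?_
      rcases lt_or_ge q p with hqp | hqp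
      · exact h0 q hqp (by rw [hq]; ring)
      · refine h (q - p) ?_
        rw [hq, Nat.cast_sub hqp]; ring
    rw [gamma_add_nat p s h0, mul_div_cancel_right₀ _ hs]
  · push Not at h0
    obtain ⟨i, hi, h1⟩ := h0
    rw [Finset.prod_eq_zero (Finset.mem_range.2 hi) h1,
      (Complex.Gamma_eq_zero_iff s).2 ⟨i, by linear_combination h1⟩, div_zero]

/-- For even `k` the gamma arguments in numerator and denominator differ by the integer `k / 2`; for
odd `k` the equality is the definition. -/
lemma gammaRatio_eq {m k : ℕ} {l : Fin m → ℂ}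
    (h : ¬ IsGammaConePole (constVec m k - revVec l)) :
    gammaRatio k l = gammaCone (constVec m k - revVec l) / gammaCone (-revVec l) := by
  by_cases hk : Even k
  · rw [gammaRatio, if_pos hk, gammaCone, gammaCone, mul_div_mul_left _ _ (pi_cpow_ne_zero _),
      ← Finset.prod_div_distrib]
    obtain ⟨p, rfl⟩ := hk.exists_two_nsmul
    have hp : 2 • p / 2 = p := by simp
    refine Finset.prod_congr rfl fun j _ => ?_
    have e : (-revVec l j - (j.val : ℂ)) / 2 + p =
        ((constVec m (2 • p) - revVec l) j - (j.val : ℂ)) / 2 := by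
      simp only [Pi.sub_apply, constVec]
      rw [nsmul_eq_mul]
      push_cast
      ring
    rw [hp, prod_range_eq_gamma_div p _ fun q => by
      rw [e]; exact gamma_ne_zero_of_not_isGammaConePole h j q, e]
    rfl
  · rw [gammaRatio, if_neg hk, div_eq_mul_inv]

lemma differentiable_revVec {m : ℕ} : Differentiable ℂ fun l : Fin m → ℂ => revVec l := by
  unfold revVec
  fun_prop

lemma differentiableOn_gammaRatio (m k : ℕ) :
    DifferentiableOn ℂ (gammaRatio k : (Fin m → ℂ) → ℂ) (regularSet m k) := by
  have hr := differentiable_revVec (m := m)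
  by_cases hk : Even k
  · refine Differentiable.differentiableOn ?_
    have h : Differentiable ℂ fun l : Fin m → ℂ => ∏ j : Fin m, ∏ i ∈ Finset.range (k / 2),
        ((-revVec l j - (j.val : ℂ)) / 2 + i) :=
      differentiable_finsetProd fun j _ => differentiable_finsetProd fun i _ => by
        unfold revVec
        fun_prop
    have e : (gammaRatio k : (Fin m → ℂ) → ℂ) = fun l => ∏ j : Fin m, ∏ i ∈ Finset.range (k / 2),
        ((-revVec l j - (j.val : ℂ)) / 2 + i) := by
      funext l
      rw [gammaRatio, if_pos hk]
    rw [e]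
    exact h
  · intro l hl
    have h := hl (Nat.not_even_iff_odd.1 hk)
    have h1 : DifferentiableAt ℂ (fun l : Fin m → ℂ => gammaCone (constVec m k - revVec l)) l :=
      (differentiableAt_gammaCone h).comp l
        (f := fun l : Fin m → ℂ => constVec m k - revVec l) (by fun_prop)
    have h2 : DifferentiableAt ℂ (fun l : Fin m → ℂ => (gammaCone (-revVec l))⁻¹) l :=
      (differentiable_inv_gammaCone _).comp l (f := fun l : Fin m → ℂ => -revVec l) (by fun_prop)
    have h3 := h1.mul h2
    refine (h3.congr_of_eventuallyEq (Eventually.of_forall fun w => ?_)).differentiableWithinAt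
    simp only [gammaRatio, if_neg hk]
    rfl

end GammaRatio

/-! ### The inverse Fourier transform -/

section Fourier

variable {n m : ℕ}

/-- The inverse of `fourierS`. -/
noncomputable def fourierSInv (n m : ℕ) : 𝓢(MatSpace n m, ℂ) →L[ℂ] 𝓢(MatSpace n m, ℂ) :=
  ((FourierTransform.fourierCLE ℂ 𝓢(MatSpace n m, ℂ)).symm : 𝓢(MatSpace n m, ℂ) →L[ℂ] _).comp
    (SchwartzMap.compCLMOfContinuousLinearEquiv ℂ (dilation n m).symm)

lemma fourierS_fourierSInv (φ : 𝓢(MatSpace n m, ℂ)) : fourierS n m (fourierSInv n m φ) = φ := by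
  ext x
  have h : fourierS n m (fourierSInv n m φ) x = (FourierTransform.fourierCLE ℂ 𝓢(MatSpace n m, ℂ)
    ((FourierTransform.fourierCLE ℂ 𝓢(MatSpace n m, ℂ)).symm
      (SchwartzMap.compCLMOfContinuousLinearEquiv ℂ (dilation n m).symm φ))) (dilation n m x) := rfl
  rw [h, ContinuousLinearEquiv.apply_symm_apply]
  simp

lemma fourierSInv_fourierS (φ : 𝓢(MatSpace n m, ℂ)) : fourierSInv n m (fourierS n m φ) = φ := by
  have h1 : SchwartzMap.compCLMOfContinuousLinearEquiv ℂ (dilation n m).symm (fourierS n m φ) =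
      FourierTransform.fourierCLE ℂ 𝓢(MatSpace n m, ℂ) φ := by
    ext x
    change FourierTransform.fourierCLE ℂ 𝓢(MatSpace n m, ℂ) φ
      (dilation n m ((dilation n m).symm x)) = _
    rw [ContinuousLinearEquiv.apply_symm_apply]
  change (FourierTransform.fourierCLE ℂ 𝓢(MatSpace n m, ℂ)).symm
    (SchwartzMap.compCLMOfContinuousLinearEquiv ℂ (dilation n m).symm (fourierS n m φ)) = _
  rw [h1, ContinuousLinearEquiv.symm_apply_apply]

lemma dilation_symm_apply (x : MatSpace n m) : (dilation n m).symm x = (-(2 * Real.pi)) • x := by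
  rw [ContinuousLinearEquiv.symm_apply_eq]
  change x = (-(2 * Real.pi)⁻¹) • ((-(2 * Real.pi)) • x)
  have hpi : Real.pi ≠ 0 := Real.pi_ne_zero
  rw [smul_smul, show (-(2 * Real.pi)⁻¹) * (-(2 * Real.pi)) = 1 by field_simp, one_smul]

/-- Conjugation changes the sign of the phase and so turns the transform into an inverse one; the
constant is the Jacobian of the dilation by `-2π`. This is what makes the Parseval form equivalent
to the Fourier formula. -/
lemma conjS_fourierS (φ : 𝓢(MatSpace n m, ℂ)) :
    conjS (fourierS n m φ) = (2 * (Real.pi : ℂ)) ^ (n * m) • fourierSInv n m (conjS φ) := by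
  ext x
  have h1 : fourierSInv n m (conjS φ) x =
      𝓕⁻ (fun y : MatSpace n m => conjS φ ((dilation n m).symm y)) x := by
    change (𝓕⁻ (SchwartzMap.compCLMOfContinuousLinearEquiv ℂ (dilation n m).symm (conjS φ)) :
      𝓢(MatSpace n m, ℂ)) x = _
    rw [SchwartzMap.fourierInv_coe]
    rfl
  rw [smul_apply, smul_eq_mul, h1, conjS_apply, fourierS_apply, Real.fourierInv_eq']
  set G : MatSpace n m → ℂ := fun u => Complex.exp (-(Complex.I * (inner ℝ u x : ℝ))) *
    starRingEnd ℂ (φ u) with hG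
  have h2 : ∀ y : MatSpace n m, Complex.exp (((2 * Real.pi * inner ℝ y x : ℝ) : ℂ) * Complex.I) •
      conjS φ ((dilation n m).symm y) = G ((-(2 * Real.pi)) • y) := fun y => by
    rw [dilation_symm_apply, conjS_apply, hG]
    simp only [inner_smul_left, smul_eq_mul]
    congr 2
    push_cast
    simp
    ring
  rw [integral_congr_ae (Eventually.of_forall h2), Measure.integral_comp_smul volume G,
    ← integral_conj]
  have hcard : Module.finrank ℝ (MatSpace n m) = n * m := by simp
  have hpos : (0 : ℝ) < (2 * Real.pi) ^ (n * m) := by positivity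
  rw [hcard, abs_inv, abs_pow, abs_neg, abs_of_pos (by positivity : (0 : ℝ) < 2 * Real.pi),
    Complex.real_smul, ← mul_assoc]
  have h3 : (2 * (Real.pi : ℂ)) ^ (n * m) * ((((2 * Real.pi) ^ (n * m))⁻¹ : ℝ) : ℂ) = 1 := by
    push_cast
    exact mul_inv_cancel₀ (by exact_mod_cast hpos.ne')
  rw [h3, one_mul]
  refine integral_congr_ae (Eventually.of_forall fun u => ?_)
  simp only [hG, map_mul, ← inner_eq_trace]
  rw [← Complex.exp_conj, map_mul, Complex.conj_I, Complex.conj_ofReal, neg_mul]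

end Fourier

/-! ### Growth in the imaginary directions -/

section Growth

lemma HasStripGrowth.mul_left {ι X : Type*} [Fintype ι] {q : ℕ → X → ℝ} {D : Set (ι → ℂ)}
    {f : X → (ι → ℂ) → ℂ} (hf : HasStripGrowth q D f) {G : (ι → ℂ) → ℂ} (hG : Differentiable ℂ G)
    (hGb : ∀ a b : ι → ℝ, ∃ C A : ℝ, 0 ≤ C ∧ 0 ≤ A ∧ ∀ l ∈ reBox a b,
      ‖G l‖ ≤ C * Real.exp (A * ∑ i, |(l i).im|)) :
    HasStripGrowth q D fun φ l => G l * f φ l := by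
  refine ⟨hf.isOpen, fun φ => hG.differentiableOn.mul (hf.differentiableOn φ), fun a b hab => ?_⟩
  obtain ⟨N, C, A, hC, hA, h⟩ := hf.bound a b hab
  obtain ⟨C', A', hC', hA', h'⟩ := hGb a b
  refine ⟨N, C' * C, A' + A, by positivity, by positivity, fun φ l hl => ?_⟩
  rw [norm_mul]
  calc _ ≤ (C' * Real.exp (A' * ∑ i, |(l i).im|)) * (C * Real.exp (A * ∑ i, |(l i).im|) * q N φ) :=
        mul_le_mul (h' l hl) (h φ l hl) (norm_nonneg _) (by positivity)
    _ = _ := by rw [add_mul, Real.exp_add]; ring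

variable {n m : ℕ}

lemma exists_norm_inv_gammaCone_add_le (k n : ℕ) (a b : Fin m → ℝ) :
    ∃ C A : ℝ, 0 ≤ C ∧ 0 ≤ A ∧ ∀ l ∈ reBox a b,
      ‖(gammaCone (l + constVec m k + constVec m n))⁻¹‖ ≤ C * Real.exp (A * ∑ i, |(l i).im|) := by
  obtain ⟨C, hC, h⟩ := exists_norm_inv_gammaCone_le (fun i => a i + k + n) (fun i => b i + k + n)
  refine ⟨C, 2, hC, zero_le_two, fun l hl => ?_⟩
  have := h (l + constVec m k + constVec m n) fun i => by
    simp only [Pi.add_apply, constVec, Complex.add_re, Complex.natCast_re]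
    constructor <;> linarith [(hl i).1, (hl i).2]
  simpa [constVec] using this

lemma dConst_ne_zero (n k : ℕ) (l : Fin m → ℂ) : dConst n k l ≠ 0 := by
  refine mul_ne_zero (mul_ne_zero ?_ (pi_cpow_ne_zero _)) (pow_ne_zero _ Complex.I_ne_zero)
  rw [Complex.cpow_ne_zero_iff]; exact Or.inl two_ne_zero

lemma differentiable_dConst (n k : ℕ) : Differentiable ℂ fun l : Fin m → ℂ => dConst n k l := by
  have h : Differentiable ℂ fun l : Fin m → ℂ => (2 : ℂ) ^ (-∑ j, l j) := fun l =>
    DifferentiableAt.const_cpow (by fun_prop) (Or.inl two_ne_zero)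
  exact (h.mul_const _).mul_const _

lemma exists_norm_inv_dConst_mul_gammaCone_le (n k : ℕ) (a b : Fin m → ℝ) :
    ∃ C A : ℝ, 0 ≤ C ∧ 0 ≤ A ∧ ∀ l ∈ reBox a b,
      ‖(dConst n k l * gammaCone (constVec m k - revVec l))⁻¹‖ ≤
        C * Real.exp (A * ∑ i, |(l i).im|) := by
  obtain ⟨C, hC, h⟩ := exists_norm_inv_gammaCone_le (fun i => k - b i.rev) (fun i => k - a i.rev)
  set K : ℂ := (Real.pi : ℂ) ^ ((n : ℂ) * (m : ℂ) / 2) * Complex.I ^ (k * m) with hK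
  refine ⟨(2 : ℝ) ^ (∑ j, b j) * ‖K⁻¹‖ * C, 2, by positivity, zero_le_two, fun l hl => ?_⟩
  have h1 := h (constVec m k - revVec l) fun i => by
    simp only [Pi.sub_apply, constVec, revVec, Complex.sub_re, Complex.natCast_re]
    constructor <;> linarith [(hl i.rev).1, (hl i.rev).2]
  have him : ∑ i, |((constVec m k - revVec l) i).im| = ∑ i, |(l i).im| := by
    rw [← Equiv.sum_comp Fin.revPerm fun i => |(l i).im|]
    refine Finset.sum_congr rfl fun i _ => ?_
    simp [constVec, revVec]
  rw [him] at h1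
  have h2 : ‖(dConst n k l)⁻¹‖ ≤ (2 : ℝ) ^ (∑ j, b j) * ‖K⁻¹‖ := by
    rw [dConst, mul_assoc, ← hK, mul_inv, norm_mul, Complex.cpow_neg, inv_inv,
      show (2 : ℂ) = ((2 : ℝ) : ℂ) by norm_num, Complex.norm_cpow_eq_rpow_re_of_pos two_pos]
    refine mul_le_mul_of_nonneg_right ?_ (norm_nonneg _)
    refine Real.rpow_le_rpow_of_exponent_le one_le_two ?_
    rw [Complex.re_sum]
    exact Finset.sum_le_sum fun j _ => (hl j).2
  rw [mul_inv, norm_mul, mul_assoc ((2 : ℝ) ^ (∑ j, b j) * ‖K⁻¹‖)]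
  exact mul_le_mul h2 h1 (norm_nonneg _) (by positivity)

lemma reBox_eq_empty {ι : Type*} {a b : ι → ℝ} (h : ¬ ∀ i, a i ≤ b i) (l : ι → ℂ) :
    l ∉ reBox a b := fun hl => h fun i => (hl i).1.trans (hl i).2

lemma ofReal_mem_reBox {ι : Type*} {a b c : ι → ℝ} (h₁ : ∀ i, a i ≤ c i) (h₂ : ∀ i, c i ≤ b i) :
    (fun i => (c i : ℂ)) ∈ reBox a b := fun i => by simpa using ⟨h₁ i, h₂ i⟩

variable {A : MatSpace n m → ℂ}

lemma hasStripGrowth_powInt {S : MatSpace n m → Matrix (Fin m) (Fin m) ℝ} (hS : IsPowIntegrable S)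
    (hA : IsEssBounded A) :
    HasStripGrowth decaySeminorm {l : Fin m → ℂ | ∀ i, (i.val : ℝ) - n < (l i).re}
      fun φ l => powInt S A l φ := by
  refine ⟨isOpen_powDomain n m, fun φ => differentiableOn_powInt hS hA φ, fun a b hab => ?_⟩
  -- A nonempty box contains its real corner `a`, which gives the strict lower bounds for `a`; for
  -- an empty box there is nothing to prove.
  by_cases h : ∀ i, a i ≤ b i
  · have ha : ∀ i, (i.val : ℝ) - n < a i := fun i => by
      simpa using hab (ofReal_mem_reBox (fun i => le_rfl) h) i
    obtain ⟨N, C, hC, hb⟩ := exists_norm_powInt_le hS hA ha fun i => (ha i).trans_le (h i)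
    refine ⟨N, C, 0, hC, le_rfl, fun φ l hl => ?_⟩
    simpa using hb l (fun i => (hl i).1) (fun i => (hl i).2) φ
  · exact ⟨0, 0, 0, le_rfl, le_rfl, fun φ l hl => absurd hl (reBox_eq_empty h l)⟩

lemma differentiable_dualExp (n : ℕ) : Differentiable ℂ fun l : Fin m → ℂ => dualExp n l := by
  unfold dualExp revVec
  fun_prop

lemma hasStripGrowth_powInt_dualExp {S : MatSpace n m → Matrix (Fin m) (Fin m) ℝ}
    (hS : IsPowIntegrable S) (hA : IsEssBounded A)
    (L : 𝓢(MatSpace n m, ℂ) →L[ℂ] 𝓢(MatSpace n m, ℂ)) :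
    HasStripGrowth decaySeminorm {l : Fin m → ℂ | ∀ i, (l i).re < (i.val : ℝ) + 1 - m}
      fun φ l => powInt S A (dualExp n l) (L φ) := by
  refine ⟨isOpen_setOf_lt_re _, fun φ => ?_, fun a b hab => ?_⟩
  · exact (differentiableOn_powInt hS hA (L φ)).comp (differentiable_dualExp n).differentiableOn
      fun l hl => dualExp_mem_powDomain n hl
  by_cases h : ∀ i, a i ≤ b i
  · have hre : ∀ (l : Fin m → ℂ) (i : Fin m), (dualExp n l i).re = -(l i.rev).re - n := fun l i => by
      simp [dualExp, revVec, constVec]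
    have hlo : ∀ i : Fin m, (i.val : ℝ) - n < -b i.rev - n := fun i => by
      have := dualExp_mem_powDomain n (hab (ofReal_mem_reBox h fun i => le_rfl)) i
      rw [hre] at this
      simpa using this
    obtain ⟨N, C, hC, hb⟩ := exists_norm_powInt_le hS hA (b := fun i => -a i.rev - n) hlo fun i =>
      (hlo i).trans_le (by linarith [h i.rev])
    obtain ⟨N', C', hC', hL⟩ := exists_decaySeminorm_comp_le L N
    refine ⟨N', C * C', 0, by positivity, le_rfl, fun φ l hl => ?_⟩
    have h1 := hb (dualExp n l) (fun i => by rw [hre]; linarith [(hl i.rev).2])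
      (fun i => by rw [hre]; linarith [(hl i.rev).1]) (L φ)
    rw [zero_mul, Real.exp_zero, mul_one, mul_assoc]
    exact h1.trans (mul_le_mul_of_nonneg_left (hL φ) hC)
  · exact ⟨0, 0, 0, le_rfl, le_rfl, fun φ l hl => absurd hl (reBox_eq_empty h l)⟩

end Growth

section Assembly

variable {n m : ℕ}

/-- A linear functional on Schwartz functions that is bounded by a decay seminorm. -/
noncomputable def schwartzFunctional (A : 𝓢(MatSpace n m, ℂ) → ℂ)
    (hadd : ∀ φ ψ, A (φ + ψ) = A φ + A ψ) (hsmul : ∀ (c : ℂ) φ, A (c • φ) = c * A φ)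
    (hb : ∃ (N : ℕ) (C : ℝ), 0 ≤ C ∧ ∀ φ, ‖A φ‖ ≤ C * decaySeminorm N φ) :
    𝓢(MatSpace n m, ℂ) →L[ℂ] ℂ :=
  SchwartzMap.mkCLMtoNormedSpace A hadd hsmul (by
    obtain ⟨N, C, hC, h⟩ := hb
    refine ⟨Finset.Iic (N, N), C * 2 ^ N, by positivity, fun φ => (h φ).trans (le_of_eq ?_)⟩
    rw [decaySeminorm, mul_assoc])

lemma not_isGammaConePole_constVec_sub (k : ℕ) {l : Fin m → ℂ}
    (h : ∀ i, (l i).re < (i.val : ℝ) + 1 - m) : ¬ IsGammaConePole (constVec m k - revVec l) :=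
  not_isGammaConePole_of_re_pos fun j => by
    have hk0 : (0 : ℝ) ≤ k := Nat.cast_nonneg k
    have h1 := dualExp_mem_powDomain 0 h j
    simp only [dualExp, Pi.sub_apply, Pi.neg_apply, constVec, revVec, Complex.sub_re,
      Complex.neg_re, Complex.natCast_re, Nat.cast_zero, sub_zero] at h1 ⊢
    linarith

/-- The entire family of tempered distributions that continues `P(v) r ^ l / Γ_Ω(l + k₀ + n₀)`. -/
theorem exists_entire_family (hmn : m ≤ n) {k : ℕ} {P : MvPolynomial (Fin n × Fin m) ℂ}
    (hharm : IsHarmonicPoly P) (hdet : IsDetHomogeneous k P) :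
    ∃ R : (Fin m → ℂ) → (𝓢(MatSpace n m, ℂ) →L[ℂ] ℂ),
      (∀ φ, Differentiable ℂ fun l => R l φ) ∧
      (∀ φ l, (∀ i, (i.val : ℝ) - n < (l i).re) →
        R l φ = (gammaCone (l + constVec m k + constVec m n))⁻¹ *
          powInt (fun x => radial x) (fun x => evalMat P (angular x)) l φ) ∧
      (∀ φ l, (∀ i, (l i).re < (i.val : ℝ) + 1 - m) →
        R l φ = (dConst n k l * gammaCone (constVec m k - revVec l))⁻¹ *
          powInt (fun x => revMat (radial x)) (fun x => evalMat P (angular x)) (dualExp n l)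
            (fourierS n m φ)) := by
  have hA := isEssBounded_evalMat_angular hmn hdet
  have hr := differentiable_revVec (m := m)
  have h₁ := (hasStripGrowth_powInt (isPowIntegrable_radial (n := n) hmn) hA).mul_left
    (G := fun l => (gammaCone (l + constVec m k + constVec m n))⁻¹)
    (differentiable_inv_gammaCone.comp
      (by fun_prop : Differentiable ℂ fun l : Fin m → ℂ => l + constVec m k + constVec m n))
    (exists_norm_inv_gammaCone_add_le k n)
  have h₂ := (hasStripGrowth_powInt_dualExp (isPowIntegrable_revMat_radial (n := n) hmn) hA
    (fourierS n m)).mul_left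
    (G := fun l => (dConst n k l * gammaCone (constVec m k - revVec l))⁻¹)
    (by
      have hd : Differentiable ℂ fun l : Fin m → ℂ => (dConst n k l)⁻¹ := fun l =>
        (differentiable_dConst n k l).inv (dConst_ne_zero n k l)
      have hg : Differentiable ℂ fun l : Fin m → ℂ => (gammaCone (constVec m k - revVec l))⁻¹ :=
        differentiable_inv_gammaCone.comp
          (by fun_prop : Differentiable ℂ fun l : Fin m → ℂ => constVec m k - revVec l)
      simp only [mul_inv]
      exact hd.mul hg)
    (exists_norm_inv_dConst_mul_gammaCone_le n k)
  have hmn' : (m : ℝ) ≤ n := by exact_mod_cast hmn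
  have hk0 : (0 : ℝ) ≤ k := Nat.cast_nonneg k
  -- `v` is the midpoint of the overlap, from `i - n` to `i + 1 - m` in each coordinate. Its
  -- half-width `(n - m + 1) / 2` is at least 1/2 because `m ≤ n`.
  obtain ⟨F, hF, hF₁, hF₂, hFb⟩ := exists_entire_extension h₁ h₂
    (v := fun i => (i.val : ℝ) + (1 - m - n) / 2)
    (fun N φ => decaySeminorm_nonneg N φ) (fun N N' h φ => decaySeminorm_mono h φ)
    (fun i => by linarith) (fun i => by linarith)
    (fun φ l hl₁ hl₂ => by
      have hfe := gammaCone_mul_powInt_fourierS hmn hharm hdet hl₁ hl₂ φ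
      have n₁ : gammaCone (l + constVec m k + constVec m n) ≠ 0 :=
        gammaCone_ne_zero (not_isGammaConePole_of_re_pos fun j => by
          simp only [Pi.add_apply, constVec, Complex.add_re, Complex.natCast_re]
          linarith [hl₁ j])
      have n₂ : gammaCone (constVec m k - revVec l) ≠ 0 :=
        gammaCone_ne_zero (not_isGammaConePole_constVec_sub k hl₂)
      have n₃ := dConst_ne_zero n k l
      field_simp
      linear_combination -hfe)
  set O : Set (Fin m → ℂ) := {l | ∀ i : Fin m, (i.val : ℝ) - n < (l i).re} with hO
  have hv : (fun _ => (m : ℂ)) ∈ O := fun i => by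
    have h1 : (i.val : ℝ) < m := by exact_mod_cast i.2
    simp only [Complex.natCast_re]
    have h2 : (0 : ℝ) ≤ n := Nat.cast_nonneg n
    linarith
  -- Linearity in the test function is clear where the integral converges and propagates to all `l`
  -- by the identity theorem.
  have hid : ∀ f g : (Fin m → ℂ) → ℂ, Differentiable ℂ f → Differentiable ℂ g → (∀ l ∈ O, f l = g l) →
      ∀ l, f l = g l := fun f g hf hg h l =>
    eqOn_of_convex_of_eventuallyEq isOpen_univ convex_univ hf.differentiableOn hg.differentiableOn
      (Set.mem_univ _) (eventually_of_mem ((isOpen_powDomain n m).mem_nhds hv) h) (Set.mem_univ l)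
  refine ⟨fun l => schwartzFunctional (fun φ => F φ l) (fun φ ψ => ?_) (fun c φ => ?_) (hFb l),
    hF, hF₁, hF₂⟩
  · refine hid (F (φ + ψ)) (fun l => F φ l + F ψ l) (hF _) ((hF φ).add (hF ψ)) (fun l hl => ?_) l
    simp only [hF₁ _ l hl, powInt_add (isPowIntegrable_radial (n := n) hmn) hA hl]
    ring
  · refine hid (F (c • φ)) (fun l => c * F φ l) (hF _) ((hF φ).const_mul c) (fun l hl => ?_) l
    simp only [hF₁ _ l hl, powInt_smul]
    ring

end Assembly

end CompositeCosine

/-! ### The Fourier transform of the composite powers -/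

theorem theorem4p6 (n m k : ℕ) (hm : 1 ≤ m) (hmn : m ≤ n)
    (P : MvPolynomial (Fin n × Fin m) ℂ) (hharm : IsHarmonicPoly P)
    (hdet : IsDetHomogeneous k P) :
    ∃ (Φ R : (Fin m → ℂ) → 𝓢'(MatSpace n m, ℂ)) (ρ : (Fin m → ℂ) → ℂ),
      -- `Φ l` is `r_* ^ (-l_* - n₀) P(v) / Γ_Ω(-l_*)`, continued from its domain of convergence
      (∀ φ : 𝓢(MatSpace n m, ℂ), DifferentiableOn ℂ (fun l => Φ l φ) (regularSet m k)) ∧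
      (∀ l : Fin m → ℂ, (∀ j : Fin m, (l j).re < ((j.val : ℝ) + 1) - m) →
        IsRegularDist (Φ l) (fun x =>
          compPow (revMat (radial x)) (-revVec l - constVec m n) / gammaCone (-revVec l)
            * evalMat P (angular x))) ∧
      -- `R l` is `P(v) r ^ l / Γ_Ω(l + k₀ + n₀)`, continued from its domain of convergence
      (∀ φ : 𝓢(MatSpace n m, ℂ), Differentiable ℂ (fun l => R l φ)) ∧
      (∀ l : Fin m → ℂ, (∀ j : Fin m, ((j.val : ℝ) + 1) - n - 1 < (l j).re) →
        IsRegularDist (R l) (fun x =>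
          evalMat P (angular x) * compPow (radial x) l
            / gammaCone (l + constVec m k + constVec m n))) ∧
      -- `ρ l` is `Γ_Ω(k₀ - l_*) / Γ_Ω(-l_*)`, with its removable singularities removed
      DifferentiableOn ℂ ρ (regularSet m k) ∧
      (∀ l : Fin m → ℂ, ¬ IsGammaConePole (constVec m k - revVec l) →
        ρ l = gammaCone (constVec m k - revVec l) / gammaCone (-revVec l)) ∧
      -- the formula for the Fourier transform, and its form as a Parseval equality
      ∀ l ∈ regularSet m k,
        fourierDist (Φ l) = (dConst n k l * ρ l) • R l ∧
        ∀ φ : 𝓢(MatSpace n m, ℂ),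
          dConst n k l * ρ l * R l (conjS (fourierS n m φ))
            = (2 * (Real.pi : ℂ)) ^ (n * m) * Φ l (conjS φ) := by
  obtain ⟨R, hRd, hR₁, hR₂⟩ := exists_entire_family hmn hharm hdet
  have hA := isEssBounded_evalMat_angular hmn hdet
  have hΦ : ∀ l φ, ((dConst n k l * gammaRatio k l) • (R l).comp (fourierSInv n m)) φ =
      dConst n k l * gammaRatio k l * R l (fourierSInv n m φ) := fun l φ => rfl
  -- Defining `Φ` through `R` and the inverse Fourier transform makes the Fourier formula immediate,
  -- and its holomorphy is that of `dConst`, `gammaRatio` and `R`. What remains to be shown is that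
  -- `Φ` is the given regular distribution.
  refine ⟨fun l => ContinuousLinearMap.toPointwiseConvergenceCLM _ _ _ _
      ((dConst n k l * gammaRatio k l) • (R l).comp (fourierSInv n m)),
    fun l => ContinuousLinearMap.toPointwiseConvergenceCLM _ _ _ _ (R l), gammaRatio k,
    fun φ => ?_, fun l hl φ => ?_, hRd, fun l hl φ => ?_, differentiableOn_gammaRatio m k,
    fun l hl => gammaRatio_eq hl, fun l _ => ⟨?_, fun φ => ?_⟩⟩
  · exact ((differentiable_dConst n k).differentiableOn.mul (differentiableOn_gammaRatio m k)).mul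
      (hRd (fourierSInv n m φ)).differentiableOn
  · have hI := (integrable_powInt (isPowIntegrable_revMat_radial (n := n) hmn) hA
      (dualExp_mem_powDomain n hl) φ).const_mul (gammaCone (-revVec l))⁻¹
    have e : ∀ x : MatSpace n m, (gammaCone (-revVec l))⁻¹ *
        (compPow (revMat (radial x)) (dualExp n l) * evalMat P (angular x) * φ x) =
        compPow (revMat (radial x)) (-revVec l - constVec m n) / gammaCone (-revVec l)
            * evalMat P (angular x) * φ x := fun x => by
      rw [dualExp]; ring
    refine ⟨hI.congr (Eventually.of_forall e), ?_⟩
    change dConst n k l * gammaRatio k l * R l (fourierSInv n m φ) = _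
    have hnp := not_isGammaConePole_constVec_sub k hl
    -- In the convergence domain `R` is a zeta integral of a Fourier transform, and composing with
    -- the inverse transform restores φ. The factors d_λ and Γ_Ω(k₀ - λ_*) cancel, leaving
    -- 1/Γ_Ω(-λ_*).
    rw [hR₂ _ l hl, fourierS_fourierSInv, gammaRatio_eq hnp,
      ← integral_congr_ae (Eventually.of_forall e), integral_const_mul]
    have n₁ := gammaCone_ne_zero hnp
    have n₂ := dConst_ne_zero n k l
    change _ = (gammaCone (-revVec l))⁻¹ *
      powInt (fun x => revMat (radial x)) (fun x => evalMat P (angular x)) (dualExp n l) φ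
    field_simp
  · have hl' : ∀ i : Fin m, (i.val : ℝ) - n < (l i).re := fun i => by linarith [hl i]
    have hI := (integrable_powInt (isPowIntegrable_radial (n := n) hmn) hA hl' φ).const_mul
      (gammaCone (l + constVec m k + constVec m n))⁻¹
    have e : ∀ x : MatSpace n m, (gammaCone (l + constVec m k + constVec m n))⁻¹ *
        (compPow (radial x) l * evalMat P (angular x) * φ x) =
        evalMat P (angular x) * compPow (radial x) l
            / gammaCone (l + constVec m k + constVec m n) * φ x := fun x => by ring
    refine ⟨hI.congr (Eventually.of_forall e), ?_⟩
    change R l φ = _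
    rw [hR₁ _ l hl', ← integral_congr_ae (Eventually.of_forall e), integral_const_mul]
    rfl
  · ext φ
    change dConst n k l * gammaRatio k l * R l (fourierSInv n m (fourierS n m φ)) =
      (dConst n k l * gammaRatio k l) * R l φ
    rw [fourierSInv_fourierS]
  · change dConst n k l * gammaRatio k l * R l (conjS (fourierS n m φ)) =
      (2 * (Real.pi : ℂ)) ^ (n * m) * (dConst n k l * gammaRatio k l *
        R l (fourierSInv n m (conjS φ)))
    rw [conjS_fourierS, map_smul, smul_eq_mul]
    ring
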